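/- There are constants $K_{k,\theta}$ (depending only on $k$ and $\theta$) and $\gamma(\beta)\in(0,1)$ (depending only on $\beta$) such that the following holds for all positive integers $k$, all $\theta\in(0,1)$ and all $\beta\in(0,\pi/4)$. Let $X$ be a $\sigma$-finite metric measure space with measure $\mu$, let $L$ be a positive self-adjoint operator on $L^2(X)$ and write $H_t=\exp(-tL)$, $P_t=\exp(-tL^{1/2})$ and $P_{t,k}=(tL^{1/2})^kP_t$. Let $\{G_t=\exp(-tM)\}$ be a bounded strongly continuous positivity-preserving semigroup on $L^2(X)$ (that is, $G_tf\ge 0$ if $f\ge 0$) with generator $-M$, and let $Q_t=\exp(-tM^{1/2})$ be its Poisson semigroup. Suppose that for some constant $C>0$ $$|H_tf|\le C\,G_t|f| \qquad\text{for all } f\in L^2(X) \text{ and all } t>0 .$$ All pointwise inequalities below hold almost everywhere. Write $\bar\Gamma_\beta=\{z\in\mathbb C: |\arg z|\le\beta\}\cup\{0\}$. Then: (a) For all $t>0$, the operator $P_t$ maps $L^2(X)$ into the domain of $(tL^{1/2})^k$, and $$|P_{t,k}f|\le K_{k,\theta}\,C\,Q_{\theta t}|f|\qquad\text{for all } f\in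 L^2(X).$$ (b) The semigroup $\{P_t\}$ extends to a complex semigroup $\{P_z=\exp(-zL^{1/2}): z\in\bar\Gamma_\beta\}$, holomorphic in the interior of $\bar\Gamma_\beta$ and strongly continuous on $\bar\Gamma_\beta$, and with $\gamma=\gamma(\beta)$ $$|P_zf|\le \sqrt2\,\gamma^{-1}\,C\,Q_{\gamma\operatorname{Re}z}|f|\qquad\text{for all } z\in\bar\Gamma_\beta \text{ and } f\in L^2(X).$$ Suppose further that balls in $X$ have finite measure and that, for all $t>0$, $H_t$ and $G_t$ have kernels $h_t$ and $g_t$. Here an operator $T$ has the kernel $k$ when $k$ is integrable on bounded subsets of $X\times X$ and $\langle Tf,g\rangle=\iint k(x,y)f(y)\overline{g(x)}\,d\mu(y)\,d\mu(x)$, with absolute convergence, for all $f,g\in L^2(X)$. Then: (c) For all $t>0$, the operators $Q_t$, $P_t$ and $P_{t,k}$ have kernels $q_t$, $p_t$ and $p_{t,k}$, and $|p_{t,k}(x,y)|\le K_{k,\theta}\,C\,q_{\theta t}(x,y)$. (d) For all $z\in\bar\Gamma_\beta\setminus\{0\}$, the operator $P_z$ has a kernel $p_z$, and with $\gamma=\gamma(\beta)$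 we have $|p_z(x,y)|\le\sqrt2\,\gamma^{-1}\,C\,q_{\gamma\operatorname{Re}z}(x,y)$. -/

import Mathlib

open MeasureTheory Filter Topology
open scoped ENNReal NNReal ComplexOrder

noncomputable section

namespace PoissonDomination

section Operators

variable {E : Type*} [NormedAddCommGroup E] [NormedSpace ℂ E]

/-- `T t`, `t ≥ 0`, is a strongly continuous one-parameter semigroup of bounded operators
(the values of `T` at negative times play no role). -/
structure IsC0Semigroup (T : ℝ → E →L[ℂ] E) : Prop where
  zero : T 0 = 1
  add : ∀ s t : ℝ, 0 ≤ s → 0 ≤ t → T (s + t) = T s * T t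
  tendsto : ∀ f : E, Tendsto (fun t : ℝ => T t f) (𝓝[>] 0) (𝓝 f)

/-- `T t = exp (-t A)`: `T` is a strongly continuous semigroup and `-A` is its infinitesimal
generator, i.e. `f ∈ dom A` and `A f = g` exactly when `(f - T t f) / t → g` as `t → 0+`. -/
structure IsSemigroupOf (T : ℝ → E →L[ℂ] E) (A : E →ₗ.[ℂ] E) : Prop extends
    IsC0Semigroup T where
  generator : ∀ f g : E, (f, g) ∈ A.graph ↔
    Tendsto (fun t : ℝ => ((t⁻¹ : ℝ) : ℂ) • (f - T t f)) (𝓝[>] 0) (𝓝 g)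

/-- The semigroup is uniformly bounded on `[0, ∞)`. -/
def IsBoundedSemigroup (T : ℝ → E →L[ℂ] E) : Prop :=
  ∃ B : ℝ, ∀ t : ℝ, 0 ≤ t → ‖T t‖ ≤ B

open Classical in
/-- `opExp A t = exp (-t A)` for `t ≥ 0`: the strongly continuous semigroup with generator `-A`
(which is unique on `[0, ∞)`); the value is `0` when `-A` is not a generator. -/
def opExp (A : E →ₗ.[ℂ] E) : ℝ → E →L[ℂ] E :=
  if h : ∃ T : ℝ → E →L[ℂ] E, IsSemigroupOf T A then h.choose else 0

/-- `B ∘ B = A` as unbounded operators, with the natural domain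
`dom A = {f ∈ dom B : B f ∈ dom B}`. -/
def IsSquareRoot (B A : E →ₗ.[ℂ] E) : Prop :=
  ∀ f g : E, (f, g) ∈ A.graph ↔ ∃ w : E, (f, w) ∈ B.graph ∧ (w, g) ∈ B.graph

open Classical in
/-- The square root `A ^ (1/2)` of an operator `A` for which `-A` generates a bounded strongly
continuous semigroup: the unique `B` with `B ∘ B = A` such that `-B` generates a bounded strongly
continuous semigroup. When `A` is positive and self-adjoint, this is the positive self-adjoint
square root of `A` given by the spectral theorem. The value is `0` when there is no such `B`. -/
def opSqrt (A : E →ₗ.[ℂ] E) : E →ₗ.[ℂ] E :=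
  if h : ∃ B : E →ₗ.[ℂ] E, IsSquareRoot B A ∧
      ∃ T : ℝ → E →L[ℂ] E, IsSemigroupOf T B ∧ IsBoundedSemigroup T
  then h.choose else 0

/-- `IsPowApply A k f g`: `f` lies in the domain of `A ^ k` and `A ^ k f = g`. -/
def IsPowApply (A : E →ₗ.[ℂ] E) : ℕ → E → E → Prop
  | 0, f, g => f = g
  | k + 1, f, g => ∃ w : E, (f, w) ∈ A.graph ∧ IsPowApply A k w g

/-- The Poisson semigroup `exp (-t A ^ (1/2))` associated to `A`. -/
def poisson (A : E →ₗ.[ℂ] E) (t : ℝ) : E →L[ℂ] E := opExp (opSqrt A) t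

/-- `S = (t A ^ (1/2)) ^ k exp (-t A ^ (1/2))`, where it is part of the assertion that
`exp (-t A ^ (1/2))` maps into the domain of `(t A ^ (1/2)) ^ k`. -/
def IsPoissonDeriv (A : E →ₗ.[ℂ] E) (t : ℝ) (k : ℕ) (S : E →L[ℂ] E) : Prop :=
  ∀ f : E, IsPowApply ((t : ℂ) • opSqrt A) k (poisson A t f) (S f)

open Classical in
/-- The operator `(t A ^ (1/2)) ^ k exp (-t A ^ (1/2))` (`0` if it is not a bounded operator
defined everywhere). -/
def poissonDeriv (A : E →ₗ.[ℂ] E) (t : ℝ) (k : ℕ) : E →L[ℂ] E :=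
  if h : ∃ S : E →L[ℂ] E, IsPoissonDeriv A t k S then h.choose else 0

/-- The closed sector `{z : |arg z| ≤ β}`; it contains `0` if `β ≥ 0`, as `Complex.arg 0 = 0`. -/
def closedSector (β : ℝ) : Set ℂ := {z | |z.arg| ≤ β}

/-- The open sector `{z ≠ 0 : |arg z| < β}`. -/
def openSector (β : ℝ) : Set ℂ := {z | z ≠ 0 ∧ |z.arg| < β}

/-- `P z`, `z` in the closed sector of half-angle `β`, is a semigroup of bounded operators,
holomorphic (in operator norm) inside the sector and strongly continuous on the closed sector. -/
structure IsComplexSemigroup (β : ℝ) (P : ℂ → E →L[ℂ] E) : Prop where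
  zero : P 0 = 1
  add : ∀ z ∈ closedSector β, ∀ w ∈ closedSector β, P (z + w) = P z * P w
  holomorphic : DifferentiableOn ℂ P (openSector β)
  continuous : ∀ f : E, ContinuousOn (fun z => P z f) (closedSector β)

/-- `P z = exp (-z A ^ (1/2))` on the closed sector: `P` is a complex semigroup there which extends
the Poisson semigroup, and on each ray `s ↦ s z` it is the semigroup with generator
`-z A ^ (1/2)`. -/
structure IsPoissonExtension (A : E →ₗ.[ℂ] E) (β : ℝ) (P : ℂ → E →L[ℂ] E) : Prop extends
    IsComplexSemigroup β P where
  extends_poisson : ∀ t : ℝ, 0 ≤ t → P (t : ℂ) = poisson A t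
  generator : ∀ z ∈ closedSector β, z ≠ 0 →
    IsSemigroupOf (fun s : ℝ => P ((s : ℂ) * z)) (z • opSqrt A)

end Operators

/-- A positive self-adjoint (in general unbounded) operator on a Hilbert space. -/
def IsPositiveSelfAdjoint {E : Type*} [NormedAddCommGroup E] [InnerProductSpace ℂ E]
    [CompleteSpace E] (A : E →ₗ.[ℂ] E) : Prop :=
  IsSelfAdjoint A ∧ ∀ f : A.domain, 0 ≤ (inner ℂ (f : E) (A f)).re

section LebesgueSpace

variable {X : Type*} [MeasurableSpace X] {μ : Measure X}

/-- The function `|f|`, as an element of the complex space `L²(X)`. -/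
def absL2 (f : Lp ℂ 2 μ) : Lp ℂ 2 μ :=
  MemLp.toLp (fun x => ((‖f x‖ : ℝ) : ℂ)) (Lp.memLp f).norm.ofReal

/-- `T f ≥ 0` whenever `f ≥ 0` (for complex numbers `0 ≤ w` means that `w` is real and
nonnegative). -/
def IsPositivityPreserving (T : Lp ℂ 2 μ →L[ℂ] Lp ℂ 2 μ) : Prop :=
  ∀ f : Lp ℂ 2 μ, (∀ᵐ x ∂μ, 0 ≤ f x) → ∀ᵐ x ∂μ, 0 ≤ T f x

/-- `|T f| ≤ c S |f|` almost everywhere, for all `f ∈ L²(X)`. The inequality is one between complex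
numbers, so it contains the assertion that the right-hand side is real. -/
def Dominated (T S : Lp ℂ 2 μ →L[ℂ] Lp ℂ 2 μ) (c : ℝ) : Prop :=
  ∀ f : Lp ℂ 2 μ, ∀ᵐ x ∂μ, ((‖T f x‖ : ℝ) : ℂ) ≤ (c : ℂ) * S (absL2 f) x

end LebesgueSpace

section Kernels

variable {X : Type*} [MetricSpace X] [MeasurableSpace X] {μ : Measure X}

/-- `T` has the associated kernel `k`: `k` is integrable on bounded subsets of `X × X`, and
`⟨T f, g⟩ = ∫∫ k(x, y) f(y) conj (g(x)) dμ(y) dμ(x)` for all `f, g ∈ L²(X)`, the integral being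
absolutely convergent. -/
structure HasKernel (T : Lp ℂ 2 μ →L[ℂ] Lp ℂ 2 μ) (k : X × X → ℂ) : Prop where
  integrableOn : ∀ (a : X) (r : ℝ),
    IntegrableOn k (Metric.ball a r ×ˢ Metric.ball a r) (μ.prod μ)
  integrable : ∀ f g : Lp ℂ 2 μ,
    Integrable (fun p : X × X => k p * f p.2 * (starRingEnd ℂ) (g p.1)) (μ.prod μ)
  inner_eq : ∀ f g : Lp ℂ 2 μ,
    inner ℂ g (T f) = ∫ p : X × X, k p * f p.2 * (starRingEnd ℂ) (g p.1) ∂(μ.prod μ)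

/-- `|k| ≤ c l` almost everywhere on `X × X`. -/
def KernelDominated (μ : Measure X) (k l : X × X → ℂ) (c : ℝ) : Prop :=
  ∀ᵐ p ∂(μ.prod μ), ((‖k p‖ : ℝ) : ℂ) ≤ (c : ℂ) * l p

end Kernels

end PoissonDomination

end

open MeasureTheory Filter Topology
open scoped ENNReal NNReal ComplexOrder

noncomputable section

namespace PoissonDomination

/-! ### Strongly continuous semigroups and their generators -/

section Semigroups

variable {E F : Type*} [NormedAddCommGroup E] [NormedSpace ℂ E]
  [NormedAddCommGroup F] [NormedSpace ℂ F]

/-! Everything rests on subordination. For `|arg z| < π/4` put `η_z(s) = z (2√π)⁻¹ s^(-3/2)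
exp(-z²/4s)`. Then `exp(-z A^(1/2)) = ∫₀^∞ η_z(s) exp(-sA) ds`, both for `A = L` and for `A = M`. If
`τ > 0` and `τ² ≤ Re z²`, then `|η_z| ≤ (|z|/τ) η_τ` pointwise, so the hypothesis `|H_s f| ≤ C
G_s|f|` integrates to `|P_z f| ≤ (|z|/τ) C Q_τ|f|`. The integration is legitimate because the pairs
`(u, v)` with `|u| ≤ v` form a closed convex cone in `L² × L²`, and Hahn-Banach keeps Bochner
integrals inside such a cone (`IsDominationCone.integral_mem`).

Two choices of `τ` give the estimates. In the sector of half-angle `β`, `γ = √cos 2β` and `τ = γ Re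
z` give `|z|/τ ≤ √2/γ`. For `(tL^(1/2))^k P_t`, Cauchy's formula on the circle of radius `(1-θ²)t/4`
about `t` reduces to complex times with `Re z² ≥ (θt)²` and `|z| ≤ 2t`, whence the constant `k!
(4/(1-θ²))^k · 2/θ`.

Since square roots and semigroups are specified only by their defining properties, the subordinated
family `S(z)` must be identified with `exp(-z A^(1/2))`. From `∂_z² η = ∂_s η` one gets `S'' = S A`
on the domain of `A`. The key fact is a uniqueness theorem: a bounded solution of `x'' = A x` on
`(0, ∞)` with `x(0+) = f` is `S(t)f` (`eq_subordinate_of_deriv`). It yields the semigroup law for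
`S`, and it shows that every admissible square root has `S` as its semigroup
(`isSemigroupOf_opSqrt`). That `L` itself generates a contraction semigroup is obtained from the
continuous functional calculus of the resolvent `(1 + L)⁻¹`.

For the kernels, domination is tested on rectangles `A × B`: a domination between operators gives
one between the integrals of the kernels, and a semiring argument localises it
(`ae_norm_le_of_setIntegral_prod`). Existence is subtler, because kernels given for each time
separately need not be jointly measurable. Nonnegative kernels are therefore regarded as measures,
which do depend measurably on the parameter; these are mixed, and the Radon-Nikodym theorem supplies
a density (`exists_kernel_mixture`). Complex kernels are reduced to nonnegative ones with the help
of the dominating kernel. -/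

/-- `-g` is the right derivative at `0` of the orbit of `f`. -/
def Gen (T : ℝ → E →L[ℂ] E) (f g : E) : Prop :=
  Tendsto (fun t : ℝ => ((t⁻¹ : ℝ) : ℂ) • (f - T t f)) (𝓝[>] 0) (𝓝 g)

/-- Product rule for a locally bounded family of operators applied to a curve. -/
theorem hasDerivWithinAt_clm_apply {U : ℝ → E →L[ℂ] F} {x : ℝ → E} {S : Set ℝ} {r₀ K : ℝ}
    {w : F} {x' : E} (hK : ∀ᶠ r in 𝓝[S] r₀, ‖U r‖ ≤ K)
    (hU : HasDerivWithinAt (fun r => U r (x r₀)) w S r₀) (hx : HasDerivWithinAt x x' S r₀)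
    (hc : Tendsto (fun r => U r x') (𝓝[S] r₀) (𝓝 (U r₀ x'))) :
    HasDerivWithinAt (fun r => U r (x r)) (w + U r₀ x') S r₀ := by
  rw [hasDerivWithinAt_iff_tendsto_slope] at *
  have hle : 𝓝[S \ {r₀}] r₀ ≤ 𝓝[S] r₀ := nhdsWithin_mono _ Set.sdiff_subset
  -- The slope of the product is that of `U r (x r₀)` plus `U r` applied to the slope of `x`. Local
  -- boundedness of `U` replaces norm continuity.
  have h1 : Tendsto (fun r => U r (slope x r₀ r - x')) (𝓝[S \ {r₀}] r₀) (𝓝 0) := by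
    have h2 : Tendsto (fun r => K * ‖slope x r₀ r - x'‖) (𝓝[S \ {r₀}] r₀) (𝓝 0) := by
      have := (tendsto_sub_nhds_zero_iff.2 hx).norm.const_mul K
      simpa using this
    refine squeeze_zero_norm' ?_ h2
    filter_upwards [hle hK] with r hr
    exact ((U r).le_opNorm _).trans (by gcongr)
  have h3 := (hU.add h1).add (hc.mono_left hle)
  rw [add_zero] at h3
  refine h3.congr' (Eventually.of_forall fun r => ?_)
  simp only [slope, vsub_eq_sub, map_sub]
  rw [(U r).map_smul_of_tower, map_sub]
  module

namespace IsC0Semigroup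

variable {T T' : ℝ → E →L[ℂ] E}

theorem tendsto_ge (hT : IsC0Semigroup T) (f : E) :
    Tendsto (fun t : ℝ => T t f) (𝓝[≥] 0) (𝓝 f) := by
  have h : (Set.Ici (0 : ℝ)) = insert 0 (Set.Ioi 0) := by
    ext; simp [le_iff_eq_or_lt, eq_comm]
  rw [h, nhdsWithin_insert, tendsto_sup]
  refine ⟨?_, hT.tendsto f⟩
  rw [tendsto_pure_left]
  intro s hs
  simpa [hT.zero] using mem_of_mem_nhds hs

/-- Uniform boundedness principle: norms exceeding `n` at times `tₙ → 0` would contradict the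
convergence of `T tₙ f` for every `f`. -/
theorem norm_le_near_zero [CompleteSpace E] (hT : IsC0Semigroup T) :
    ∃ δ K : ℝ, 0 < δ ∧ ∀ t, 0 ≤ t → t ≤ δ → ‖T t‖ ≤ K := by
  by_contra! hcon
  choose t ht0 ht1 ht2 using fun n : ℕ => hcon (1 / (n + 1)) n (by positivity)
  have htt : Tendsto t atTop (𝓝[≥] 0) :=
    tendsto_nhdsWithin_iff.2 ⟨squeeze_zero ht0 ht1 tendsto_one_div_add_atTop_nhds_zero_nat,
      Eventually.of_forall ht0⟩
  obtain ⟨C, hC⟩ := banach_steinhaus (g := fun n => T (t n)) fun f => by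
    obtain ⟨C, hC⟩ := (Metric.isBounded_range_of_tendsto _
      ((hT.tendsto_ge f).comp htt)).exists_norm_le
    exact ⟨C, fun n => hC _ ⟨n, rfl⟩⟩
  obtain ⟨n, hn⟩ := exists_nat_gt C
  exact absurd (hC n) (not_le.2 (hn.trans (ht2 n)))

theorem norm_le_on [CompleteSpace E] (hT : IsC0Semigroup T) (b : ℝ) :
    ∃ K : ℝ, 0 ≤ K ∧ ∀ t, 0 ≤ t → t ≤ b → ‖T t‖ ≤ K := by
  obtain ⟨δ, K, hδ, hK⟩ := hT.norm_le_near_zero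
  have key : ∀ n : ℕ, ∀ t, 0 ≤ t → t ≤ (n + 1) * δ → ‖T t‖ ≤ (max K 1) ^ (n + 1) := by
    intro n
    induction n with
    | zero => intro t h0 h1; simpa using Or.inl (hK t h0 (by simpa using h1))
    | succ n ih =>
      intro t h0 h1
      rcases le_total t δ with h | h
      · exact ((hK t h0 h).trans (le_max_left _ _)).trans
          (le_self_pow₀ (le_max_right _ _) (by omega))
      · have : T t = T (t - δ) * T δ := by rw [← hT.add _ _ (by linarith) hδ.le]; simp
        rw [this, pow_succ]
        refine (norm_mul_le _ _).trans ?_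
        gcongr
        · exact ih _ (by linarith) (by push_cast at h1; linarith)
        · exact (hK δ hδ.le le_rfl).trans (le_max_left _ _)
  obtain ⟨n, hn⟩ := exists_nat_ge (b / δ)
  refine ⟨(max K 1) ^ (n + 1), by positivity, fun t h0 h1 => key n t h0 ?_⟩
  rw [div_le_iff₀ hδ] at hn
  nlinarith

theorem continuousOn [CompleteSpace E] (hT : IsC0Semigroup T) (f : E) :
    ContinuousOn (fun t => T t f) (Set.Ici 0) := by
  intro t₀ ht₀
  obtain ⟨K, hK0, hK⟩ := hT.norm_le_on (t₀ + 1)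
  have h1 : Tendsto (fun t : ℝ => |t - t₀|) (𝓝[Set.Ici 0] t₀) (𝓝[≥] 0) := by
    refine tendsto_nhdsWithin_iff.2 ⟨?_, Eventually.of_forall fun t => Set.mem_Ici.2 (abs_nonneg _)⟩
    have : Continuous fun t : ℝ => |t - t₀| := by fun_prop
    simpa using (this.tendsto t₀).mono_left (nhdsWithin_le_nhds (s := Set.Ici 0))
  have h2 : Tendsto (fun t : ℝ => K * ‖T |t - t₀| f - f‖) (𝓝[Set.Ici 0] t₀) (𝓝 0) := by
    have := ((tendsto_sub_nhds_zero_iff.2 (hT.tendsto_ge f)).comp h1).norm.const_mul K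
    simpa using this
  rw [ContinuousWithinAt, ← tendsto_sub_nhds_zero_iff]
  refine squeeze_zero_norm' ?_ h2
  have hlt : ∀ᶠ t in 𝓝[Set.Ici 0] t₀, t < t₀ + 1 :=
    nhdsWithin_le_nhds (Iio_mem_nhds (by linarith))
  filter_upwards [hlt, self_mem_nhdsWithin] with t ht ht'
  have ht₀' : 0 ≤ t₀ := ht₀
  have ht'' : 0 ≤ t := ht'
  rcases le_total t₀ t with h | h
  · have : T t = T t₀ * T (t - t₀) := by rw [← hT.add _ _ ht₀' (by linarith)]; simp
    rw [abs_of_nonneg (by linarith), this, mul_apply_eq_comp, ← map_sub]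
    exact ((T t₀).le_opNorm _).trans (by gcongr; exact hK _ ht₀' (by linarith))
  · have : T t₀ = T t * T (t₀ - t) := by rw [← hT.add _ _ ht'' (by linarith)]; simp
    rw [abs_of_nonpos (by linarith), this, mul_apply_eq_comp, ← map_sub, neg_sub,
      norm_sub_rev _ f]
    exact ((T t).le_opNorm _).trans (by gcongr; exact hK _ ht'' (by linarith))

theorem intervalIntegrable [CompleteSpace E] (hT : IsC0Semigroup T) (f : E) {a b : ℝ}
    (ha : 0 ≤ a) (hb : 0 ≤ b) : IntervalIntegrable (fun t => T t f) volume a b :=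
  ((hT.continuousOn f).mono fun _ hx => (le_inf ha hb).trans hx.1).intervalIntegrable

theorem map_gen (hT : IsC0Semigroup T) {f g : E} (h : Gen T f g) {t : ℝ} (ht : 0 ≤ t) :
    Gen T (T t f) (T t g) := by
  refine (((T t).continuous.tendsto g).comp h).congr' ?_
  filter_upwards [self_mem_nhdsWithin] with r hr
  have hr' : (0 : ℝ) ≤ r := le_of_lt hr
  have : T r (T t f) = T t (T r f) := by
    simp only [← mul_apply_eq_comp]
    rw [← hT.add _ _ hr' ht, ← hT.add _ _ ht hr', add_comm]
  simp [this]

theorem hasDerivWithinAt_orbit (hT : IsC0Semigroup T) {f g : E} (h : Gen T f g) {t : ℝ}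
    (ht : 0 ≤ t) : HasDerivWithinAt (fun r => T r f) (-(T t g)) (Set.Ici t) t := by
  rw [hasDerivWithinAt_iff_tendsto_slope, Set.Ici_sdiff_left]
  have h1 := (hT.map_gen h ht).neg
  have h2 : Tendsto (fun r : ℝ => r - t) (𝓝[>] t) (𝓝[>] 0) := by
    refine tendsto_nhdsWithin_iff.2 ⟨?_, ?_⟩
    · have : Continuous fun r : ℝ => r - t := by fun_prop
      simpa using (this.tendsto t).mono_left (nhdsWithin_le_nhds (s := Set.Ioi t))
    · filter_upwards [self_mem_nhdsWithin] with r hr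
      simpa using hr
  refine (h1.comp h2).congr' ?_
  filter_upwards [self_mem_nhdsWithin] with r hr
  have hr' : t < r := hr
  have : T r = T (r - t) * T t := by rw [← hT.add _ _ (by linarith) ht]; simp
  simp only [Function.comp, slope, vsub_eq_sub, this, mul_apply_eq_comp,
    Complex.coe_smul]
  rw [← smul_neg, neg_sub]

theorem sub_eq_integral [CompleteSpace E] (hT : IsC0Semigroup T) {f g : E} (h : Gen T f g)
    {t : ℝ} (ht : 0 ≤ t) : f - T t f = ∫ r in (0 : ℝ)..t, T r g := by
  have := intervalIntegral.integral_eq_sub_of_hasDeriv_right (a := 0) (b := t)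
    (f := fun r => T r f) (f' := fun r => -(T r g))
    ((hT.continuousOn f).mono fun x hx => by
      rw [Set.uIcc_of_le ht] at hx; exact hx.1)
    (fun x hx => by
      rw [min_eq_left ht] at hx
      exact (hT.hasDerivWithinAt_orbit h hx.1.le).mono Set.Ioi_subset_Ici_self)
    ((hT.intervalIntegrable g le_rfl ht).neg)
  rw [intervalIntegral.integral_neg, hT.zero] at this
  have h2 := neg_eq_iff_eq_neg.1 this
  rw [h2]
  simp

/-- Converse of `sub_eq_integral`. An integral identity survives limits where a difference quotient
does not, and this is how generators are shown to be closed. -/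
theorem gen_of_sub_eq_integral [CompleteSpace E] (hT : IsC0Semigroup T) {f g : E}
    (h : ∀ t, 0 < t → f - T t f = ∫ r in (0 : ℝ)..t, T r g) : Gen T f g := by
  have hd := intervalIntegral.integral_hasDerivWithinAt_right (f := fun r => T r g) (a := 0)
    (b := 0) (s := Set.Ici 0) (t := Set.Ioi 0) (by simp)
    ⟨Set.Ici 0, mem_of_superset self_mem_nhdsWithin Set.Ioi_subset_Ici_self,
      (hT.continuousOn g).aestronglyMeasurable measurableSet_Ici⟩
    (((hT.continuousOn g) 0 (by simp)).mono Set.Ioi_subset_Ici_self)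
  rw [hasDerivWithinAt_iff_tendsto_slope, Set.Ici_sdiff_left, hT.zero] at hd
  refine hd.congr' ?_
  filter_upwards [self_mem_nhdsWithin] with t ht
  simp [slope, h t ht, -Complex.ofReal_inv, Complex.coe_smul]

/-- `Gen` by itself gives right derivatives only; the orbit is `f` minus an integral with continuous
integrand, which makes the derivative two-sided. -/
theorem hasDerivAt_orbit [CompleteSpace E] (hT : IsC0Semigroup T) {f g : E} (h : Gen T f g)
    {t : ℝ} (ht : 0 < t) : HasDerivAt (fun r => T r f) (-(T t g)) t := by
  have hd := intervalIntegral.integral_hasDerivAt_right (f := fun r => T r g) (a := 0)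
    (b := t) (hT.intervalIntegrable g le_rfl ht.le)
    ⟨Set.Ici 0, Ici_mem_nhds ht, (hT.continuousOn g).aestronglyMeasurable measurableSet_Ici⟩
    ((hT.continuousOn g).continuousAt (Ici_mem_nhds ht))
  refine (hd.const_sub f).congr_of_eventuallyEq ?_
  filter_upwards [Ioi_mem_nhds ht] with r hr
  rw [← hT.sub_eq_integral h (le_of_lt hr)]; simp

/-- Generators are closed. -/
theorem gen_closed [CompleteSpace E] (hT : IsC0Semigroup T) {ι : Type*} {l : Filter ι} [l.NeBot]
    {u v : ι → E} {f g : E} (h : ∀ᶠ i in l, Gen T (u i) (v i)) (hu : Tendsto u l (𝓝 f))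
    (hv : Tendsto v l (𝓝 g)) : Gen T f g := by
  refine hT.gen_of_sub_eq_integral fun t ht => ?_
  obtain ⟨K, hK0, hK⟩ := hT.norm_le_on t
  have h1 : Tendsto (fun i => u i - T t (u i)) l (𝓝 (f - T t f)) :=
    hu.sub (((T t).continuous.tendsto f).comp hu)
  refine tendsto_nhds_unique h1 ?_
  have h2 : Tendsto (fun i => K * ‖v i - g‖ * |t - 0|) l (𝓝 0) := by
    simpa using ((tendsto_sub_nhds_zero_iff.2 hv).norm.const_mul K).mul_const |t - 0|
  rw [← tendsto_sub_nhds_zero_iff]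
  refine squeeze_zero_norm' ?_ h2
  filter_upwards [h] with i hi
  rw [hT.sub_eq_integral hi ht.le, ← intervalIntegral.integral_sub
    (hT.intervalIntegrable _ le_rfl ht.le) (hT.intervalIntegrable _ le_rfl ht.le)]
  refine intervalIntegral.norm_integral_le_of_norm_le_const fun r hr => ?_
  rw [Set.uIoc_of_le ht.le] at hr
  rw [← map_sub]
  exact ((T r).le_opNorm _).trans (by gcongr; exact hK _ hr.1.le hr.2)

/-- The averages `a⁻¹ ∫₀^a T r f dr` lie in the domain, with image `a⁻¹ (f - T a f)`, and tend to
`f` as `a → 0`. -/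
theorem dense_gen [CompleteSpace E] (hT : IsC0Semigroup T) : Dense {f : E | ∃ g, Gen T f g} := by
  intro f
  have hd := intervalIntegral.integral_hasDerivWithinAt_right (f := fun r => T r f) (a := 0)
    (b := 0) (s := Set.Ici 0) (t := Set.Ioi 0) (by simp)
    ⟨Set.Ici 0, mem_of_superset self_mem_nhdsWithin Set.Ioi_subset_Ici_self,
      (hT.continuousOn f).aestronglyMeasurable measurableSet_Ici⟩
    (((hT.continuousOn f) 0 (by simp)).mono Set.Ioi_subset_Ici_self)
  rw [hasDerivWithinAt_iff_tendsto_slope, Set.Ici_sdiff_left, hT.zero] at hd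
  refine mem_closure_of_tendsto hd ?_
  filter_upwards [self_mem_nhdsWithin] with a ha
  have ha' : (0 : ℝ) < a := ha
  refine ⟨((a⁻¹ : ℝ) : ℂ) • (f - T a f), ?_⟩
  have key : Gen T (∫ r in (0 : ℝ)..a, T r f) (f - T a f) := by
    refine hT.gen_of_sub_eq_integral fun t ht => ?_
    have hI := fun {x y : ℝ} (hx : 0 ≤ x) (hy : 0 ≤ y) => hT.intervalIntegrable f hx hy
    have e1 : T t (∫ r in (0 : ℝ)..a, T r f) = ∫ r in t..(t + a), T r f := by
      rw [← (T t).intervalIntegral_comp_comm (hI le_rfl ha'.le)]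
      have := intervalIntegral.integral_comp_add_left (a := 0) (b := a) (fun r => T r f) t
      rw [add_zero] at this
      rw [← this]
      refine intervalIntegral.integral_congr fun r hr => ?_
      rw [Set.uIcc_of_le ha'.le] at hr
      simp [hT.add t r ht.le hr.1]
    have e2 : ∫ r in (0 : ℝ)..t, T r (f - T a f) =
        (∫ r in (0 : ℝ)..t, T r f) - ∫ r in a..(t + a), T r f := by
      have := intervalIntegral.integral_comp_add_right (a := 0) (b := t) (fun r => T r f) a
      rw [zero_add] at this
      rw [← this]
      simp only [map_sub]
      rw [intervalIntegral.integral_sub (hI le_rfl ht.le) (hT.intervalIntegrable _ le_rfl ht.le)]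
      congr 1
      refine intervalIntegral.integral_congr fun r hr => ?_
      rw [Set.uIcc_of_le ht.le] at hr
      simp [hT.add r a hr.1 ha'.le]
    rw [e1, e2]
    have h1 := intervalIntegral.integral_add_adjacent_intervals (hI le_rfl ht.le)
      (hI ht.le (by positivity : (0 : ℝ) ≤ t + a))
    have h2 := intervalIntegral.integral_add_adjacent_intervals (hI le_rfl ha'.le)
      (hI ha'.le (by positivity : (0 : ℝ) ≤ t + a))
    rw [sub_eq_sub_iff_add_eq_add, h1, h2]
  have e3 : slope (fun u => ∫ r in (0 : ℝ)..u, T r f) 0 a =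
      ((a⁻¹ : ℝ) : ℂ) • ∫ r in (0 : ℝ)..a, T r f := by
    simp [slope, -Complex.ofReal_inv, Complex.coe_smul]
  rw [e3]
  refine (key.const_smul ((a⁻¹ : ℝ) : ℂ)).congr fun t => ?_
  simp only [map_smul]
  module

/-- A semigroup is determined by its generator. -/
theorem eq_of_gen [CompleteSpace E] (hT : IsC0Semigroup T) (hT' : IsC0Semigroup T')
    (h : ∀ f g, Gen T f g → Gen T' f g) {t : ℝ} (ht : 0 ≤ t) : T t = T' t := by
  have key : ∀ f ∈ {f : E | ∃ g, Gen T f g}, T t f = T' t f := by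
    rintro f ⟨g, hfg⟩
    obtain ⟨K, hK0, hK⟩ := hT'.norm_le_on t
    have hcU : ∀ y, ∀ s ≤ t, ContinuousWithinAt (fun s => T' (t - s) y) (Set.Iic t) s := by
      intro y s hs
      have := (hT'.continuousOn y) (t - s) (by simpa using hs)
      exact this.comp (f := fun s => t - s) (by fun_prop) fun r hr => by simpa using hr
    -- The curve `s ↦ T' (t - s) (T s f)` joins `T' t f` to `T t f`. It has zero right derivative
    -- because the generator of `T` is contained in that of `T'`, so it is constant.
    have hc : ContinuousOn (fun s => T' (t - s) (T s f)) (Set.Icc 0 t) := by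
      intro s hs
      have h1 : Tendsto (fun r => T' (t - r) (T r f - T s f)) (𝓝[Set.Icc 0 t] s) (𝓝 0) := by
        have h2 : Tendsto (fun r => K * ‖T r f - T s f‖) (𝓝[Set.Icc 0 t] s) (𝓝 0) := by
          have := (tendsto_sub_nhds_zero_iff.2 (((hT.continuousOn f) s hs.1).mono
            (fun r (hr : r ∈ Set.Icc 0 t) => hr.1)).tendsto).norm.const_mul K
          simpa using this
        refine squeeze_zero_norm' ?_ h2
        filter_upwards [self_mem_nhdsWithin] with r hr
        exact ((T' (t - r)).le_opNorm _).trans (by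
          gcongr; exact hK _ (by linarith [hr.2]) (by linarith [hr.1]))
      have h3 := h1.add ((hcU (T s f) s hs.2).mono (Set.Icc_subset_Iic_self (a := 0)))
      rw [zero_add] at h3
      refine h3.congr fun r => by simp
    have hd : ∀ s ∈ Set.Ico 0 t,
        HasDerivWithinAt (fun s => T' (t - s) (T s f)) 0 (Set.Ici s) s := by
      intro s hs
      have hnear : ∀ᶠ r in 𝓝[≥] s, r < t := nhdsWithin_le_nhds (Iio_mem_nhds hs.2)
      have hge : ∀ᶠ r in 𝓝[≥] s, s ≤ r := self_mem_nhdsWithin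
      have := hasDerivWithinAt_clm_apply (U := fun s => T' (t - s)) (x := fun s => T s f)
        (S := Set.Ici s) (r₀ := s) (K := K) (w := T' (t - s) (T s g)) (x' := -(T s g)) (by
          filter_upwards [hnear, hge] with r hr hr'
          exact hK _ (by linarith) (by linarith [hs.1]))
        (by
          have h1 := hT'.hasDerivAt_orbit (h _ _ (hT.map_gen hfg hs.1))
            (by linarith [hs.2] : 0 < t - s)
          have h2 := h1.scomp s ((hasDerivAt_id s).const_sub t)
          simpa [Function.comp_def] using h2.hasDerivWithinAt)
        (hT.hasDerivWithinAt_orbit hfg hs.1)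
        (by
          have := (hcU (-(T s g)) s hs.2.le).continuousAt (Iic_mem_nhds hs.2)
          exact this.tendsto.mono_left nhdsWithin_le_nhds)
      simpa using this
    have := constant_of_has_deriv_right_zero hc hd t ⟨ht, le_rfl⟩
    simpa [hT'.zero, hT.zero] using this
  exact ContinuousLinearMap.ext fun f => by
    have := Continuous.ext_on hT.dense_gen (T t).continuous (T' t).continuous key
    exact congrFun this f

end IsC0Semigroup

/-- The generator, with the sign changed, as a partially defined operator. -/
def genPMap (T : ℝ → E →L[ℂ] E) : E →ₗ.[ℂ] E :=
  Submodule.toLinearPMap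
    { carrier := {p : E × E | Gen T p.1 p.2}
      add_mem' := fun {p q} hp hq => by
        refine (Tendsto.add hp hq).congr fun t => ?_
        simp only [Prod.fst_add, map_add]
        module
      zero_mem' := by simp [Gen]
      smul_mem' := fun c p hp => by
        refine (Tendsto.const_smul hp c).congr fun t => ?_
        simp only [Prod.smul_fst, map_smul]
        module }

/-- The set of pairs really is a graph: as `T t 0 = 0`, the only possible image of `0` is `0`. -/
theorem mem_genPMap_graph {T : ℝ → E →L[ℂ] E} {f g : E} :
    (f, g) ∈ (genPMap T).graph ↔ Gen T f g := by
  rw [genPMap, Submodule.toLinearPMap_graph_eq]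
  · rfl
  · rintro ⟨x, y⟩ hxy hx
    have hxy' : Gen T x y := hxy
    have hx' : x = 0 := hx
    subst hx'
    have : Tendsto (fun _ : ℝ => (0 : E)) (𝓝[>] 0) (𝓝 y) := by simpa [Gen] using hxy'
    exact tendsto_nhds_unique this tendsto_const_nhds

theorem isSemigroupOf_genPMap {T : ℝ → E →L[ℂ] E} (hT : IsC0Semigroup T) :
    IsSemigroupOf T (genPMap T) := ⟨hT, fun _ _ => mem_genPMap_graph⟩

theorem IsSemigroupOf.mem_graph_iff {T : ℝ → E →L[ℂ] E} {A : E →ₗ.[ℂ] E}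
    (h : IsSemigroupOf T A) {f g : E} : (f, g) ∈ A.graph ↔ Gen T f g := h.generator f g

theorem IsSemigroupOf.congr {T T' : ℝ → E →L[ℂ] E} {A : E →ₗ.[ℂ] E} (h : IsSemigroupOf T A)
    (he : ∀ t, 0 ≤ t → T t = T' t) : IsSemigroupOf T' A where
  zero := by rw [← he 0 le_rfl, h.zero]
  add s t hs ht := by rw [← he s hs, ← he t ht, ← he _ (add_nonneg hs ht), h.add s t hs ht]
  tendsto f := (h.tendsto f).congr' (by
    filter_upwards [self_mem_nhdsWithin] with t ht
    rw [he t (le_of_lt ht)])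
  generator f g := (h.generator f g).trans (tendsto_congr' (by
    filter_upwards [self_mem_nhdsWithin] with t ht
    rw [he t (le_of_lt ht)]))

theorem IsSemigroupOf.eq_of [CompleteSpace E] {T T' : ℝ → E →L[ℂ] E} {A : E →ₗ.[ℂ] E}
    (h : IsSemigroupOf T A) (h' : IsSemigroupOf T' A) {t : ℝ} (ht : 0 ≤ t) : T t = T' t :=
  h.toIsC0Semigroup.eq_of_gen h'.toIsC0Semigroup
    (fun _ _ hg => h'.mem_graph_iff.1 (h.mem_graph_iff.2 hg)) ht

theorem isSemigroupOf_opExp {T : ℝ → E →L[ℂ] E} {A : E →ₗ.[ℂ] E} (h : IsSemigroupOf T A) :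
    IsSemigroupOf (opExp A) A := by
  have hex : ∃ T : ℝ → E →L[ℂ] E, IsSemigroupOf T A := ⟨T, h⟩
  rw [opExp, dif_pos hex]
  exact hex.choose_spec

theorem opExp_eq [CompleteSpace E] {T : ℝ → E →L[ℂ] E} {A : E →ₗ.[ℂ] E} (h : IsSemigroupOf T A)
    {t : ℝ} (ht : 0 ≤ t) : opExp A t = T t :=
  (isSemigroupOf_opExp h).eq_of h ht

end Semigroups

/-! ### The subordination density -/

section Density

/-- The open sector of half-angle `π/4`, on which the subordination density decays. -/
def diagSector : Set ℂ := {z | |z.im| < z.re}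

/-- The Gaussian factor `(2√π)⁻¹ s^(-3/2) exp (-z² / 4s)`. -/
def gaussFactor (z : ℂ) (s : ℝ) : ℂ :=
  (((2 * √Real.pi)⁻¹ * s ^ (-3 / 2 : ℝ) : ℝ) : ℂ) * Complex.exp (-(z ^ 2) / (4 * s))

/-- The subordination density `z (2√π)⁻¹ s^(-3/2) exp (-z² / 4s)`. -/
def subDensity (z : ℂ) (s : ℝ) : ℂ := z * gaussFactor z s

/-- The `z`-derivative of the subordination density. -/
def subDensity₁ (z : ℂ) (s : ℝ) : ℂ := (1 - z ^ 2 / (2 * s)) * gaussFactor z s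

/-- The second `z`-derivative, and the `s`-derivative, of the subordination density. -/
def subDensity₂ (z : ℂ) (s : ℝ) : ℂ :=
  (-(3 * z) / (2 * s) + z ^ 3 / (4 * s ^ 2)) * gaussFactor z s

/-- The majorant `s^(-3/2) exp (-a / 4s)`. -/
def levyWeight (a s : ℝ) : ℝ := s ^ (-3 / 2 : ℝ) * Real.exp (-a / (4 * s))

theorem re_sq (z : ℂ) : (z ^ 2).re = z.re ^ 2 - z.im ^ 2 := by
  simp [pow_two]

theorem diagSector_re_pos {z : ℂ} (hz : z ∈ diagSector) : 0 < z.re :=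
  (abs_nonneg _).trans_lt hz

theorem diagSector_re_sq_pos {z : ℂ} (hz : z ∈ diagSector) : 0 < (z ^ 2).re := by
  rw [re_sq, ← sq_abs z.im]
  have h : |z.im| < z.re := hz
  have := abs_nonneg z.im
  nlinarith

theorem mem_diagSector_of {z : ℂ} (h1 : 0 < z.re) (h2 : 0 < (z ^ 2).re) : z ∈ diagSector := by
  rw [re_sq] at h2
  exact abs_lt_of_sq_lt_sq (by linarith) h1.le

theorem isOpen_diagSector : IsOpen diagSector :=
  isOpen_lt (by fun_prop) (by fun_prop)

theorem ofReal_mem_diagSector {t : ℝ} (ht : 0 < t) : (t : ℂ) ∈ diagSector := by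
  simpa [diagSector] using ht

theorem add_mem_diagSector {z w : ℂ} (hz : z ∈ diagSector) (hw : w ∈ diagSector) :
    z + w ∈ diagSector := by
  have h1 : |z.im| < z.re := hz
  have h2 : |w.im| < w.re := hw
  have := abs_add_le z.im w.im
  simp only [diagSector, Set.mem_ofPred_eq, Complex.add_im, Complex.add_re]
  linarith

theorem smul_mem_diagSector {z : ℂ} (hz : z ∈ diagSector) {t : ℝ} (ht : 0 < t) :
    (t : ℂ) * z ∈ diagSector := by
  have h1 : |z.im| < z.re := hz
  simp only [diagSector, Set.mem_ofPred_eq, Complex.mul_im, Complex.mul_re, Complex.ofReal_re,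
    Complex.ofReal_im, zero_mul, add_zero, sub_zero, abs_mul, abs_of_pos ht]
  gcongr

theorem convex_diagSector : Convex ℝ diagSector := by
  intro z hz w hw a b ha hb hab
  rcases ha.eq_or_lt with rfl | ha
  · have : b = 1 := by linarith
    simpa [this] using hw
  rcases hb.eq_or_lt with rfl | hb
  · have : a = 1 := by linarith
    simpa [this] using hz
  · simpa using add_mem_diagSector (smul_mem_diagSector hz ha) (smul_mem_diagSector hw hb)

theorem levyWeight_nonneg (a : ℝ) {s : ℝ} (hs : 0 < s) : 0 ≤ levyWeight a s := by
  unfold levyWeight; positivity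

theorem levyWeight_anti {a b : ℝ} (h : a ≤ b) {s : ℝ} (hs : 0 < s) :
    levyWeight b s ≤ levyWeight a s := by
  unfold levyWeight; gcongr

/-- The substitution `y = s^(-1/2)` turns the weight into the Gaussian `exp(-a y²/4)`; the
right-hand side has the shape of the change of variables for powers. -/
theorem levyWeight_integrand {a s : ℝ} (hs : 0 < s) :
    levyWeight a s = 2 * ((|(-1 / 2 : ℝ)| * s ^ ((-1 / 2 : ℝ) - 1)) •
      Real.exp (-(a / 4) * (s ^ (-1 / 2 : ℝ)) ^ 2)) := by
  have h1 : (s ^ (-1 / 2 : ℝ)) ^ 2 = s⁻¹ := by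
    rw [← Real.rpow_natCast, ← Real.rpow_mul hs.le]; norm_num [Real.rpow_neg_one]
  rw [h1, levyWeight, abs_of_neg (by norm_num), smul_eq_mul]
  have : -a / (4 * s) = -(a / 4) * s⁻¹ := by field_simp
  rw [this]; norm_num; ring

theorem integrableOn_levyWeight {a : ℝ} (ha : 0 < a) :
    IntegrableOn (levyWeight a) (Set.Ioi 0) := by
  have hg : IntegrableOn (fun y : ℝ => Real.exp (-(a / 4) * y ^ 2)) (Set.Ioi 0) :=
    (integrable_exp_neg_mul_sq (by positivity)).integrableOn
  have := (integrableOn_Ioi_comp_rpow_iff (fun y : ℝ => Real.exp (-(a / 4) * y ^ 2))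
    (p := (-1 / 2 : ℝ)) (by norm_num)).2 hg
  refine IntegrableOn.congr_fun (this.const_mul 2) (fun s hs => ?_) measurableSet_Ioi
  exact (levyWeight_integrand hs).symm

theorem integral_levyWeight {a : ℝ} (ha : 0 < a) :
    ∫ s in Set.Ioi 0, levyWeight a s = 2 * √Real.pi / √a := by
  rw [setIntegral_congr_fun measurableSet_Ioi fun s hs => levyWeight_integrand hs,
    integral_const_mul, integral_comp_rpow_Ioi (fun y : ℝ => Real.exp (-(a / 4) * y ^ 2))
    (by norm_num), integral_gaussian_Ioi]
  have : Real.pi / (a / 4) = 4 * Real.pi / a := by field_simp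
  rw [this, Real.sqrt_div (by positivity), Real.sqrt_mul (by norm_num),
    show √(4 : ℝ) = 2 by rw [show (4 : ℝ) = 2 ^ 2 by norm_num]; simp]
  ring

/-- Half of the exponent absorbs the factor `s⁻¹`, since `x exp(-x) ≤ 1` at `x = a/8s`. This is why
the bounds for derivatives carry `a / 2` in place of `a`. -/
theorem inv_mul_levyWeight_le {a s : ℝ} (ha : 0 < a) (hs : 0 < s) :
    s⁻¹ * levyWeight a s ≤ 8 / a * levyWeight (a / 2) s := by
  have e : Real.exp (-a / (4 * s)) = Real.exp (-(a / 2) / (4 * s)) * Real.exp (-(a / (8 * s))) := by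
    rw [← Real.exp_add]; congr 1; field_simp; ring
  have h1 : a / (8 * s) * Real.exp (-(a / (8 * s))) ≤ 1 := by
    rw [Real.exp_neg, ← div_eq_mul_inv, div_le_one (Real.exp_pos _)]
    linarith [Real.add_one_le_exp (a / (8 * s))]
  have h2 : s⁻¹ * levyWeight a s =
      8 / a * levyWeight (a / 2) s * (a / (8 * s) * Real.exp (-(a / (8 * s)))) := by
    unfold levyWeight; rw [e]; field_simp
  rw [h2]
  exact mul_le_of_le_one_right (mul_nonneg (by positivity) (levyWeight_nonneg _ hs)) h1

theorem inv_sq_mul_levyWeight_le {a s : ℝ} (ha : 0 < a) (hs : 0 < s) :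
    (s⁻¹) ^ 2 * levyWeight a s ≤ 128 / a ^ 2 * levyWeight (a / 2) s := by
  have e : Real.exp (-a / (4 * s)) = Real.exp (-(a / 2) / (4 * s)) * Real.exp (-(a / (8 * s))) := by
    rw [← Real.exp_add]; congr 1; field_simp; ring
  have h1 : (a / (8 * s)) ^ 2 / 2 * Real.exp (-(a / (8 * s))) ≤ 1 := by
    rw [Real.exp_neg, ← div_eq_mul_inv, div_le_one (Real.exp_pos _)]
    have := Real.quadratic_le_exp_of_nonneg (x := a / (8 * s)) (by positivity)
    have : 0 ≤ a / (8 * s) := by positivity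
    linarith
  have h2 : (s⁻¹) ^ 2 * levyWeight a s =
      128 / a ^ 2 * levyWeight (a / 2) s * ((a / (8 * s)) ^ 2 / 2 * Real.exp (-(a / (8 * s)))) := by
    unfold levyWeight; rw [e]; field_simp; ring
  rw [h2]
  exact mul_le_of_le_one_right (mul_nonneg (by positivity) (levyWeight_nonneg _ hs)) h1

theorem norm_gaussFactor (z : ℂ) {s : ℝ} (hs : 0 < s) :
    ‖gaussFactor z s‖ = (2 * √Real.pi)⁻¹ * levyWeight (z ^ 2).re s := by
  have e : (-(z ^ 2) / (4 * (s : ℂ))).re = -(z ^ 2).re / (4 * s) := by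
    rw [show (4 * (s : ℂ)) = ((4 * s : ℝ) : ℂ) by push_cast; ring, Complex.div_ofReal_re,
      Complex.neg_re]
  rw [gaussFactor, norm_mul, Complex.norm_exp, e, Complex.norm_real, Real.norm_of_nonneg
    (by positivity), levyWeight, mul_assoc]

theorem norm_subDensity (z : ℂ) {s : ℝ} (hs : 0 < s) :
    ‖subDensity z s‖ = (2 * √Real.pi)⁻¹ * (‖z‖ * levyWeight (z ^ 2).re s) := by
  rw [subDensity, norm_mul, norm_gaussFactor z hs]; ring

theorem norm_gaussFactor_le {z : ℂ} {a s : ℝ} (hz : a ≤ (z ^ 2).re) (hs : 0 < s) :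
    ‖gaussFactor z s‖ ≤ (2 * √Real.pi)⁻¹ * levyWeight a s := by
  rw [norm_gaussFactor z hs]
  gcongr
  exact levyWeight_anti hz hs

theorem norm_subDensity_le {z : ℂ} {a ρ s : ℝ} (hz : a ≤ (z ^ 2).re) (hρ : ‖z‖ ≤ ρ)
    (hs : 0 < s) : ‖subDensity z s‖ ≤ (2 * √Real.pi)⁻¹ * ρ * levyWeight a s := by
  rw [norm_subDensity z hs]
  have h1 := levyWeight_anti hz hs
  have h2 := levyWeight_nonneg (z ^ 2).re hs
  have hρ0 : 0 ≤ ρ := (norm_nonneg _).trans hρ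
  calc (2 * √Real.pi)⁻¹ * (‖z‖ * levyWeight (z ^ 2).re s)
      ≤ (2 * √Real.pi)⁻¹ * (ρ * levyWeight a s) := by gcongr
    _ = _ := by ring

theorem norm_subDensity₁_le {z : ℂ} {a ρ s : ℝ} (ha : 0 < a) (hz : a ≤ (z ^ 2).re)
    (hρ : ‖z‖ ≤ ρ) (hs : 0 < s) :
    ‖subDensity₁ z s‖ ≤ (2 * √Real.pi)⁻¹ * (1 + 4 * ρ ^ 2 / a) * levyWeight (a / 2) s := by
  have hn : ‖(1 - z ^ 2 / (2 * s) : ℂ)‖ ≤ 1 + ρ ^ 2 / 2 * s⁻¹ := by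
    refine (norm_sub_le _ _).trans ?_
    rw [norm_one, norm_div, norm_pow, norm_mul, Complex.norm_real, Real.norm_of_nonneg hs.le,
      Complex.norm_ofNat]
    gcongr
    rw [div_mul_eq_mul_div, ← div_eq_mul_inv, div_div, mul_comm s]
    gcongr
  have hw := levyWeight_nonneg a hs
  have h1 := inv_mul_levyWeight_le ha hs
  have h2 : levyWeight a s ≤ levyWeight (a / 2) s := levyWeight_anti (by linarith) hs
  rw [subDensity₁, norm_mul]
  calc _ ≤ (1 + ρ ^ 2 / 2 * s⁻¹) * ((2 * √Real.pi)⁻¹ * levyWeight a s) := by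
        gcongr; exact norm_gaussFactor_le hz hs
    _ = (2 * √Real.pi)⁻¹ * (levyWeight a s + ρ ^ 2 / 2 * (s⁻¹ * levyWeight a s)) := by ring
    _ ≤ (2 * √Real.pi)⁻¹ * (levyWeight (a / 2) s +
          ρ ^ 2 / 2 * (8 / a * levyWeight (a / 2) s)) := by gcongr
    _ = _ := by ring

theorem norm_subDensity₂_le {z : ℂ} {a ρ s : ℝ} (ha : 0 < a) (hz : a ≤ (z ^ 2).re)
    (hρ : ‖z‖ ≤ ρ) (hs : 0 < s) :
    ‖subDensity₂ z s‖ ≤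
      (2 * √Real.pi)⁻¹ * (12 * ρ / a + 32 * ρ ^ 3 / a ^ 2) * levyWeight (a / 2) s := by
  have hρ0 : 0 ≤ ρ := (norm_nonneg _).trans hρ
  have hn : ‖(-(3 * z) / (2 * s) + z ^ 3 / (4 * s ^ 2) : ℂ)‖ ≤
      3 * ρ / 2 * s⁻¹ + ρ ^ 3 / 4 * (s⁻¹) ^ 2 := by
    refine (norm_add_le _ _).trans ?_
    simp only [norm_div, norm_neg, norm_pow, norm_mul, Complex.norm_real, Real.norm_of_nonneg hs.le,
      Complex.norm_ofNat]
    calc _ = 3 * ‖z‖ / 2 * s⁻¹ + ‖z‖ ^ 3 / 4 * (s⁻¹) ^ 2 := by field_simp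
      _ ≤ _ := by gcongr
  have hw := levyWeight_nonneg a hs
  have h1 := inv_mul_levyWeight_le ha hs
  have h2 := inv_sq_mul_levyWeight_le ha hs
  rw [subDensity₂, norm_mul]
  calc _ ≤ (3 * ρ / 2 * s⁻¹ + ρ ^ 3 / 4 * (s⁻¹) ^ 2) *
          ((2 * √Real.pi)⁻¹ * levyWeight a s) := by
        gcongr; exact norm_gaussFactor_le hz hs
    _ = (2 * √Real.pi)⁻¹ * (3 * ρ / 2 * (s⁻¹ * levyWeight a s) +
          ρ ^ 3 / 4 * ((s⁻¹) ^ 2 * levyWeight a s)) := by ring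
    _ ≤ (2 * √Real.pi)⁻¹ * (3 * ρ / 2 * (8 / a * levyWeight (a / 2) s) +
          ρ ^ 3 / 4 * (128 / a ^ 2 * levyWeight (a / 2) s)) := by gcongr
    _ = _ := by ring

theorem hasDerivAt_gaussFactor (z : ℂ) {s : ℝ} (hs : 0 < s) :
    HasDerivAt (fun z => gaussFactor z s) (-(z / (2 * s)) * gaussFactor z s) z := by
  have hs' : (s : ℂ) ≠ 0 := by exact_mod_cast hs.ne'
  have h := ((((hasDerivAt_id z).pow 2).neg.div_const (4 * (s : ℂ))).cexp).const_mul
    (((2 * √Real.pi)⁻¹ * s ^ (-3 / 2 : ℝ) : ℝ) : ℂ)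
  refine h.congr_deriv ?_
  simp only [gaussFactor, id, Pi.pow_apply, Pi.neg_apply]
  field_simp
  push_cast
  ring

theorem hasDerivAt_subDensity (z : ℂ) {s : ℝ} (hs : 0 < s) :
    HasDerivAt (fun z => subDensity z s) (subDensity₁ z s) z := by
  refine ((hasDerivAt_id z).mul (hasDerivAt_gaussFactor z hs)).congr_deriv ?_
  simp only [subDensity₁, id]
  ring

theorem hasDerivAt_subDensity₁ (z : ℂ) {s : ℝ} (hs : 0 < s) :
    HasDerivAt (fun z => subDensity₁ z s) (subDensity₂ z s) z := by
  have hs' : (s : ℂ) ≠ 0 := by exact_mod_cast hs.ne'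
  refine ((((hasDerivAt_id z).pow 2).div_const (2 * (s : ℂ))).const_sub 1 |>.mul
    (hasDerivAt_gaussFactor z hs)).congr_deriv ?_
  simp only [subDensity₂, id, Pi.pow_apply]
  field_simp
  push_cast
  ring

/-- The density solves `∂_z² η = ∂_s η`: the derivative found here is the one of
`hasDerivAt_subDensity₁`. This is the source of the equation `S'' = S M` for the subordinated family
`S`. -/
theorem hasDerivAt_subDensity_real (z : ℂ) {s : ℝ} (hs : 0 < s) :
    HasDerivAt (fun s => subDensity z s) (subDensity₂ z s) s := by
  have hs' : (s : ℂ) ≠ 0 := by exact_mod_cast hs.ne'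
  have h1 : HasDerivAt (fun s : ℝ => (((2 * √Real.pi)⁻¹ * s ^ (-3 / 2 : ℝ) : ℝ) : ℂ))
      (((2 * √Real.pi)⁻¹ * ((-3 / 2) * s ^ (-3 / 2 - 1 : ℝ)) : ℝ) : ℂ) s :=
    ((Real.hasDerivAt_rpow_const (Or.inl hs.ne')).const_mul _).ofReal_comp
  have h2 : HasDerivAt (fun s : ℝ => Complex.exp (-(z ^ 2) / (4 * (s : ℂ))))
      (Complex.exp (-(z ^ 2) / (4 * (s : ℂ))) * (z ^ 2 / (4 * s ^ 2))) s := by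
    have h3 : HasDerivAt (fun s : ℝ => -(z ^ 2) / (4 * (s : ℂ))) (z ^ 2 / (4 * s ^ 2)) s := by
      have h4 : HasDerivAt (fun w : ℂ => -(z ^ 2) / (4 * w)) (z ^ 2 / (4 * s ^ 2)) (s : ℂ) := by
        refine ((hasDerivAt_const (s : ℂ) (-(z ^ 2))).div ((hasDerivAt_id (s : ℂ)).const_mul 4)
          (by simpa using hs')).congr_deriv ?_
        simp only [id]
        field_simp
        ring
      exact h4.comp_ofReal
    exact h3.cexp
  refine ((h1.mul h2).const_mul z).congr_deriv ?_
  have h5 : s ^ (-3 / 2 - 1 : ℝ) = s ^ (-3 / 2 : ℝ) * s⁻¹ := by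
    rw [Real.rpow_sub hs, Real.rpow_one, div_eq_mul_inv]
  simp only [subDensity₂, gaussFactor, h5]
  push_cast
  field_simp

theorem continuousOn_gaussFactor (z : ℂ) : ContinuousOn (gaussFactor z) (Set.Ioi 0) := by
  intro s hs
  have hs0 : (s : ℝ) ≠ 0 := (Set.mem_Ioi.1 hs).ne'
  have hs' : (s : ℂ) ≠ 0 := by exact_mod_cast hs0
  refine ContinuousAt.continuousWithinAt ?_
  unfold gaussFactor
  have : ContinuousAt (fun s : ℝ => s ^ (-3 / 2 : ℝ)) s :=
    Real.continuousAt_rpow_const _ _ (Or.inl hs0)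
  have h4 : (4 * (s : ℂ)) ≠ 0 := by simpa using hs'
  fun_prop (disch := assumption)

theorem continuousOn_subDensity (z : ℂ) : ContinuousOn (subDensity z) (Set.Ioi 0) :=
  continuousOn_const.mul (continuousOn_gaussFactor z)

theorem continuousOn_subDensity₁ (z : ℂ) : ContinuousOn (subDensity₁ z) (Set.Ioi 0) := by
  refine ContinuousOn.mul (fun s hs => ?_) (continuousOn_gaussFactor z)
  have hs' : (s : ℂ) ≠ 0 := by exact_mod_cast (Set.mem_Ioi.1 hs).ne'
  have h4 : (2 * (s : ℂ)) ≠ 0 := by simpa using hs'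
  refine ContinuousAt.continuousWithinAt ?_
  fun_prop (disch := assumption)

theorem continuousOn_subDensity₂ (z : ℂ) : ContinuousOn (subDensity₂ z) (Set.Ioi 0) := by
  refine ContinuousOn.mul (fun s hs => ?_) (continuousOn_gaussFactor z)
  have hs' : (s : ℂ) ≠ 0 := by exact_mod_cast (Set.mem_Ioi.1 hs).ne'
  have h4 : (2 * (s : ℂ)) ≠ 0 := by simpa using hs'
  have h5 : (4 * (s : ℂ) ^ 2) ≠ 0 := by simpa using hs'
  refine ContinuousAt.continuousWithinAt ?_
  fun_prop (disch := assumption)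

theorem integrableOn_of_le_levyWeight {w : ℝ → ℂ} {a c : ℝ} (ha : 0 < a)
    (hw : ContinuousOn w (Set.Ioi 0)) (h : ∀ s, 0 < s → ‖w s‖ ≤ c * levyWeight a s) :
    IntegrableOn w (Set.Ioi 0) :=
  ((integrableOn_levyWeight ha).const_mul c).mono' (hw.aestronglyMeasurable measurableSet_Ioi)
    ((ae_restrict_iff' measurableSet_Ioi).2 (Eventually.of_forall fun s hs => h s hs))

theorem integrableOn_subDensity {z : ℂ} (hz : z ∈ diagSector) :
    IntegrableOn (subDensity z) (Set.Ioi 0) :=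
  integrableOn_of_le_levyWeight (diagSector_re_sq_pos hz) (continuousOn_subDensity z)
    fun _ hs => norm_subDensity_le le_rfl le_rfl hs

theorem integrableOn_subDensity₁ {z : ℂ} (hz : z ∈ diagSector) :
    IntegrableOn (subDensity₁ z) (Set.Ioi 0) :=
  integrableOn_of_le_levyWeight (half_pos (diagSector_re_sq_pos hz)) (continuousOn_subDensity₁ z)
    fun _ hs => norm_subDensity₁_le (diagSector_re_sq_pos hz) le_rfl le_rfl hs

theorem integrableOn_subDensity₂ {z : ℂ} (hz : z ∈ diagSector) :
    IntegrableOn (subDensity₂ z) (Set.Ioi 0) :=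
  integrableOn_of_le_levyWeight (half_pos (diagSector_re_sq_pos hz)) (continuousOn_subDensity₂ z)
    fun _ hs => norm_subDensity₂_le (diagSector_re_sq_pos hz) le_rfl le_rfl hs

theorem tendsto_subDensity_zero {z : ℂ} (hz : z ∈ diagSector) :
    Tendsto (subDensity z) (𝓝[>] 0) (𝓝 0) := by
  have ha := diagSector_re_sq_pos hz
  set a := (z ^ 2).re with hadef
  -- The majorant comes from trading `s⁻²` against half of the exponential, which leaves `s² ·
  -- s^(-3/2) = s^(1/2)`.
  have h1 : Tendsto (fun s : ℝ => (2 * √Real.pi)⁻¹ * ‖z‖ * (128 / a ^ 2 * s ^ (1 / 2 : ℝ)))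
      (𝓝[>] 0) (𝓝 0) := by
    have : Continuous fun s : ℝ => s ^ (1 / 2 : ℝ) := Real.continuous_rpow_const (by norm_num)
    have h2 := ((this.tendsto 0).const_mul (128 / a ^ 2)).const_mul ((2 * √Real.pi)⁻¹ * ‖z‖)
    rw [Real.zero_rpow (by norm_num), mul_zero, mul_zero] at h2
    exact h2.mono_left nhdsWithin_le_nhds
  refine squeeze_zero_norm' ?_ h1
  filter_upwards [self_mem_nhdsWithin] with s hs
  have hs' : 0 < s := hs
  refine (norm_subDensity_le (le_refl a) le_rfl hs').trans ?_
  gcongr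
  have h3 := inv_sq_mul_levyWeight_le ha hs'
  have h4 : levyWeight (a / 2) s ≤ s ^ (-3 / 2 : ℝ) := by
    unfold levyWeight
    refine mul_le_of_le_one_right (by positivity) ?_
    rw [Real.exp_le_one_iff, neg_div]
    have : 0 ≤ a / 2 / (4 * s) := by positivity
    linarith
  have h5 : s ^ (1 / 2 : ℝ) = s ^ 2 * s ^ (-3 / 2 : ℝ) := by
    rw [← Real.rpow_natCast s 2, ← Real.rpow_add hs']; norm_num
  calc levyWeight a s = s ^ 2 * ((s⁻¹) ^ 2 * levyWeight a s) := by field_simp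
    _ ≤ s ^ 2 * (128 / a ^ 2 * s ^ (-3 / 2 : ℝ)) := by
        exact mul_le_mul_of_nonneg_left (h3.trans (by gcongr)) (by positivity)
    _ = _ := by rw [h5]; ring

theorem levyWeight_le_rpow {a s : ℝ} (ha : 0 ≤ a) (hs : 0 < s) :
    levyWeight a s ≤ s ^ (-3 / 2 : ℝ) := by
  unfold levyWeight
  refine mul_le_of_le_one_right (by positivity) ?_
  rw [Real.exp_le_one_iff, neg_div]
  have : 0 ≤ a / (4 * s) := by positivity
  linarith

theorem tendsto_subDensity_atTop {z : ℂ} (hz : z ∈ diagSector) :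
    Tendsto (subDensity z) atTop (𝓝 0) := by
  have h1 : Tendsto (fun s : ℝ => (2 * √Real.pi)⁻¹ * ‖z‖ * s ^ (-(3 / 2) : ℝ)) atTop (𝓝 0) := by
    have := (tendsto_rpow_neg_atTop (by norm_num : (0 : ℝ) < 3 / 2)).const_mul
      ((2 * √Real.pi)⁻¹ * ‖z‖)
    simpa using this
  refine squeeze_zero_norm' ?_ h1
  filter_upwards [eventually_gt_atTop 0] with s hs
  refine (norm_subDensity_le le_rfl le_rfl hs).trans ?_
  gcongr
  have := levyWeight_le_rpow (diagSector_re_sq_pos hz).le hs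
  rwa [neg_div] at this

theorem subDensity_ofReal (t s : ℝ) :
    subDensity t s = (((2 * √Real.pi)⁻¹ * (t * levyWeight (t ^ 2) s) : ℝ) : ℂ) := by
  simp only [subDensity, gaussFactor, levyWeight]
  push_cast
  ring

theorem integral_subDensity_ofReal {t : ℝ} (ht : 0 < t) :
    ∫ s in Set.Ioi 0, ((2 * √Real.pi)⁻¹ * (t * levyWeight (t ^ 2) s)) = 1 := by
  rw [integral_const_mul, integral_const_mul, integral_levyWeight (by positivity),
    Real.sqrt_sq ht.le]
  have : √Real.pi ≠ 0 := by positivity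
  field_simp

/-- Comparison of the complex density with a real one. -/
theorem norm_subDensity_le_ofReal {z : ℂ} {τ c : ℝ} (h1 : ‖z‖ ≤ c * τ)
    (h2 : τ ^ 2 ≤ (z ^ 2).re) {s : ℝ} (hs : 0 < s) :
    ‖subDensity z s‖ ≤ c * ((2 * √Real.pi)⁻¹ * (τ * levyWeight (τ ^ 2) s)) :=
  (norm_subDensity_le h2 h1 hs).trans_eq (by ring)

end Density

/-! ### Averages of a bounded semigroup against the density -/

section Subordination

variable {E : Type*} [NormedAddCommGroup E] [NormedSpace ℂ E]

/-- A strongly continuous semigroup bounded by `B`. -/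
structure IsC0SemigroupBddBy (G : ℝ → E →L[ℂ] E) (B : ℝ) : Prop extends IsC0Semigroup G where
  norm_le : ∀ t : ℝ, 0 ≤ t → ‖G t‖ ≤ B

open Classical in
/-- The operator `f ↦ ∫₀^∞ w(s) G_s f ds`. -/
def weightedAvg (G : ℝ → E →L[ℂ] E) (w : ℝ → ℂ) : E →L[ℂ] E :=
  if h : ∃ S : E →L[ℂ] E, ∀ f, S f = ∫ s in Set.Ioi 0, w s • G s f then h.choose else 0

namespace IsC0SemigroupBddBy

variable {G : ℝ → E →L[ℂ] E} {B : ℝ}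

theorem bound_nonneg (hG : IsC0SemigroupBddBy G B) : 0 ≤ B :=
  (norm_nonneg _).trans (hG.norm_le 0 le_rfl)

theorem norm_apply_le (hG : IsC0SemigroupBddBy G B) (f : E) {s : ℝ} (hs : 0 < s) :
    ‖G s f‖ ≤ B * ‖f‖ :=
  ((G s).le_opNorm f).trans (by gcongr; exact hG.norm_le s hs.le)

variable [CompleteSpace E]

theorem aestronglyMeasurable (hG : IsC0SemigroupBddBy G B) {w : ℝ → ℂ}
    (hw : AEStronglyMeasurable w (volume.restrict (Set.Ioi 0))) (f : E) :
    AEStronglyMeasurable (fun s => w s • G s f) (volume.restrict (Set.Ioi 0)) :=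
  hw.smul (((hG.continuousOn f).mono Set.Ioi_subset_Ici_self).aestronglyMeasurable
    measurableSet_Ioi)

theorem integrableOn (hG : IsC0SemigroupBddBy G B) {w : ℝ → ℂ}
    (hw : IntegrableOn w (Set.Ioi 0)) (f : E) :
    IntegrableOn (fun s => w s • G s f) (Set.Ioi 0) := by
  refine (hw.norm.mul_const (B * ‖f‖)).mono' (hG.aestronglyMeasurable hw.1 f)
    ((ae_restrict_iff' measurableSet_Ioi).2 (Eventually.of_forall fun s hs => ?_))
  rw [norm_smul]
  gcongr
  exact hG.norm_apply_le f hs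

theorem weightedAvg_apply (hG : IsC0SemigroupBddBy G B) {w : ℝ → ℂ}
    (hw : IntegrableOn w (Set.Ioi 0)) (f : E) :
    weightedAvg G w f = ∫ s in Set.Ioi 0, w s • G s f := by
  have hex : ∃ S : E →L[ℂ] E, ∀ f, S f = ∫ s in Set.Ioi 0, w s • G s f := by
    refine ⟨LinearMap.mkContinuous
      { toFun := fun f => ∫ s in Set.Ioi 0, w s • G s f
        map_add' := fun f g => by
          simp only [map_add, smul_add]
          exact integral_add (hG.integrableOn hw f) (hG.integrableOn hw g)
        map_smul' := fun c f => by
          simp only [map_smul, RingHom.id_apply]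
          rw [← integral_smul]
          simp only [smul_comm c] }
      (∫ s in Set.Ioi 0, ‖w s‖ * B) fun f => ?_, fun f => rfl⟩
    change ‖∫ s in Set.Ioi 0, w s • G s f‖ ≤ _
    rw [← integral_mul_const]
    refine norm_integral_le_of_norm_le ((hw.norm.mul_const B).mul_const _)
      ((ae_restrict_iff' measurableSet_Ioi).2 (Eventually.of_forall fun s hs => ?_))
    rw [norm_smul, mul_assoc]
    gcongr
    exact hG.norm_apply_le f hs
  rw [weightedAvg, dif_pos hex]
  exact hex.choose_spec f

/-- The integral of `levyWeight a` is `2√π / √a`, which cancels the normalisation `(2√π)⁻¹`. -/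
theorem norm_weightedAvg_le (hG : IsC0SemigroupBddBy G B) {w : ℝ → ℂ} {a c : ℝ} (ha : 0 < a)
    (hc : 0 ≤ c) (hwc : ContinuousOn w (Set.Ioi 0))
    (hw : ∀ s, 0 < s → ‖w s‖ ≤ (2 * √Real.pi)⁻¹ * c * levyWeight a s) :
    ‖weightedAvg G w‖ ≤ B * c / √a := by
  have hB := hG.bound_nonneg
  refine ContinuousLinearMap.opNorm_le_bound _ (by positivity) fun f => ?_
  rw [hG.weightedAvg_apply (integrableOn_of_le_levyWeight ha hwc hw)]
  have h1 : B * c / √a * ‖f‖ =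
      ∫ s in Set.Ioi 0, (2 * √Real.pi)⁻¹ * c * (B * ‖f‖) * levyWeight a s := by
    rw [integral_const_mul, integral_levyWeight ha]
    have : √Real.pi ≠ 0 := by positivity
    field_simp
  rw [h1]
  refine norm_integral_le_of_norm_le ((integrableOn_levyWeight ha).const_mul _)
    ((ae_restrict_iff' measurableSet_Ioi).2 (Eventually.of_forall fun s hs => ?_))
  rw [norm_smul]
  calc _ ≤ ((2 * √Real.pi)⁻¹ * c * levyWeight a s) * (B * ‖f‖) := by
        gcongr
        · exact (norm_nonneg _).trans (hw s hs)
        · exact hw s hs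
        · exact hG.norm_apply_le f hs
    _ = _ := by ring

theorem weightedAvg_comm (hG : IsC0SemigroupBddBy G B) {w : ℝ → ℂ}
    (hw : IntegrableOn w (Set.Ioi 0)) {K : E →L[ℂ] E} (hK : ∀ s, 0 < s → ∀ f, K (G s f) = G s (K f))
    (f : E) : K (weightedAvg G w f) = weightedAvg G w (K f) := by
  rw [hG.weightedAvg_apply hw, hG.weightedAvg_apply hw,
    ← K.integral_comp_comm (hG.integrableOn hw f)]
  refine setIntegral_congr_fun measurableSet_Ioi fun s hs => ?_
  simp only [map_smul, hK s hs]

theorem gen_weightedAvg (hG : IsC0SemigroupBddBy G B) {w : ℝ → ℂ}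
    (hw : IntegrableOn w (Set.Ioi 0)) {f g : E} (h : Gen G f g) :
    Gen G (weightedAvg G w f) (weightedAvg G w g) := by
  refine (((weightedAvg G w).continuous.tendsto g).comp h).congr' ?_
  filter_upwards [self_mem_nhdsWithin] with r hr
  have hr' : (0 : ℝ) < r := hr
  have : G r (weightedAvg G w f) = weightedAvg G w (G r f) := by
    refine hG.weightedAvg_comm hw (fun s hs f => ?_) f
    simp only [← mul_apply_eq_comp]
    rw [← hG.add _ _ hr'.le hs.le, ← hG.add _ _ hs.le hr'.le, add_comm]
  simp [this]

theorem hasDerivAt_weightedAvg (hG : IsC0SemigroupBddBy G B) {w w' : ℂ → ℝ → ℂ} {z : ℂ}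
    {S : Set ℂ} (hS : S ∈ 𝓝 z) {a c : ℝ} (ha : 0 < a)
    (hw : ∀ x ∈ S, IntegrableOn (w x) (Set.Ioi 0)) (hw' : ContinuousOn (w' z) (Set.Ioi 0))
    (hb : ∀ x ∈ S, ∀ s, 0 < s → ‖w' x s‖ ≤ c * levyWeight a s)
    (hd : ∀ x ∈ S, ∀ s, 0 < s → HasDerivAt (fun x => w x s) (w' x s) x) (f : E) :
    HasDerivAt (fun x => weightedAvg G (w x) f) (weightedAvg G (w' z) f) z := by
  have hz := mem_of_mem_nhds hS
  rw [hG.weightedAvg_apply (integrableOn_of_le_levyWeight ha hw' (hb z hz))]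
  have := (hasDerivAt_integral_of_dominated_loc_of_deriv_le
    (μ := volume.restrict (Set.Ioi (0 : ℝ))) (F := fun x s => w x s • G s f)
    (F' := fun x s => w' x s • G s f) (bound := fun s => c * levyWeight a s * (B * ‖f‖)) hS
    (by filter_upwards [hS] with x hx using hG.aestronglyMeasurable (hw x hx).1 f)
    (hG.integrableOn (hw z hz) f)
    (hG.aestronglyMeasurable (hw'.aestronglyMeasurable measurableSet_Ioi) f)
    ((ae_restrict_iff' measurableSet_Ioi).2 (Eventually.of_forall fun s hs x hx => by
      rw [norm_smul]
      have := hb x hx s hs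
      gcongr
      · exact (norm_nonneg _).trans this
      · exact hG.norm_apply_le f hs))
    (((integrableOn_levyWeight ha).const_mul c).mul_const _)
    ((ae_restrict_iff' measurableSet_Ioi).2 (Eventually.of_forall fun s hs x hx =>
      (hd x hx s hs).smul_const _))).2
  refine this.congr_of_eventuallyEq ?_
  filter_upwards [hS] with x hx using hG.weightedAvg_apply (hw x hx) f

end IsC0SemigroupBddBy

/-- The subordinated (Poisson) semigroup at complex time `z`. -/
def subordinate (G : ℝ → E →L[ℂ] E) (z : ℂ) : E →L[ℂ] E :=
  if z = 0 then 1 else weightedAvg G (subDensity z)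

/-- The first derivative of the subordinated semigroup. -/
def subordinate₁ (G : ℝ → E →L[ℂ] E) (z : ℂ) : E →L[ℂ] E := weightedAvg G (subDensity₁ z)

/-- The second derivative of the subordinated semigroup. -/
def subordinate₂ (G : ℝ → E →L[ℂ] E) (z : ℂ) : E →L[ℂ] E := weightedAvg G (subDensity₂ z)

theorem ne_zero_of_mem_diagSector {z : ℂ} (hz : z ∈ diagSector) : z ≠ 0 := by
  rintro rfl
  simpa using diagSector_re_pos hz

theorem subordinate_of_mem {G : ℝ → E →L[ℂ] E} {z : ℂ} (hz : z ∈ diagSector) :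
    subordinate G z = weightedAvg G (subDensity z) :=
  if_neg (ne_zero_of_mem_diagSector hz)

theorem subordinate_zero (G : ℝ → E →L[ℂ] E) : subordinate G 0 = 1 := if_pos rfl

theorem exists_ball_diagSector {z : ℂ} (hz : z ∈ diagSector) :
    ∃ ε a ρ : ℝ, 0 < ε ∧ 0 < a ∧ 0 ≤ ρ ∧ ∀ x ∈ Metric.ball z ε, x ∈ diagSector ∧
      a ≤ (x ^ 2).re ∧ ‖x‖ ≤ ρ := by
  have h0 := diagSector_re_sq_pos hz
  have h1 : ∀ᶠ x in 𝓝 z, (z ^ 2).re / 2 < (x ^ 2).re := by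
    have : ContinuousAt (fun x : ℂ => (x ^ 2).re) z := by fun_prop
    exact this.eventually_const_lt (by linarith)
  have h2 : ∀ᶠ x in 𝓝 z, ‖x‖ < ‖z‖ + 1 := by
    have : ContinuousAt (fun x : ℂ => ‖x‖) z := by fun_prop
    exact this.eventually_lt_const (by linarith)
  obtain ⟨ε, hε, h⟩ := Metric.eventually_nhds_iff_ball.1
    ((h1.and h2).and (isOpen_diagSector.mem_nhds hz))
  exact ⟨ε, (z ^ 2).re / 2, ‖z‖ + 1, hε, by positivity, by positivity, fun x hx =>
    ⟨(h x hx).2, (h x hx).1.1.le, (h x hx).1.2.le⟩⟩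

/-- Functions which are holomorphic on the sector are determined by their values on `(0, ∞)`. -/
theorem eqOn_diagSector {F : Type*} [NormedAddCommGroup F] [NormedSpace ℂ F] [CompleteSpace F]
    {u v : ℂ → F} (hu : DifferentiableOn ℂ u diagSector) (hv : DifferentiableOn ℂ v diagSector)
    (h : ∀ t : ℝ, 0 < t → u t = v t) : Set.EqOn u v diagSector := by
  have h1 : (1 : ℂ) ∈ diagSector := by simpa using ofReal_mem_diagSector one_pos
  refine (hu.analyticOnNhd isOpen_diagSector).eqOn_of_preconnected_of_frequently_eq
    (hv.analyticOnNhd isOpen_diagSector) convex_diagSector.isPreconnected h1 ?_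
  have hlim : Tendsto (fun t : ℝ => (t : ℂ)) (𝓝[>] 1) (𝓝[≠] 1) := by
    refine tendsto_nhdsWithin_iff.2 ⟨?_, ?_⟩
    · have := Complex.continuous_ofReal.tendsto (1 : ℝ)
      rw [Complex.ofReal_one] at this
      exact this.mono_left nhdsWithin_le_nhds
    · filter_upwards [self_mem_nhdsWithin] with t ht
      have : t ≠ 1 := ne_of_gt ht
      simpa using this
  refine hlim.frequently (Eventually.frequently ?_)
  filter_upwards [self_mem_nhdsWithin] with t ht
  exact h t (one_pos.trans ht)

/-- Strong differentiability upgrades to norm differentiability, given a bound for the second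
derivative. -/
theorem hasDerivAt_clm_of_apply {F F' F'' : ℂ → E →L[ℂ] E} {z : ℂ} {ε K : ℝ} (hε : 0 < ε)
    (h1 : ∀ x ∈ Metric.ball z ε, ∀ f, HasDerivAt (fun x => F x f) (F' x f) x)
    (h2 : ∀ x ∈ Metric.ball z ε, ∀ f, HasDerivAt (fun x => F' x f) (F'' x f) x)
    (hK : ∀ x ∈ Metric.ball z ε, ‖F'' x‖ ≤ K) : HasDerivAt F (F' z) z := by
  have hK0 : 0 ≤ K := (norm_nonneg _).trans (hK z (Metric.mem_ball_self hε))
  -- A quadratic remainder, uniform over unit vectors, from two uses of the mean value inequality: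
  -- first for `F'`, then for `F x - (x - z) F' z`.
  have key : ∀ x ∈ Metric.ball z ε, ‖F x - F z - (x - z) • F' z‖ ≤ K * ‖x - z‖ ^ 2 := by
    intro x hx
    refine ContinuousLinearMap.opNorm_le_bound _ (by positivity) fun f => ?_
    have hsub : Metric.closedBall z ‖x - z‖ ⊆ Metric.ball z ε := by
      refine Metric.closedBall_subset_ball ?_
      rwa [Metric.mem_ball, dist_eq_norm] at hx
    have hz : z ∈ Metric.closedBall z ‖x - z‖ := Metric.mem_closedBall_self (norm_nonneg _)
    have hx' : x ∈ Metric.closedBall z ‖x - z‖ := by rw [Metric.mem_closedBall, dist_eq_norm]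
    have hF' : ∀ y ∈ Metric.closedBall z ‖x - z‖, ‖F' y f - F' z f‖ ≤ K * ‖f‖ * ‖x - z‖ := by
      intro y hy
      have := (convex_closedBall z ‖x - z‖).norm_image_sub_le_of_norm_hasDerivWithin_le
        (f := fun x => F' x f) (f' := fun x => F'' x f) (C := K * ‖f‖)
        (fun x hx => (h2 x (hsub hx) f).hasDerivWithinAt)
        (fun x hx => ((F'' x).le_opNorm f).trans (by gcongr; exact hK x (hsub hx))) hz hy
      refine this.trans ?_
      gcongr
      rwa [Metric.mem_closedBall, dist_eq_norm] at hy
    have := (convex_closedBall z ‖x - z‖).norm_image_sub_le_of_norm_hasDerivWithin_le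
      (f := fun x => F x f - (x - z) • F' z f) (f' := fun x => F' x f - F' z f)
      (C := K * ‖f‖ * ‖x - z‖)
      (fun x hx => by
        have hd := (h1 x (hsub hx) f).sub (((hasDerivAt_id x).sub_const z).smul_const (F' z f))
        simpa [Pi.sub_def] using hd.hasDerivWithinAt)
      hF' hz hx'
    simp only [sub_self, zero_smul, sub_zero] at this
    simp only [sub_apply, smul_apply]
    calc _ = ‖F x f - (x - z) • F' z f - F z f‖ := by congr 1; abel
      _ ≤ _ := this.trans_eq (by ring)
  rw [hasDerivAt_iff_isLittleO]
  have hO : (fun x => F x - F z - (x - z) • F' z) =O[𝓝 z] fun x => ‖x - z‖ ^ 2 := by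
    refine Asymptotics.IsBigO.of_bound K ?_
    filter_upwards [Metric.ball_mem_nhds z hε] with x hx
    simpa using key x hx
  refine hO.trans_isLittleO ?_
  have := (Asymptotics.isLittleO_pow_sub_sub z (m := 2) one_lt_two)
  simpa using this

namespace IsC0SemigroupBddBy

variable {G : ℝ → E →L[ℂ] E} {B : ℝ} [CompleteSpace E]

theorem hasDerivAt_subordinate_apply (hG : IsC0SemigroupBddBy G B) {z : ℂ} (hz : z ∈ diagSector)
    (f : E) : HasDerivAt (fun z => subordinate G z f) (subordinate₁ G z f) z := by
  obtain ⟨ε, a, ρ, hε, ha, hρ, h⟩ := exists_ball_diagSector hz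
  refine (hG.hasDerivAt_weightedAvg (Metric.ball_mem_nhds z hε) (half_pos ha)
    (fun x hx => integrableOn_subDensity (h x hx).1) (continuousOn_subDensity₁ z)
    (fun x hx s hs => norm_subDensity₁_le ha (h x hx).2.1 (h x hx).2.2 hs)
    (fun x hx s hs => hasDerivAt_subDensity x hs) f).congr_of_eventuallyEq ?_
  filter_upwards [isOpen_diagSector.mem_nhds hz] with x hx
  rw [subordinate_of_mem hx]

theorem hasDerivAt_subordinate₁_apply (hG : IsC0SemigroupBddBy G B) {z : ℂ} (hz : z ∈ diagSector)
    (f : E) : HasDerivAt (fun z => subordinate₁ G z f) (subordinate₂ G z f) z := by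
  obtain ⟨ε, a, ρ, hε, ha, hρ, h⟩ := exists_ball_diagSector hz
  exact hG.hasDerivAt_weightedAvg (Metric.ball_mem_nhds z hε) (half_pos ha)
    (fun x hx => integrableOn_subDensity₁ (h x hx).1) (continuousOn_subDensity₂ z)
    (fun x hx s hs => norm_subDensity₂_le ha (h x hx).2.1 (h x hx).2.2 hs)
    (fun x hx s hs => hasDerivAt_subDensity₁ x hs) f

theorem norm_subordinate_le (hG : IsC0SemigroupBddBy G B) {z : ℂ} (hz : z ∈ diagSector) :
    ‖subordinate G z‖ ≤ B * ‖z‖ / √(z ^ 2).re := by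
  rw [subordinate_of_mem hz]
  exact hG.norm_weightedAvg_le (diagSector_re_sq_pos hz) (norm_nonneg _)
    (continuousOn_subDensity z) fun s hs => norm_subDensity_le le_rfl le_rfl hs

theorem norm_subordinate₁_le (hG : IsC0SemigroupBddBy G B) {z : ℂ} {a ρ : ℝ} (ha : 0 < a)
    (hz : a ≤ (z ^ 2).re) (hρ : ‖z‖ ≤ ρ) :
    ‖subordinate₁ G z‖ ≤ B * (1 + 4 * ρ ^ 2 / a) / √(a / 2) :=
  hG.norm_weightedAvg_le (half_pos ha) (by positivity)
    (continuousOn_subDensity₁ z) fun _ hs => norm_subDensity₁_le ha hz hρ hs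

theorem norm_subordinate₂_le (hG : IsC0SemigroupBddBy G B) {z : ℂ} {a ρ : ℝ} (ha : 0 < a)
    (hz : a ≤ (z ^ 2).re) (hρ : ‖z‖ ≤ ρ) :
    ‖subordinate₂ G z‖ ≤ B * (12 * ρ / a + 32 * ρ ^ 3 / a ^ 2) / √(a / 2) := by
  have hρ0 : 0 ≤ ρ := (norm_nonneg _).trans hρ
  exact hG.norm_weightedAvg_le (half_pos ha) (by positivity)
    (continuousOn_subDensity₂ z) fun _ hs => norm_subDensity₂_le ha hz hρ hs

theorem hasDerivAt_subordinate (hG : IsC0SemigroupBddBy G B) {z : ℂ} (hz : z ∈ diagSector) :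
    HasDerivAt (subordinate G) (subordinate₁ G z) z := by
  obtain ⟨ε, a, ρ, hε, ha, hρ, h⟩ := exists_ball_diagSector hz
  exact hasDerivAt_clm_of_apply hε
    (fun x hx f => hG.hasDerivAt_subordinate_apply (h x hx).1 f)
    (fun x hx f => hG.hasDerivAt_subordinate₁_apply (h x hx).1 f)
    (fun x hx => hG.norm_subordinate₂_le ha (h x hx).2.1 (h x hx).2.2)

theorem differentiableOn_subordinate (hG : IsC0SemigroupBddBy G B) :
    DifferentiableOn ℂ (subordinate G) diagSector := fun _ hz =>
  (hG.hasDerivAt_subordinate hz).differentiableAt.differentiableWithinAt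

/-- A norm-holomorphic function is infinitely differentiable, so its derivative is
norm-differentiable without a bound for the third derivative. The value is then identified vector by
vector. -/
theorem hasDerivAt_subordinate₁ (hG : IsC0SemigroupBddBy G B) {z : ℂ} (hz : z ∈ diagSector) :
    HasDerivAt (subordinate₁ G) (subordinate₂ G z) z := by
  have hd : DifferentiableAt ℂ (subordinate₁ G) z := by
    have h1 := ((hG.differentiableOn_subordinate.analyticOnNhd isOpen_diagSector) z
      hz).deriv.differentiableAt
    refine h1.congr_of_eventuallyEq ?_
    filter_upwards [isOpen_diagSector.mem_nhds hz] with x hx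
    exact (hG.hasDerivAt_subordinate hx).deriv.symm
  convert! hd.hasDerivAt using 1
  refine ContinuousLinearMap.ext fun f => ?_
  have h2 := hd.hasDerivAt.clm_apply (hasDerivAt_const z f)
  simp only [map_zero, add_zero] at h2
  exact (hG.hasDerivAt_subordinate₁_apply hz f).unique h2

theorem gen_subordinate (hG : IsC0SemigroupBddBy G B) {z : ℂ} (hz : z ∈ diagSector) {f g : E}
    (h : Gen G f g) : Gen G (subordinate G z f) (subordinate G z g) := by
  rw [subordinate_of_mem hz]
  exact hG.gen_weightedAvg (integrableOn_subDensity hz) h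

/-- The subordinated semigroup satisfies `∂²u = M u`. -/
theorem subordinate₂_apply (hG : IsC0SemigroupBddBy G B) {z : ℂ} (hz : z ∈ diagSector) {f g : E}
    (h : Gen G f g) : subordinate₂ G z f = subordinate G z g := by
  rw [subordinate_of_mem hz, subordinate₂, hG.weightedAvg_apply (integrableOn_subDensity₂ hz),
    hG.weightedAvg_apply (integrableOn_subDensity hz), ← sub_eq_zero,
    ← integral_sub (hG.integrableOn (integrableOn_subDensity₂ hz) f)
      (hG.integrableOn (integrableOn_subDensity hz) g)]
  have hb : ∀ {l : Filter ℝ}, (∀ᶠ s in l, 0 < s) → Tendsto (subDensity z) l (𝓝 0) →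
      Tendsto (fun s => subDensity z s • G s f) l (𝓝 0) := by
    intro l hl hlim
    have h1 : Tendsto (fun s => ‖subDensity z s‖ * (B * ‖f‖)) l (𝓝 0) := by
      simpa using hlim.norm.mul_const (B * ‖f‖)
    refine squeeze_zero_norm' ?_ h1
    filter_upwards [hl] with s hs
    rw [norm_smul]
    gcongr
    exact hG.norm_apply_le f hs
  have h0 : subDensity z 0 = 0 := by
    simp [subDensity, gaussFactor, Real.zero_rpow]
  -- Integration by parts: `subDensity₂` is also the `s`-derivative of the density, so the integrand
  -- is the derivative of `η_z(s) G s f`, which vanishes at both ends.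
  have := integral_Ioi_of_hasDerivAt_of_tendsto (a := 0) (m := 0)
    (f := fun s => subDensity z s • G s f)
    (f' := fun s => subDensity₂ z s • G s f - subDensity z s • G s g)
    (by
      refine continuousWithinAt_Ioi_iff_Ici.1 ?_
      have := hb (l := 𝓝[>] 0) self_mem_nhdsWithin (tendsto_subDensity_zero hz)
      rw [ContinuousWithinAt, h0, zero_smul]
      exact this)
    (fun s hs => by
      have hd := (hasDerivAt_subDensity_real z hs).smul (hG.hasDerivAt_orbit h hs)
      refine hd.congr_deriv ?_
      rw [smul_neg]; abel)
    ((hG.integrableOn (integrableOn_subDensity₂ hz) f).sub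
      (hG.integrableOn (integrableOn_subDensity hz) g))
    (hb (eventually_gt_atTop 0) (tendsto_subDensity_atTop hz))
  rw [this, h0, zero_smul, sub_zero]

end IsC0SemigroupBddBy

/-- For the trivial semigroup on `ℂ`, the general results become statements about the density alone.
-/
theorem isC0SemigroupBddBy_one : IsC0SemigroupBddBy (fun _ : ℝ => (1 : ℂ →L[ℂ] ℂ)) 1 where
  zero := rfl
  add _ _ _ _ := by simp
  tendsto f := by simp
  norm_le _ _ := by simp

/-- For real `z` this is a Gaussian integral; both sides are holomorphic in the sector, so the
identity theorem applies. -/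
theorem integral_subDensity {z : ℂ} (hz : z ∈ diagSector) :
    ∫ s in Set.Ioi 0, subDensity z s = 1 := by
  have hG := isC0SemigroupBddBy_one
  have h1 : ∀ {z : ℂ}, z ∈ diagSector →
      subordinate (fun _ : ℝ => (1 : ℂ →L[ℂ] ℂ)) z 1 = ∫ s in Set.Ioi 0, subDensity z s := by
    intro z hz
    rw [subordinate_of_mem hz, hG.weightedAvg_apply (integrableOn_subDensity hz)]
    simp
  rw [← h1 hz]
  refine eqOn_diagSector (v := fun _ => (1 : ℂ))
    (fun z hz => (hG.hasDerivAt_subordinate_apply hz 1).differentiableAt.differentiableWithinAt)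
    (differentiableOn_const _) (fun t ht => ?_) hz
  rw [h1 (ofReal_mem_diagSector ht)]
  simp only [subDensity_ofReal]
  rw [integral_complex_ofReal, integral_subDensity_ofReal ht, Complex.ofReal_one]

/-- The part of the sector `diagSector` where `|z|² ≤ κ Re z²`. -/
def subSector (κ : ℝ) : Set ℂ := {z | z ∈ diagSector ∧ ‖z‖ ^ 2 ≤ κ * (z ^ 2).re}

theorem norm_div_sqrt_le {z : ℂ} {κ : ℝ} (hz : z ∈ subSector κ) : ‖z‖ / √(z ^ 2).re ≤ √κ := by
  have h0 := diagSector_re_sq_pos hz.1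
  rw [div_le_iff₀ (by positivity), ← Real.sqrt_mul' _ h0.le]
  exact Real.le_sqrt_of_sq_le hz.2

namespace IsC0SemigroupBddBy

variable {G : ℝ → E →L[ℂ] E} {B : ℝ} [CompleteSpace E]

theorem norm_subordinate_le_of_subSector (hG : IsC0SemigroupBddBy G B) {z : ℂ} {κ : ℝ}
    (hz : z ∈ subSector κ) : ‖subordinate G z‖ ≤ B * √κ := by
  refine (hG.norm_subordinate_le hz.1).trans ?_
  rw [mul_div_assoc]
  exact mul_le_mul_of_nonneg_left (norm_div_sqrt_le hz) hG.bound_nonneg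

/-- An approximate identity: `η_z` has integral `1`, `L¹` norm `|z|/√(Re z²) ≤ √κ`, and mass
`O(|z|)` on `s ≥ δ`. The restriction to `subSector κ` keeps the `L¹` norms bounded. -/
theorem tendsto_subordinate_zero (hG : IsC0SemigroupBddBy G B) (κ : ℝ) (f : E) :
    Tendsto (fun z => subordinate G z f) (𝓝[subSector κ] 0) (𝓝 f) := by
  have hB := hG.bound_nonneg
  rw [Metric.tendsto_nhds]
  intro ε hε
  set ε' := ε / (2 * (√κ + 1)) with hε'
  have hε'0 : 0 < ε' := by positivity
  obtain ⟨δ, hδ, hδ'⟩ : ∃ δ > 0, ∀ s, 0 < s → s < δ → ‖G s f - f‖ ≤ ε' := by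
    have h1 := (tendsto_sub_nhds_zero_iff.2 (hG.tendsto f)).norm
    rw [norm_zero] at h1
    have h2 := h1.eventually_lt_const hε'0
    obtain ⟨δ, hδ, h⟩ := mem_nhdsGT_iff_exists_Ioo_subset.1 h2
    exact ⟨δ, hδ, fun s h0 h1 => (h ⟨h0, h1⟩).le⟩
  set C := ∫ s in Set.Ioi (0 : ℝ), (Set.Ici δ).indicator (fun s => s ^ (-3 / 2 : ℝ)) s with hC
  have hint : IntegrableOn ((Set.Ici δ).indicator (fun s : ℝ => s ^ (-3 / 2 : ℝ))) (Set.Ioi 0) := by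
    refine Integrable.integrableOn ((integrable_indicator_iff measurableSet_Ici).2 ?_)
    rw [integrableOn_Ici_iff_integrableOn_Ioi]
    exact integrableOn_Ioi_rpow_of_lt (by norm_num) hδ
  set D := (2 * √Real.pi)⁻¹ * ((B + 1) * ‖f‖) * C with hD
  have hsmall : ∀ᶠ z in 𝓝[subSector κ] (0 : ℂ), ‖z‖ * D < ε / 2 := by
    have : Continuous fun z : ℂ => ‖z‖ * D := by fun_prop
    have h2 := (this.tendsto 0).mono_left (nhdsWithin_le_nhds (s := subSector κ))
    rw [norm_zero, zero_mul] at h2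
    exact h2.eventually_lt_const (by positivity)
  filter_upwards [hsmall, self_mem_nhdsWithin] with z hzD hz
  have hi := integrableOn_subDensity hz.1
  rw [dist_eq_norm, subordinate_of_mem hz.1, hG.weightedAvg_apply hi]
  have e1 : f = ∫ s in Set.Ioi 0, subDensity z s • f := by
    rw [integral_smul_const, integral_subDensity hz.1, one_smul]
  have e2 : (∫ s in Set.Ioi 0, subDensity z s • G s f) - f =
      ∫ s in Set.Ioi 0, subDensity z s • (G s f - f) := by
    conv_lhs => rw [e1]
    rw [← integral_sub]
    · conv_lhs => rw [← e1]
      simp only [smul_sub]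
    · rw [← e1]; exact hG.integrableOn hi f
    · exact hi.smul_const f
  have e3 : ∫ s in Set.Ioi 0, ‖subDensity z s‖ = ‖z‖ / √(z ^ 2).re := by
    rw [setIntegral_congr_fun measurableSet_Ioi fun s hs => norm_subDensity z hs,
      integral_const_mul, integral_const_mul, integral_levyWeight (diagSector_re_sq_pos hz.1)]
    have : √Real.pi ≠ 0 := by positivity
    field_simp
  have hpt : ∀ s, 0 < s → ‖subDensity z s • (G s f - f)‖ ≤ ‖subDensity z s‖ * ε' +
      (2 * √Real.pi)⁻¹ * ‖z‖ * ((B + 1) * ‖f‖) *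
        (Set.Ici δ).indicator (fun s => s ^ (-3 / 2 : ℝ)) s := by
    intro s hs
    rw [norm_smul]
    rcases lt_or_ge s δ with h | h
    · rw [Set.indicator_of_notMem (by simpa using h), mul_zero, add_zero]
      gcongr
      exact hδ' s hs h
    · rw [Set.indicator_of_mem (by simpa using h)]
      have h1 : ‖subDensity z s‖ ≤ (2 * √Real.pi)⁻¹ * ‖z‖ * s ^ (-3 / 2 : ℝ) :=
        (norm_subDensity_le le_rfl le_rfl hs).trans (by
          gcongr; exact levyWeight_le_rpow (diagSector_re_sq_pos hz.1).le hs)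
      have h2 : ‖G s f - f‖ ≤ (B + 1) * ‖f‖ :=
        (norm_sub_le _ _).trans ((add_le_add (hG.norm_apply_le f hs) le_rfl).trans_eq (by ring))
      have h3 : 0 ≤ ‖subDensity z s‖ * ε' := by positivity
      calc _ ≤ ((2 * √Real.pi)⁻¹ * ‖z‖ * s ^ (-3 / 2 : ℝ)) * ((B + 1) * ‖f‖) := by gcongr
        _ ≤ _ := by linarith
  rw [e2]
  calc _ ≤ ∫ s in Set.Ioi 0, (‖subDensity z s‖ * ε' +
      (2 * √Real.pi)⁻¹ * ‖z‖ * ((B + 1) * ‖f‖) *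
        (Set.Ici δ).indicator (fun s => s ^ (-3 / 2 : ℝ)) s) :=
        norm_integral_le_of_norm_le ((hi.norm.mul_const _).add (hint.const_mul _))
          ((ae_restrict_iff' measurableSet_Ioi).2 (Eventually.of_forall hpt))
    _ = ‖z‖ / √(z ^ 2).re * ε' + ‖z‖ * D := by
        rw [integral_add (hi.norm.mul_const _) (hint.const_mul _), integral_mul_const, e3,
          integral_const_mul, hD]
        ring
    _ ≤ √κ * ε' + ‖z‖ * D := by gcongr; exact norm_div_sqrt_le hz
    _ < ε / 2 + ε / 2 := by
        refine add_lt_add_of_le_of_lt ?_ hzD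
        rw [hε', mul_div_assoc', div_le_div_iff₀ (by positivity) (by positivity)]
        have := Real.sqrt_nonneg κ
        nlinarith
    _ = ε := by ring

end IsC0SemigroupBddBy

end Subordination

/-! ### Uniqueness for `x'' = M x` and the semigroup law -/

section SquareRoot

theorem hasDerivAt_comp_ofReal {F : Type*} [NormedAddCommGroup F] [NormedSpace ℂ F] {u : ℂ → F}
    {u' : F} {r : ℝ} (h : HasDerivAt u u' (r : ℂ)) : HasDerivAt (fun r : ℝ => u r) u' r := by
  simpa [Function.comp_def] using h.scomp r Complex.ofRealCLM.hasDerivAt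

theorem Gen.unique {E : Type*} [NormedAddCommGroup E] [NormedSpace ℂ E] {T : ℝ → E →L[ℂ] E}
    {f g g' : E} (h : Gen T f g) (h' : Gen T f g') : g = g' :=
  tendsto_nhds_unique h h'

variable {E : Type*} [NormedAddCommGroup E] [NormedSpace ℂ E] [CompleteSpace E]

theorem ofReal_mem_subSector {t : ℝ} (ht : 0 < t) : (t : ℂ) ∈ subSector 1 := by
  refine ⟨ofReal_mem_diagSector ht, ?_⟩
  rw [re_sq]
  simp

theorem mem_subSector_self {z : ℂ} (hz : z ∈ diagSector) :
    z ∈ subSector (‖z‖ ^ 2 / (z ^ 2).re) :=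
  ⟨hz, by rw [div_mul_cancel₀ _ (diagSector_re_sq_pos hz).ne']⟩

theorem one_le_of_mem_subSector {z : ℂ} {κ : ℝ} (hz : z ∈ subSector κ) : 1 ≤ κ := by
  have h0 := diagSector_re_sq_pos hz.1
  have h1 : (z ^ 2).re ≤ ‖z‖ ^ 2 := (Complex.re_le_norm _).trans_eq (norm_pow _ _)
  by_contra! h
  nlinarith [hz.2]

/-- A shift to the right adds `2 r Re z + r²` to both `|z|²` and `Re z²`, and `κ ≥ 1`. -/
theorem add_ofReal_mem_subSector {z : ℂ} {κ : ℝ} (hz : z ∈ subSector κ) {r : ℝ} (hr : 0 ≤ r) :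
    z + r ∈ subSector κ := by
  have hκ := one_le_of_mem_subSector hz
  have hre := diagSector_re_pos hz.1
  refine ⟨?_, ?_⟩
  · rcases hr.eq_or_lt with rfl | h
    · simpa using hz.1
    · exact add_mem_diagSector hz.1 (ofReal_mem_diagSector h)
  · have h2 := hz.2
    rw [re_sq, ← Complex.normSq_eq_norm_sq, Complex.normSq_apply] at h2 ⊢
    simp only [Complex.add_re, Complex.add_im, Complex.ofReal_re, Complex.ofReal_im, add_zero]
    nlinarith [mul_nonneg (sub_nonneg.2 hκ) (by positivity : 0 ≤ 2 * z.re * r + r ^ 2)]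

theorem smul_mem_subSector {z : ℂ} {κ : ℝ} (hz : z ∈ subSector κ) {t : ℝ} (ht : 0 < t) :
    (t : ℂ) * z ∈ subSector κ := by
  refine ⟨smul_mem_diagSector hz.1 ht, ?_⟩
  rw [mul_pow, ← Complex.ofReal_pow, Complex.re_ofReal_mul, norm_mul, Complex.norm_real,
    Real.norm_of_nonneg ht.le, mul_pow]
  nlinarith [hz.2, sq_nonneg t, mul_le_mul_of_nonneg_left hz.2 (sq_nonneg t)]

theorem tendsto_ofReal_mul_subSector {z : ℂ} {κ : ℝ} (hz : z ∈ subSector κ) :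
    Tendsto (fun t : ℝ => (t : ℂ) * z) (𝓝[>] 0) (𝓝[subSector κ] 0) := by
  refine tendsto_nhdsWithin_iff.2 ⟨?_, ?_⟩
  · have : Continuous fun t : ℝ => (t : ℂ) * z := by fun_prop
    simpa using (this.tendsto 0).mono_left (nhdsWithin_le_nhds (s := Set.Ioi 0))
  · filter_upwards [self_mem_nhdsWithin] with t ht using smul_mem_subSector hz ht

namespace IsC0SemigroupBddBy

variable {G : ℝ → E →L[ℂ] E} {B : ℝ}

/-- Along the half-line `|z|²/Re z²` stays at most `κ`, so the norm bound for `subordinate₁` is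
`O(1/r)`. -/
theorem tendsto_subordinate₁_atTop (hG : IsC0SemigroupBddBy G B) {c : ℂ} (hc : c ∈ diagSector) :
    Tendsto (fun r : ℝ => ‖subordinate₁ G (c + r)‖) atTop (𝓝 0) := by
  have hκ := mem_subSector_self hc
  set κ := ‖c‖ ^ 2 / (c ^ 2).re
  have hκ0 : 0 < κ := one_pos.trans_le (one_le_of_mem_subSector hκ)
  have hlim : Tendsto (fun r : ℝ => B * (1 + 4 * κ) * (√(1 / (2 * κ)))⁻¹ * r⁻¹) atTop (𝓝 0) := by
    simpa using tendsto_inv_atTop_zero.const_mul (B * (1 + 4 * κ) * (√(1 / (2 * κ)))⁻¹)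
  refine squeeze_zero' (Eventually.of_forall fun _ => norm_nonneg _) ?_ hlim
  filter_upwards [eventually_gt_atTop 0] with r hr
  have h1 := add_ofReal_mem_subSector hκ hr.le
  have h3 := diagSector_re_sq_pos h1.1
  have h2 := hG.norm_subordinate₁_le h3 le_rfl (le_refl ‖c + r‖)
  have h4 : r ^ 2 ≤ ‖c + r‖ ^ 2 := by
    have : r ≤ (c + r).re := by simpa using (diagSector_re_pos hc).le
    exact pow_le_pow_left₀ hr.le (this.trans (Complex.re_le_norm _)) 2
  have h5 : r ^ 2 / κ ≤ ((c + r) ^ 2).re := by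
    rw [div_le_iff₀ hκ0, mul_comm]; exact h4.trans h1.2
  have hB := hG.bound_nonneg
  have h6 : ‖c + r‖ ^ 2 / ((c + r) ^ 2).re ≤ κ := by
    rw [div_le_iff₀ h3]; exact h1.2
  have h7 : √(1 / (2 * κ)) * r ≤ √(((c + r) ^ 2).re / 2) := by
    rw [← Real.sqrt_sq hr.le, ← Real.sqrt_mul (by positivity), Real.sqrt_sq hr.le]
    apply Real.sqrt_le_sqrt
    calc 1 / (2 * κ) * r ^ 2 = r ^ 2 / κ / 2 := by field_simp
      _ ≤ _ := by gcongr
  calc _ ≤ _ := h2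
    _ ≤ B * (1 + 4 * κ) / (√(1 / (2 * κ)) * r) := by
        rw [mul_div_assoc 4]
        gcongr
    _ = _ := by rw [div_eq_mul_inv, mul_inv]; ring

/-- Bounded solutions of `x'' = M x` on `(0, ∞)` are orbits of the subordinated semigroup. -/
theorem eq_subordinate_of_deriv (hG : IsC0SemigroupBddBy G B) {x x' x'' : ℝ → E} {f : E} {C : ℝ}
    (hx : ∀ r, 0 < r → HasDerivAt x (x' r) r) (hx' : ∀ r, 0 < r → HasDerivAt x' (x'' r) r)
    (hM : ∀ r, 0 < r → Gen G (x r) (x'' r)) (hb : ∀ r, 0 < r → ‖x r‖ ≤ C)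
    (h0 : Tendsto x (𝓝[>] 0) (𝓝 f)) {t : ℝ} (ht : 0 < t) : x t = subordinate G t f := by
  have hadd : ∀ {c : ℂ}, c ∈ diagSector → ∀ {r : ℝ}, 0 ≤ r → c + r ∈ diagSector := by
    intro c hc r hr
    exact (add_ofReal_mem_subSector (mem_subSector_self hc) hr).1
  have hshift : ∀ {F F' : ℂ → E →L[ℂ] E} {c : ℂ} {r : ℝ}, HasDerivAt F (F' (c + r)) (c + r) →
      HasDerivAt (fun r : ℝ => F (c + r)) (F' (c + r)) r := by
    intro F F' c r h
    exact hasDerivAt_comp_ofReal (HasDerivAt.comp_const_add c (r : ℂ) h)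
  have happ : ∀ {F : ℝ → E →L[ℂ] E} {F' : E →L[ℂ] E} {y : ℝ → E} {y' : E} {r : ℝ},
      HasDerivAt F F' r → HasDerivAt y y' r → HasDerivAt (fun r => F r (y r)) (F' (y r) + F r y') r := by
    intro F F' y y' r h1 h2
    have h3 := (((ContinuousLinearMap.restrictScalarsL ℂ E E ℝ ℝ).hasFDerivAt).comp_hasDerivAt r h1)
    exact h3.clm_apply h2
  -- Write `S` for the subordinated family. The Wronskian `W(r) = S'(c+r) x(s+r) - S(c+r) x'(s+r)`
  -- is constant, because `S'' x = S M x = S x''`. The claim is that it vanishes.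
  have step1 : ∀ {c : ℂ}, c ∈ diagSector → ∀ {s : ℝ}, 0 < s →
      subordinate₁ G c (x s) = subordinate G c (x' s) := by
    intro c hc s hs
    set W : ℝ → E := fun r => subordinate₁ G (c + r) (x (s + r)) - subordinate G (c + r) (x' (s + r))
      with hW
    have hxs : ∀ {r : ℝ}, 0 ≤ r → HasDerivAt (fun r => x (s + r)) (x' (s + r)) r :=
      fun {r} hr => HasDerivAt.comp_const_add s r (hx _ (by linarith))
    have hxs' : ∀ {r : ℝ}, 0 ≤ r → HasDerivAt (fun r => x' (s + r)) (x'' (s + r)) r :=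
      fun {r} hr => HasDerivAt.comp_const_add s r (hx' _ (by linarith))
    have hWd : ∀ r, 0 ≤ r → HasDerivAt W 0 r := by
      intro r hr
      have h1 := happ (hshift (hG.hasDerivAt_subordinate₁ (hadd hc hr))) (hxs hr)
      have h2 := happ (hshift (hG.hasDerivAt_subordinate (hadd hc hr))) (hxs' hr)
      refine (h1.sub h2).congr_deriv ?_
      rw [hG.subordinate₂_apply (hadd hc hr) (hM (s + r) (by linarith))]
      abel
    have hWc : ∀ r, 0 ≤ r → W r = W 0 := by
      intro r hr
      refine constant_of_has_deriv_right_zero (a := 0) (b := r) (f := W)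
        (fun y hy => (hWd y hy.1).continuousAt.continuousWithinAt)
        (fun y hy => (hWd y hy.1).hasDerivWithinAt) r ⟨hr, le_rfl⟩
    set κ := ‖c‖ ^ 2 / (c ^ 2).re
    have hC : 0 ≤ C := (norm_nonneg _).trans (hb s hs)
    have hB := hG.bound_nonneg
    set D := B * √κ * C
    have hy : ∀ r : ℝ, 0 ≤ r → ‖subordinate G (c + r) (x (s + r))‖ ≤ D := by
      intro r hr
      refine ((subordinate G (c + r)).le_opNorm _).trans ?_
      exact mul_le_mul (hG.norm_subordinate_le_of_subSector
          (add_ofReal_mem_subSector (mem_subSector_self hc) hr)) (hb _ (by linarith))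
        (norm_nonneg _) (by positivity)
    -- The function `y(r) = S(c+r) x(s+r)` is bounded, and `y' = 2 S'(c+r) x(s+r) - W(0)`, where the
    -- first term tends to `0`. A nonzero `W(0)` would make `y` grow linearly.
    have hw : W 0 = 0 := by
      by_contra hne
      have hpos : 0 < ‖W 0‖ := norm_pos_iff.2 hne
      have hlim := (hG.tendsto_subordinate₁_atTop hc).const_mul (2 * C)
      rw [mul_zero] at hlim
      obtain ⟨R, hR⟩ := eventually_atTop.1 (hlim.eventually_lt_const (half_pos hpos))
      set R' := max R 0
      have hR0 : 0 ≤ R' := le_max_right _ _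
      have hder : ∀ r, R' ≤ r → HasDerivAt (fun r : ℝ => subordinate G (c + r) (x (s + r)) + r • W 0)
          ((2 : ℝ) • subordinate₁ G (c + r) (x (s + r))) r := by
        intro r hr
        have hr0 := hR0.trans hr
        refine ((happ (hshift (hG.hasDerivAt_subordinate (hadd hc hr0))) (hxs hr0)).add
          ((hasDerivAt_id r).smul_const (W 0))).congr_deriv ?_
        rw [← hWc r hr0, hW]
        simp only [one_smul, two_smul]
        abel
      -- On an interval of length `N` the mean value inequality gives `N ‖W 0‖ ≤ N ‖W 0‖ / 2 + 2 D`,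
      -- that is `N ‖W 0‖ ≤ 4 D`; this `N` violates it.
      set N := 4 * (D + 1) / ‖W 0‖
      have hN : 0 ≤ N := by positivity
      have hmv := (convex_Icc R' (R' + N)).norm_image_sub_le_of_norm_hasDerivWithin_le
        (f := fun r : ℝ => subordinate G (c + r) (x (s + r)) + r • W 0)
        (f' := fun r => (2 : ℝ) • subordinate₁ G (c + r) (x (s + r))) (C := ‖W 0‖ / 2)
        (fun r hr => (hder r hr.1).hasDerivWithinAt)
        (fun r hr => by
          rw [norm_smul, Real.norm_two]
          have h1 := (hR r ((le_max_left _ _).trans hr.1)).le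
          refine le_trans ?_ h1
          rw [mul_assoc, mul_comm C]
          gcongr
          exact ((subordinate₁ G (c + r)).le_opNorm _).trans (by
            gcongr; exact hb _ (by linarith [hr.1])))
        (Set.left_mem_Icc.2 (by linarith)) (Set.right_mem_Icc.2 (by linarith))
      rw [show R' + N - R' = N by ring, Real.norm_of_nonneg hN] at hmv
      have h1 := hy R' hR0
      have h2 := hy (R' + N) (by linarith)
      have h3 : N * ‖W 0‖ ≤ ‖W 0‖ / 2 * N + D + D := by
        calc N * ‖W 0‖ = ‖N • W 0‖ := by rw [norm_smul, Real.norm_of_nonneg hN]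
          _ = ‖(subordinate G (c + ↑(R' + N)) (x (s + (R' + N))) + (R' + N) • W 0 -
                (subordinate G (c + R') (x (s + R')) + R' • W 0)) -
                subordinate G (c + ↑(R' + N)) (x (s + (R' + N))) +
                subordinate G (c + R') (x (s + R'))‖ := by congr 1; rw [add_smul]; abel
          _ ≤ _ := (norm_add_le _ _).trans (add_le_add ((norm_sub_le _ _).trans
              (add_le_add hmv h2)) h1)
      have h4 : N * ‖W 0‖ = 4 * (D + 1) := div_mul_cancel₀ _ hpos.ne'
      have h5 : 0 ≤ D := by positivity
      linarith
    have := hw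
    rw [hW] at this
    simpa [sub_eq_zero] using this
  -- By the first step `r ↦ S(c + t - r) x(r)` has derivative zero on `(0, t]`. Comparing `r → 0`
  -- with `r = t` gives the identity. The shift by `c` keeps the argument of `S` inside the open
  -- sector; it is removed at the end.
  have step2 : ∀ {c : ℂ}, c ∈ diagSector → subordinate G (c + t) f = subordinate G c (x t) := by
    intro c hc
    have hmem : ∀ {r : ℝ}, r ≤ t → (c + t) + ((-r : ℝ) : ℂ) ∈ diagSector := by
      intro r hr
      have := hadd hc (sub_nonneg.2 hr)
      convert! this using 1
      push_cast; ring
    have hd : ∀ r, 0 < r → r ≤ t →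
        HasDerivAt (fun r : ℝ => subordinate G ((c + t) + ((-r : ℝ) : ℂ)) (x r)) 0 r := by
      intro r h1 h2
      have h3 := (hshift (hG.hasDerivAt_subordinate (hmem h2))).scomp r (hasDerivAt_neg r)
      refine (happ h3 (hx r h1)).congr_deriv ?_
      simp only [Function.comp]
      rw [← step1 (hmem h2) h1]
      simp
    have hconst : ∀ r, 0 < r → r ≤ t →
        subordinate G ((c + t) + ((-r : ℝ) : ℂ)) (x r) = subordinate G c (x t) := by
      intro r h1 h2
      have := constant_of_has_deriv_right_zero (a := r) (b := t)
        (f := fun r : ℝ => subordinate G ((c + t) + ((-r : ℝ) : ℂ)) (x r))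
        (fun y hy => (hd y (h1.trans_le hy.1) hy.2).continuousAt.continuousWithinAt)
        (fun y hy => (hd y (h1.trans_le hy.1) hy.2.le).hasDerivWithinAt) t ⟨h2, le_rfl⟩
      rw [← this]
      congr 2
      push_cast; ring
    have hl : Tendsto (fun r : ℝ => subordinate G ((c + t) + ((-r : ℝ) : ℂ)) (x r)) (𝓝[>] 0)
        (𝓝 (subordinate G (c + t) f)) := by
      have h1 : Tendsto (fun r : ℝ => subordinate G ((c + t) + ((-r : ℝ) : ℂ))) (𝓝[>] 0)
          (𝓝 (subordinate G (c + t))) := by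
        have h2 : ContinuousAt (subordinate G) ((c + t) + ((-(0 : ℝ) : ℝ) : ℂ)) :=
          (hG.hasDerivAt_subordinate (hmem ht.le)).continuousAt
        have h3 : Continuous fun r : ℝ => (c + t) + ((-r : ℝ) : ℂ) := by fun_prop
        have h4 := h2.tendsto.comp ((h3.tendsto 0).mono_left (nhdsWithin_le_nhds (s := Set.Ioi 0)))
        simpa [Function.comp_def] using h4
      exact (isBoundedBilinearMap_apply.continuous.tendsto (subordinate G (c + t), f)).comp
        (h1.prodMk_nhds h0)
    refine tendsto_nhds_unique hl (tendsto_const_nhds.congr' ?_)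
    filter_upwards [Ioo_mem_nhdsGT ht] with r hr
    exact (hconst r hr.1 hr.2.le).symm
  have hz := tendsto_ofReal_mul_subSector (ofReal_mem_subSector one_pos)
  have hl1 := (hG.tendsto_subordinate_zero 1 (x t)).comp hz
  have hl2 : Tendsto (fun r : ℝ => subordinate G ((t : ℂ) + r) f) (𝓝[>] 0)
      (𝓝 (subordinate G t f)) := by
    have h2 : ContinuousAt (fun z => subordinate G z f) ((t : ℂ) + ((0 : ℝ) : ℂ)) :=
      (hG.hasDerivAt_subordinate_apply (by simpa using ofReal_mem_diagSector ht) f).continuousAt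
    have h3 : Continuous fun r : ℝ => (t : ℂ) + r := by fun_prop
    have h4 := h2.tendsto.comp ((h3.tendsto 0).mono_left (nhdsWithin_le_nhds (s := Set.Ioi 0)))
    simpa [Function.comp_def] using h4
  refine tendsto_nhds_unique hl1 (hl2.congr' ?_)
  filter_upwards [self_mem_nhdsWithin] with r hr
  simp only [Function.comp, Complex.ofReal_one, mul_one]
  rw [← step2 (ofReal_mem_diagSector hr), add_comm]

omit [CompleteSpace E] in
theorem hasDerivAt_ray {F F' : ℂ → E →L[ℂ] E} {c : ℂ} {r : ℝ} {f : E}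
    (h : HasDerivAt F (F' (r + c)) (r + c)) :
    HasDerivAt (fun r : ℝ => F (r + c) f) (F' (r + c) f) r := by
  have h1 := (HasDerivAt.comp_add_const (r : ℂ) c h).clm_apply (hasDerivAt_const (r : ℂ) f)
  simpa using hasDerivAt_comp_ofReal h1

theorem ext_of_gen (hG : IsC0SemigroupBddBy G B) {S T : E →L[ℂ] E}
    (h : ∀ f g, Gen G f g → S f = T f) : S = T := by
  refine ContinuousLinearMap.ext fun f => ?_
  exact congrFun (Continuous.ext_on hG.dense_gen S.continuous T.continuous
    fun f ⟨g, hg⟩ => h f g hg) f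

/-- For `f` in the domain of the generator, `r ↦ subordinate G (r + w) f` is a bounded solution of
`x'' = M x` starting at `subordinate G w f`, so uniqueness applies; density gives all `f`. -/
theorem subordinate_ofReal_add (hG : IsC0SemigroupBddBy G B) {t : ℝ} (ht : 0 < t) {w : ℂ}
    (hw : w ∈ diagSector) : subordinate G (t + w) = subordinate G t * subordinate G w := by
  refine hG.ext_of_gen fun f g hfg => ?_
  have hmem : ∀ {r : ℝ}, 0 < r → (r : ℂ) + w ∈ diagSector := fun hr =>
    add_mem_diagSector (ofReal_mem_diagSector hr) hw
  refine hG.eq_subordinate_of_deriv (x := fun r : ℝ => subordinate G (r + w) f)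
    (x' := fun r : ℝ => subordinate₁ G (r + w) f) (x'' := fun r : ℝ => subordinate₂ G (r + w) f)
    (C := B * √(‖w‖ ^ 2 / (w ^ 2).re) * ‖f‖)
    (fun r hr => hasDerivAt_ray (hG.hasDerivAt_subordinate (hmem hr)))
    (fun r hr => hasDerivAt_ray (hG.hasDerivAt_subordinate₁ (hmem hr)))
    (fun r hr => ?_) (fun r hr => ?_) ?_ ht
  · rw [hG.subordinate₂_apply (hmem hr) hfg]
    exact hG.gen_subordinate (hmem hr) hfg
  · refine ((subordinate G _).le_opNorm _).trans ?_
    gcongr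
    rw [add_comm]
    exact hG.norm_subordinate_le_of_subSector
      (add_ofReal_mem_subSector (mem_subSector_self hw) hr.le)
  · have h2 : ContinuousAt (fun z => subordinate G z f) (((0 : ℝ) : ℂ) + w) :=
      (hG.hasDerivAt_subordinate_apply (by simpa using hw) f).continuousAt
    have h3 : Continuous fun r : ℝ => (r : ℂ) + w := by fun_prop
    have h4 := h2.tendsto.comp ((h3.tendsto 0).mono_left (nhdsWithin_le_nhds (s := Set.Ioi 0)))
    simpa [Function.comp_def] using h4

/-- Both sides are holomorphic in `z` and agree for `z > 0`. -/
theorem subordinate_add (hG : IsC0SemigroupBddBy G B) {z w : ℂ} (hz : z ∈ diagSector)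
    (hw : w ∈ diagSector) : subordinate G (z + w) = subordinate G z * subordinate G w := by
  refine eqOn_diagSector (u := fun z => subordinate G (z + w))
    (v := fun z => subordinate G z * subordinate G w) (fun x hx => ?_) (fun x hx => ?_)
    (fun t ht => hG.subordinate_ofReal_add ht hw) hz
  · exact (HasDerivAt.comp_add_const x w (hG.hasDerivAt_subordinate
      (add_mem_diagSector hx hw))).differentiableAt.differentiableWithinAt
  · exact ((hG.hasDerivAt_subordinate hx).differentiableAt.mul_const
      (subordinate G w)).differentiableWithinAt

theorem isC0Semigroup_subordinate_ray (hG : IsC0SemigroupBddBy G B) {z : ℂ} {κ : ℝ}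
    (hz : z ∈ subSector κ) :
    IsC0SemigroupBddBy (fun s : ℝ => subordinate G ((s : ℂ) * z)) (max 1 (B * √κ)) where
  zero := by simp [subordinate_zero]
  add s t hs ht := by
    rcases hs.eq_or_lt with rfl | hs
    · simp [subordinate_zero]
    rcases ht.eq_or_lt with rfl | ht
    · simp [subordinate_zero]
    rw [← hG.subordinate_add (smul_mem_diagSector hz.1 hs) (smul_mem_diagSector hz.1 ht)]
    push_cast
    rw [add_mul]
  tendsto f := (hG.tendsto_subordinate_zero κ f).comp (tendsto_ofReal_mul_subSector hz)
  norm_le t ht := by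
    rcases ht.eq_or_lt with rfl | ht
    · simp only [Complex.ofReal_zero, zero_mul, subordinate_zero]
      exact ContinuousLinearMap.norm_id_le.trans (le_max_left _ _)
    · exact (hG.norm_subordinate_le_of_subSector (smul_mem_subSector hz ht)).trans
        (le_max_right _ _)

theorem isC0Semigroup_subordinate (hG : IsC0SemigroupBddBy G B) :
    IsC0SemigroupBddBy (fun s : ℝ => subordinate G s) (max 1 B) := by
  simpa using hG.isC0Semigroup_subordinate_ray (ofReal_mem_subSector one_pos)

theorem subordinate_mul_subordinate₁ (hG : IsC0SemigroupBddBy G B) {z w : ℂ} (hz : z ∈ diagSector)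
    (hw : w ∈ diagSector) : subordinate G z * subordinate₁ G w = subordinate₁ G (z + w) := by
  have h1 := (hG.hasDerivAt_subordinate hw).const_mul (subordinate G z)
  have h2 := HasDerivAt.comp_const_add z w (hG.hasDerivAt_subordinate (add_mem_diagSector hz hw))
  refine h1.unique (h2.congr_of_eventuallyEq ?_)
  filter_upwards [isOpen_diagSector.mem_nhds hw] with x hx
  rw [hG.subordinate_add hz hx]

-- This is the right derivative of `h ↦ F (h c + z)` at `0`. With `F` general it serves the
-- subordinated family and all its derivatives.
omit [CompleteSpace E] in
theorem gen_ray_of_hasDerivAt {Q F F' : ℂ → E →L[ℂ] E} {z c : ℂ}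
    (hF : HasDerivAt F (F' z) z) (hQ : ∀ h : ℝ, 0 < h → Q (h * c) * F z = F (h * c + z)) (f : E) :
    Gen (fun s : ℝ => Q (s * c)) (F z f) (-(c • F' z f)) := by
  have h0 : HasDerivAt F (F' z) (((0 : ℝ) : ℂ) * c + z) := by simpa using hF
  have h1 : HasDerivAt (fun s : ℂ => F (s * c + z)) (c • F' z) ((0 : ℝ) : ℂ) := by
    have h2 : HasDerivAt (fun s : ℂ => s * c + z) c ((0 : ℝ) : ℂ) := by
      simpa using ((hasDerivAt_id ((0 : ℝ) : ℂ)).mul_const c).add_const z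
    exact h0.scomp ((0 : ℝ) : ℂ) h2
  have h3 := (hasDerivAt_comp_ofReal (h1.clm_apply
    (hasDerivAt_const ((0 : ℝ) : ℂ) f))).hasDerivWithinAt (s := Set.Ici 0)
  rw [hasDerivWithinAt_iff_tendsto_slope, Set.Ici_sdiff_left] at h3
  simp only [map_zero, add_zero, smul_apply] at h3
  refine h3.neg.congr' ?_
  filter_upwards [self_mem_nhdsWithin] with s hs
  have := congrArg (fun S : E →L[ℂ] E => S f) (hQ s hs)
  simp only [mul_apply_eq_comp] at this
  simp only [slope, vsub_eq_sub, this, Complex.coe_smul, sub_zero, Complex.ofReal_zero, zero_mul,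
    zero_add]
  rw [← smul_neg, neg_sub]

end IsC0SemigroupBddBy

end SquareRoot

/-! ### The subordinated semigroup is generated by the square root -/

section PoissonSemigroup

variable {E : Type*} [NormedAddCommGroup E] [NormedSpace ℂ E] [CompleteSpace E]

namespace IsC0SemigroupBddBy

variable {G : ℝ → E →L[ℂ] E} {B : ℝ}

theorem gen_subordinate_ray (hG : IsC0SemigroupBddBy G B) {z c : ℂ} (hz : z ∈ diagSector)
    (hc : c ∈ diagSector) (f : E) :
    Gen (fun s : ℝ => subordinate G (s * c)) (subordinate G z f) (-(c • subordinate₁ G z f)) :=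
  gen_ray_of_hasDerivAt (hG.hasDerivAt_subordinate hz)
    (fun _ hh => (hG.subordinate_add (smul_mem_diagSector hc hh) hz).symm) f

theorem one_mem_diagSector : (1 : ℂ) ∈ diagSector := by
  simpa using ofReal_mem_diagSector one_pos

theorem gen_subordinate_self (hG : IsC0SemigroupBddBy G B) {z : ℂ} (hz : z ∈ diagSector) (f : E) :
    Gen (fun s : ℝ => subordinate G s) (subordinate G z f) (-(subordinate₁ G z f)) := by
  simpa using hG.gen_subordinate_ray hz one_mem_diagSector f

theorem gen_subordinate₁_self (hG : IsC0SemigroupBddBy G B) {z : ℂ} (hz : z ∈ diagSector)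
    (f : E) :
    Gen (fun s : ℝ => subordinate G s) (subordinate₁ G z f) (-(subordinate₂ G z f)) := by
  have := gen_ray_of_hasDerivAt (Q := subordinate G) (c := 1) (hG.hasDerivAt_subordinate₁ hz)
    (fun h hh => hG.subordinate_mul_subordinate₁ (smul_mem_diagSector one_mem_diagSector hh) hz) f
  simpa using this

/-- Known on the dense domain; it extends because `subordinate G z` and `subordinate₂ G z` are
bounded and the generator is closed. -/
theorem gen_subordinate_of_any (hG : IsC0SemigroupBddBy G B) {z : ℂ} (hz : z ∈ diagSector)
    (f : E) : Gen G (subordinate G z f) (subordinate₂ G z f) := by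
  obtain ⟨u, hu, hlim⟩ := mem_closure_iff_seq_limit.1 (hG.dense_gen f)
  choose v hv using hu
  refine hG.gen_closed (l := atTop) (u := fun n => subordinate G z (u n))
    (v := fun n => subordinate₂ G z (u n)) (Eventually.of_forall fun n => ?_)
    (((subordinate G z).continuous.tendsto f).comp hlim)
    (((subordinate₂ G z).continuous.tendsto f).comp hlim)
  rw [hG.subordinate₂_apply hz (hv n)]
  exact hG.gen_subordinate hz (hv n)

theorem tendsto_one_div_subordinate (hG : IsC0SemigroupBddBy G B) (f : E) :
    Tendsto (fun n : ℕ => subordinate G ((1 / ((n : ℝ) + 1) : ℝ) : ℂ) f) atTop (𝓝 f) := by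
  have h1 : Tendsto (fun n : ℕ => 1 / ((n : ℝ) + 1)) atTop (𝓝[>] 0) :=
    tendsto_nhdsWithin_iff.2 ⟨tendsto_one_div_add_atTop_nhds_zero_nat,
      Eventually.of_forall fun n => Set.mem_Ioi.2 (by positivity)⟩
  exact (hG.isC0Semigroup_subordinate.tendsto f).comp h1

/-- Write `S` for the subordinated semigroup. The candidate for `M^(1/2) f` is the limit of `-S'(t)
f` as `t → 0`. It exists because `S''(t) f = S(t) g` is bounded, so `S'(t) f` is Lipschitz in `t`;
closedness of the generator along `S(1/(n+1)) f` does the rest. -/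
theorem exists_gen_sqrt (hG : IsC0SemigroupBddBy G B) {f g : E} (h : Gen G f g) :
    ∃ w, Gen (fun s : ℝ => subordinate G s) f w ∧ Gen (fun s : ℝ => subordinate G s) w g := by
  have hQ := hG.isC0Semigroup_subordinate
  have hd : ∀ t : ℝ, 0 < t →
      HasDerivAt (fun t : ℝ => subordinate₁ G t f) (subordinate G t g) t := by
    intro t ht
    have ht' := ofReal_mem_diagSector ht
    rw [← hG.subordinate₂_apply ht' h]
    exact hasDerivAt_comp_ofReal (hG.hasDerivAt_subordinate₁_apply ht' f)
  have hB := hG.bound_nonneg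
  have hlip : LipschitzOnWith (B * ‖g‖).toNNReal (fun t : ℝ => subordinate₁ G t f)
      (Set.Ioi 0) := by
    refine LipschitzOnWith.of_dist_le_mul fun x hx y hy => ?_
    rw [dist_eq_norm, dist_eq_norm, Real.coe_toNNReal _ (by positivity)]
    refine (convex_Ioi (0 : ℝ)).norm_image_sub_le_of_norm_hasDerivWithin_le
      (f := fun t : ℝ => subordinate₁ G t f) (f' := fun t : ℝ => subordinate G t g)
      (fun t ht => (hd t ht).hasDerivWithinAt) (fun t ht => ?_) hy hx
    refine ((subordinate G _).le_opNorm g).trans ?_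
    gcongr
    simpa using hG.norm_subordinate_le_of_subSector (ofReal_mem_subSector ht)
  set t : ℕ → ℝ := fun n => 1 / ((n : ℝ) + 1) with ht
  have htpos : ∀ n, 0 < t n := fun n => by simp only [ht]; positivity
  have hcau : CauchySeq fun n => subordinate₁ G (t n) f :=
    hlip.cauchySeq_comp tendsto_one_div_add_atTop_nhds_zero_nat.cauchySeq
      (Set.range_subset_iff.2 htpos)
  obtain ⟨w, hw⟩ := cauchySeq_tendsto_of_complete hcau
  have hmem := fun n => ofReal_mem_diagSector (htpos n)
  refine ⟨-w, hQ.gen_closed (l := atTop)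
    (Eventually.of_forall fun n => hG.gen_subordinate_self (hmem n) f)
    (hG.tendsto_one_div_subordinate f) hw.neg,
    hQ.gen_closed (l := atTop) (u := fun n => -(subordinate₁ G (t n) f))
    (v := fun n => subordinate G (t n) g) (Eventually.of_forall fun n => ?_) hw.neg
    (hG.tendsto_one_div_subordinate g)⟩
  have h1 := (hG.gen_subordinate₁_self (hmem n) f).neg
  rw [neg_neg, hG.subordinate₂_apply (hmem n) h] at h1
  refine h1.congr fun s => ?_
  rw [← smul_neg, map_neg]
  congr 1
  abel

/-- The hypotheses give `S' f = -S w` and `S' w = -S g`, hence `S'' f = S g`. Since `S(t) f` lies in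
the domain of `M` with image `S''(t) f`, closedness as `t → 0` concludes. -/
theorem gen_of_gen_sqrt (hG : IsC0SemigroupBddBy G B) {f w g : E}
    (h1 : Gen (fun s : ℝ => subordinate G s) f w) (h2 : Gen (fun s : ℝ => subordinate G s) w g) :
    Gen G f g := by
  have hQ := hG.isC0Semigroup_subordinate
  have e1 : ∀ {f w : E}, Gen (fun s : ℝ => subordinate G s) f w → ∀ t : ℝ, 0 < t →
      subordinate₁ G t f = -(subordinate G t w) := by
    intro f w h t ht
    have := (hG.gen_subordinate_self (ofReal_mem_diagSector ht) f).unique (hQ.map_gen h ht.le)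
    rw [← this, neg_neg]
  have e2 : ∀ t : ℝ, 0 < t → subordinate₂ G t f = subordinate G t g := by
    intro t ht
    have h3 := hasDerivAt_comp_ofReal
      (hG.hasDerivAt_subordinate₁_apply (ofReal_mem_diagSector ht) f)
    have h4 := (hasDerivAt_comp_ofReal
      (hG.hasDerivAt_subordinate_apply (ofReal_mem_diagSector ht) w)).neg
    rw [e1 h2 t ht, neg_neg] at h4
    refine h3.unique (h4.congr_of_eventuallyEq ?_)
    filter_upwards [Ioi_mem_nhds ht] with s hs using e1 h1 s hs
  refine hG.gen_closed (l := atTop)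
    (Eventually.of_forall fun n : ℕ => hG.gen_subordinate_of_any
      (ofReal_mem_diagSector (by positivity : (0 : ℝ) < 1 / ((n : ℝ) + 1))) f)
    (hG.tendsto_one_div_subordinate f) ?_
  refine (hG.tendsto_one_div_subordinate g).congr fun n => ?_
  rw [e2 _ (by positivity)]

end IsC0SemigroupBddBy

variable {G : ℝ → E →L[ℂ] E} {B : ℝ} {M : E →ₗ.[ℂ] E}

/-- The subordinated semigroup is the Poisson semigroup, generated by the square root. -/
theorem isSemigroupOf_opSqrt (hG : IsC0SemigroupBddBy G B) (hM : IsSemigroupOf G M) :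
    IsSemigroupOf (fun s : ℝ => subordinate G s) (opSqrt M) := by
  have hQ := hG.isC0Semigroup_subordinate
  have hex : ∃ D : E →ₗ.[ℂ] E, IsSquareRoot D M ∧
      ∃ T : ℝ → E →L[ℂ] E, IsSemigroupOf T D ∧ IsBoundedSemigroup T := by
    refine ⟨genPMap fun s : ℝ => subordinate G s, fun f g => ?_, _,
      isSemigroupOf_genPMap hQ.toIsC0Semigroup, _, hQ.norm_le⟩
    simp only [mem_genPMap_graph, hM.mem_graph_iff]
    exact ⟨hG.exists_gen_sqrt, fun ⟨w, h1, h2⟩ => hG.gen_of_gen_sqrt h1 h2⟩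
  rw [opSqrt, dif_pos hex]
  -- Uniqueness of the square root: for `f` in the domain of `M`, the orbit of `f` under the
  -- semigroup of the chosen root is a bounded solution of `x'' = M x`, hence the subordinated
  -- orbit.
  obtain ⟨hsq, T, hT, C, hC⟩ := hex.choose_spec
  refine hT.congr fun t ht => ?_
  rcases ht.eq_or_lt with rfl | ht
  · simp [hT.zero, subordinate_zero]
  refine hG.ext_of_gen fun f g hfg => ?_
  obtain ⟨w, h1, h2⟩ := (hsq f g).1 (hM.mem_graph_iff.2 hfg)
  have hT0 := hT.toIsC0Semigroup
  rw [hT.mem_graph_iff] at h1 h2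
  refine hG.eq_subordinate_of_deriv (x := fun r => T r f) (x' := fun r => -(T r w))
    (x'' := fun r => T r g) (C := C * ‖f‖) (fun r hr => hT0.hasDerivAt_orbit h1 hr)
    (fun r hr => by simpa [Pi.neg_def] using (hT0.hasDerivAt_orbit h2 hr).neg) (fun r hr => ?_)
    (fun r hr => ((T r).le_opNorm f).trans (by gcongr; exact hC r hr.le)) (hT0.tendsto f) ht
  rw [← hM.mem_graph_iff, hsq]
  exact ⟨T r w, hT.mem_graph_iff.2 (hT0.map_gen h1 hr.le),
    hT.mem_graph_iff.2 (hT0.map_gen h2 hr.le)⟩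

theorem poisson_eq_subordinate (hG : IsC0SemigroupBddBy G B) (hM : IsSemigroupOf G M) {t : ℝ}
    (ht : 0 ≤ t) : poisson M t = subordinate G t :=
  opExp_eq (isSemigroupOf_opSqrt hG hM) ht

theorem mem_opSqrt_graph_iff (hG : IsC0SemigroupBddBy G B) (hM : IsSemigroupOf G M) {f g : E} :
    (f, g) ∈ (opSqrt M).graph ↔ Gen (fun s : ℝ => subordinate G s) f g :=
  (isSemigroupOf_opSqrt hG hM).mem_graph_iff

end PoissonSemigroup

/-! ### Complex times -/

section ComplexExtension

theorem mem_smul_graph_iff {E : Type*} [NormedAddCommGroup E] [NormedSpace ℂ E]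
    {A : E →ₗ.[ℂ] E} {z : ℂ} (hz0 : z ≠ 0) {f g : E} :
    (f, g) ∈ (z • A).graph ↔ (f, z⁻¹ • g) ∈ A.graph := by
  simp only [LinearPMap.mem_graph_iff]
  constructor
  · rintro ⟨y, hy1, hy2⟩
    refine ⟨y, hy1, ?_⟩
    rw [← hy2, LinearPMap.smul_apply, smul_smul, inv_mul_cancel₀ hz0, one_smul]
  · rintro ⟨y, hy1, hy2⟩
    refine ⟨y, hy1, ?_⟩
    rw [LinearPMap.smul_apply]
    exact (congrArg (z • ·) hy2).trans (by simp [smul_smul, hz0])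

variable {E : Type*} [NormedAddCommGroup E] [NormedSpace ℂ E] [CompleteSpace E]
  {G : ℝ → E →L[ℂ] E} {B : ℝ} {M : E →ₗ.[ℂ] E}

/-- `Re z² = |z|² cos (2 arg z)`, and the cosine decreases on `[0, π]`. -/
theorem cos_sq_sub_sin_sq_ge {β : ℝ} (hβ : β < Real.pi / 4) {z : ℂ}
    (hz : z ∈ closedSector β) : ‖z‖ ^ 2 * Real.cos (2 * β) ≤ (z ^ 2).re := by
  have h : |z.arg| ≤ β := hz
  have h1 : (z ^ 2).re = ‖z‖ ^ 2 * Real.cos (2 * z.arg) := by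
    conv_lhs => rw [← Complex.norm_mul_exp_arg_mul_I z]
    rw [mul_pow, ← Complex.exp_nat_mul, ← Complex.ofReal_pow, Complex.re_ofReal_mul]
    congr 1
    rw [show ((2 : ℕ) : ℂ) * (z.arg * Complex.I) = ((2 * z.arg : ℝ) : ℂ) * Complex.I by
      push_cast; ring, Complex.exp_ofReal_mul_I_re]
  rw [h1]
  gcongr
  rw [← Real.cos_abs (2 * z.arg), abs_mul, abs_two]
  refine Real.cos_le_cos_of_nonneg_of_le_pi (by positivity) ?_ (by linarith)
  linarith [Real.pi_pos]

theorem cos_two_mul_pos {β : ℝ} (h0 : 0 < β) (hβ : β < Real.pi / 4) : 0 < Real.cos (2 * β) :=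
  Real.cos_pos_of_mem_Ioo ⟨by linarith, by linarith⟩

theorem closedSector_re_nonneg {β : ℝ} (hβ : β < Real.pi / 4) {z : ℂ} (hz : z ∈ closedSector β) :
    0 ≤ z.re := by
  have h : |z.arg| ≤ β := hz
  exact Complex.abs_arg_le_pi_div_two_iff.1 (by linarith [Real.pi_pos])

theorem mem_subSector_of_closedSector {β : ℝ} (h0 : 0 < β) (hβ : β < Real.pi / 4) {z : ℂ}
    (hz : z ∈ closedSector β) (hz0 : z ≠ 0) : z ∈ subSector (Real.cos (2 * β))⁻¹ := by
  have h1 := cos_sq_sub_sin_sq_ge hβ hz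
  have h2 := cos_two_mul_pos h0 hβ
  have h3 : 0 < ‖z‖ := norm_pos_iff.2 hz0
  have h4 : 0 < (z ^ 2).re := lt_of_lt_of_le (by positivity) h1
  refine ⟨mem_diagSector_of (lt_of_le_of_ne (closedSector_re_nonneg hβ hz) fun h => ?_) h4, ?_⟩
  · rw [re_sq, ← h] at h4
    nlinarith [sq_nonneg z.im]
  · rw [inv_mul_eq_div, le_div_iff₀ h2]
    exact h1

theorem openSector_subset {β : ℝ} (h0 : 0 < β) (hβ : β < Real.pi / 4) :
    openSector β ⊆ diagSector := fun _ hz =>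
  (mem_subSector_of_closedSector h0 hβ (le_of_lt hz.2 : _) hz.1).1

/-- On a vector `S(t) f` both generators are explicit: `-S'(t) f` for the positive axis and `-z
S'(t) f` for the ray. Regularising by `S(1/(n+1))` and using closedness transfers either relation to
the other. -/
theorem isSemigroupOf_ray (hG : IsC0SemigroupBddBy G B) (hM : IsSemigroupOf G M) {z : ℂ}
    (hz : z ∈ diagSector) :
    IsSemigroupOf (fun s : ℝ => subordinate G (s * z)) (z • opSqrt M) := by
  have hz0 := ne_zero_of_mem_diagSector hz
  have hR := hG.isC0Semigroup_subordinate_ray (mem_subSector_self hz)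
  have hQ := hG.isC0Semigroup_subordinate
  refine ⟨hR.toIsC0Semigroup, fun f g => ?_⟩
  change _ ↔ Gen (fun s : ℝ => subordinate G (s * z)) f g
  rw [mem_smul_graph_iff hz0, mem_opSqrt_graph_iff hG hM]
  have hpos : ∀ n : ℕ, (0 : ℝ) < 1 / ((n : ℝ) + 1) := fun n => by positivity
  have hmem := fun n => ofReal_mem_diagSector (hpos n)
  constructor
  · intro h
    refine hR.gen_closed (l := atTop) (Eventually.of_forall fun n : ℕ =>
      hG.gen_subordinate_ray (hmem n) hz f) (hG.tendsto_one_div_subordinate f) ?_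
    have h1 := (hG.tendsto_one_div_subordinate (z⁻¹ • g)).const_smul z
    rw [smul_smul, mul_inv_cancel₀ hz0, one_smul] at h1
    refine h1.congr fun n => ?_
    rw [← smul_neg]
    congr 1
    exact (hQ.map_gen h (hpos n).le).unique (hG.gen_subordinate_self (hmem n) f)
  · intro h
    refine hQ.gen_closed (l := atTop) (Eventually.of_forall fun n : ℕ =>
      hG.gen_subordinate_self (hmem n) f) (hG.tendsto_one_div_subordinate f) ?_
    refine (hG.tendsto_one_div_subordinate (z⁻¹ • g)).congr fun n => ?_
    have hcomm : Gen (fun s : ℝ => subordinate G (s * z))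
        (subordinate G ((1 / ((n : ℝ) + 1) : ℝ) : ℂ) f)
        (subordinate G ((1 / ((n : ℝ) + 1) : ℝ) : ℂ) g) := by
      refine (((subordinate G _).continuous.tendsto g).comp h).congr' ?_
      filter_upwards [self_mem_nhdsWithin] with s hs
      have : subordinate G (s * z) (subordinate G ((1 / ((n : ℝ) + 1) : ℝ) : ℂ) f) =
          subordinate G ((1 / ((n : ℝ) + 1) : ℝ) : ℂ) (subordinate G (s * z) f) := by
        simp only [← mul_apply_eq_comp]
        rw [← hG.subordinate_add (smul_mem_diagSector hz hs) (hmem n),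
          ← hG.subordinate_add (hmem n) (smul_mem_diagSector hz hs), add_comm]
      simp only [Function.comp, map_smul, map_sub, this]
    have h1 := hcomm.unique (hG.gen_subordinate_ray (hmem n) hz f)
    rw [map_smul, h1, smul_neg, smul_smul, inv_mul_cancel₀ hz0, one_smul]

theorem isPoissonExtension_subordinate (hG : IsC0SemigroupBddBy G B) (hM : IsSemigroupOf G M)
    {β : ℝ} (h0 : 0 < β) (hβ : β < Real.pi / 4) :
    IsPoissonExtension M β (subordinate G) where
  zero := subordinate_zero G
  add z hz w hw := by
    rcases eq_or_ne z 0 with rfl | hz0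
    · simp [subordinate_zero]
    rcases eq_or_ne w 0 with rfl | hw0
    · simp [subordinate_zero]
    exact hG.subordinate_add (mem_subSector_of_closedSector h0 hβ hz hz0).1
      (mem_subSector_of_closedSector h0 hβ hw hw0).1
  holomorphic := hG.differentiableOn_subordinate.mono (openSector_subset h0 hβ)
  continuous f := by
    intro z hz
    rcases eq_or_ne z 0 with rfl | hz0
    · rw [← continuousWithinAt_sdiff_self]
      have h1 := hG.tendsto_subordinate_zero (Real.cos (2 * β))⁻¹ f
      rw [ContinuousWithinAt, subordinate_zero]
      exact h1.mono_left (nhdsWithin_mono _ fun w hw =>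
        mem_subSector_of_closedSector h0 hβ hw.1 hw.2)
    · exact (hG.hasDerivAt_subordinate_apply
        (mem_subSector_of_closedSector h0 hβ hz hz0).1 f).continuousAt.continuousWithinAt
  extends_poisson t ht := (poisson_eq_subordinate hG hM ht).symm
  generator z hz hz0 := isSemigroupOf_ray hG hM (mem_subSector_of_closedSector h0 hβ hz hz0).1

end ComplexExtension

/-! ### Time derivatives and Cauchy's formula -/

section TimeDerivatives

theorem IsPowApply.unique {E : Type*} [NormedAddCommGroup E] [NormedSpace ℂ E] {A : E →ₗ.[ℂ] E}
    {k : ℕ} {f g g' : E} (h : IsPowApply A k f g) (h' : IsPowApply A k f g') : g = g' := by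
  induction k generalizing f with
  | zero => exact Eq.trans (Eq.symm h) h'
  | succ k ih =>
    obtain ⟨w, h1, h2⟩ := h
    obtain ⟨w', h1', h2'⟩ := h'
    have : w = w' := LinearPMap.mem_graph_snd_inj A h1 h1' rfl
    subst this
    exact ih h2 h2'

variable {E : Type*} [NormedAddCommGroup E] [NormedSpace ℂ E] [CompleteSpace E]
  {G : ℝ → E →L[ℂ] E} {B : ℝ} {M : E →ₗ.[ℂ] E}

namespace IsC0SemigroupBddBy

theorem hasDerivAt_iteratedDeriv_subordinate (hG : IsC0SemigroupBddBy G B) (j : ℕ) {z : ℂ}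
    (hz : z ∈ diagSector) : HasDerivAt (iteratedDeriv j (subordinate G))
      (iteratedDeriv (j + 1) (subordinate G) z) z := by
  rw [iteratedDeriv_succ, iteratedDeriv_eq_iterate]
  exact ((hG.differentiableOn_subordinate.analyticOnNhd isOpen_diagSector).iterated_deriv j z
    hz).differentiableAt.hasDerivAt

theorem subordinate_mul_iteratedDeriv (hG : IsC0SemigroupBddBy G B) (j : ℕ) {z w : ℂ}
    (hz : z ∈ diagSector) (hw : w ∈ diagSector) :
    subordinate G z * iteratedDeriv j (subordinate G) w =
      iteratedDeriv j (subordinate G) (z + w) := by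
  induction j generalizing w with
  | zero => simpa using (hG.subordinate_add hz hw).symm
  | succ j ih =>
    have h1 := (hG.hasDerivAt_iteratedDeriv_subordinate j hw).const_mul (subordinate G z)
    have h2 := HasDerivAt.comp_const_add z w
      (hG.hasDerivAt_iteratedDeriv_subordinate j (add_mem_diagSector hz hw))
    refine h1.unique (h2.congr_of_eventuallyEq ?_)
    filter_upwards [isOpen_diagSector.mem_nhds hw] with x hx using ih hx

theorem gen_iteratedDeriv (hG : IsC0SemigroupBddBy G B) (j : ℕ) {z : ℂ} (hz : z ∈ diagSector)
    (f : E) : Gen (fun s : ℝ => subordinate G s) (iteratedDeriv j (subordinate G) z f)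
      (-(iteratedDeriv (j + 1) (subordinate G) z f)) := by
  have := gen_ray_of_hasDerivAt (Q := subordinate G) (c := 1)
    (F' := iteratedDeriv (j + 1) (subordinate G)) (hG.hasDerivAt_iteratedDeriv_subordinate j hz)
    (fun h hh => hG.subordinate_mul_iteratedDeriv j
      (smul_mem_diagSector one_mem_diagSector hh) hz) f
  simpa using this

end IsC0SemigroupBddBy

/-- On the orbit, `t M^(1/2)` acts as `-t d/dt`. The index `j` is free because `IsPowApply` peels
off the innermost factor, which changes the starting vector. -/
theorem isPowApply_iteratedDeriv (hG : IsC0SemigroupBddBy G B) (hM : IsSemigroupOf G M) {t : ℝ}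
    (ht : 0 < t) (k j : ℕ) (f : E) :
    IsPowApply ((t : ℂ) • opSqrt M) k ((-(t : ℂ)) ^ j • iteratedDeriv j (subordinate G) t f)
      ((-(t : ℂ)) ^ (j + k) • iteratedDeriv (j + k) (subordinate G) t f) := by
  have ht0 : (t : ℂ) ≠ 0 := by exact_mod_cast ht.ne'
  induction k generalizing j with
  | zero => exact rfl
  | succ k ih =>
    refine ⟨(-(t : ℂ)) ^ (j + 1) • iteratedDeriv (j + 1) (subordinate G) t f, ?_, ?_⟩
    · rw [mem_smul_graph_iff ht0]
      have h1 := (mem_opSqrt_graph_iff hG hM).2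
        (hG.gen_iteratedDeriv j (ofReal_mem_diagSector ht) f)
      have h2 := (opSqrt M).graph.smul_mem ((-(t : ℂ)) ^ j) h1
      convert! h2 using 1
      ext
      · rfl
      · simp only [Prod.smul_snd, smul_smul, smul_neg, pow_succ]
        rw [← neg_smul]
        congr 1
        field_simp
    · have := ih (j + 1)
      rwa [show j + 1 + k = j + (k + 1) by omega] at this

/-- Powers of an operator are single-valued, so the operator picked by the definition can only be
`(-t)^k` times the `k`-th derivative. -/
theorem poissonDeriv_spec (hG : IsC0SemigroupBddBy G B) (hM : IsSemigroupOf G M) {t : ℝ}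
    (ht : 0 < t) (k : ℕ) : IsPoissonDeriv M t k (poissonDeriv M t k) ∧
      poissonDeriv M t k = (-(t : ℂ)) ^ k • iteratedDeriv k (subordinate G) t := by
  have hS : IsPoissonDeriv M t k ((-(t : ℂ)) ^ k • iteratedDeriv k (subordinate G) t) := by
    intro f
    have := isPowApply_iteratedDeriv hG hM ht k 0 f
    simpa [poisson_eq_subordinate hG hM ht.le] using this
  have hex : ∃ S : E →L[ℂ] E, IsPoissonDeriv M t k S := ⟨_, hS⟩
  have hch : IsPoissonDeriv M t k (poissonDeriv M t k) := by
    rw [poissonDeriv, dif_pos hex]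
    exact hex.choose_spec
  exact ⟨hch, ContinuousLinearMap.ext fun f => (hch f).unique (hS f)⟩

/-- The coefficient in Cauchy's formula for the time derivatives. -/
def cauchyCoeff (k : ℕ) (t R φ : ℝ) : ℂ :=
  (-(t : ℂ)) ^ k * ((k.factorial : ℂ) * ((2 * Real.pi)⁻¹ : ℝ) * ((circleMap 0 R φ) ^ k)⁻¹)

theorem norm_cauchyCoeff (k : ℕ) {t R : ℝ} (ht : 0 ≤ t) (hR : 0 ≤ R) (φ : ℝ) :
    ‖cauchyCoeff k t R φ‖ = (2 * Real.pi)⁻¹ * (k.factorial * (t / R) ^ k) := by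
  rw [cauchyCoeff, norm_mul, norm_mul, norm_mul, norm_pow, norm_neg, norm_inv, norm_pow,
    norm_circleMap_zero, Complex.norm_real, Complex.norm_real, Complex.norm_natCast,
    Real.norm_of_nonneg ht, Real.norm_of_nonneg (by positivity : 0 ≤ (2 * Real.pi)⁻¹),
    abs_of_nonneg hR, div_pow]
  ring

theorem continuous_cauchyCoeff (k : ℕ) (t : ℝ) {R : ℝ} (hR : 0 < R) :
    Continuous (cauchyCoeff k t R) := by
  have h : ∀ φ, (circleMap 0 R φ) ^ k ≠ 0 := fun φ => pow_ne_zero _ (circleMap_ne_center hR.ne')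
  unfold cauchyCoeff
  have : Continuous fun φ => ((circleMap 0 R φ) ^ k)⁻¹ :=
    ((continuous_circleMap 0 R).pow k).inv₀ h
  fun_prop

theorem closedBall_subset_diagSector {t R : ℝ} (hR : 2 * R < t) :
    Metric.closedBall (t : ℂ) R ⊆ diagSector := by
  intro z hz
  rw [Metric.mem_closedBall, dist_eq_norm] at hz
  have h1 := (Complex.abs_re_le_norm _).trans hz
  have h2 := (Complex.abs_im_le_norm _).trans hz
  simp only [Complex.sub_re, Complex.sub_im, Complex.ofReal_re, Complex.ofReal_im, sub_zero] at h1 h2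
  have h3 := (abs_le.1 h1).1
  change |z.im| < z.re
  linarith

theorem continuous_subordinate_circleMap (hG : IsC0SemigroupBddBy G B) {t R : ℝ} (hR0 : 0 ≤ R)
    (hR : 2 * R < t) : Continuous fun φ => subordinate G (circleMap t R φ) :=
  hG.differentiableOn_subordinate.continuousOn.comp_continuous (continuous_circleMap _ R)
    fun φ => closedBall_subset_diagSector hR (circleMap_mem_closedBall _ hR0 φ)

/-- Cauchy's formula on the circle of radius `R`, parametrised by the angle. One factor of `(z -
t)^(k+1)` cancels against the derivative of the parametrisation, so `cauchyCoeff` contains the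
`k`-th power. -/
theorem poissonDeriv_eq_integral (hG : IsC0SemigroupBddBy G B) (hM : IsSemigroupOf G M) {t R : ℝ}
    (hR0 : 0 < R) (hR : 2 * R < t) (k : ℕ) (f : E) :
    poissonDeriv M t k f =
      ∫ φ in (0 : ℝ)..2 * Real.pi, cauchyCoeff k t R φ • subordinate G (circleMap t R φ) f := by
  have ht : 0 < t := by linarith
  have hd : DiffContOnCl ℂ (subordinate G) (Metric.ball (t : ℂ) R) :=
    (hG.differentiableOn_subordinate.mono
      (closedBall_subset_diagSector hR)).diffContOnCl_ball le_rfl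
  have h1 := hd.circleIntegral_one_div_sub_center_pow_smul hR0 k
  have hne : (2 * Real.pi * Complex.I / k.factorial : ℂ) ≠ 0 := by
    simp [Nat.factorial_ne_zero]
  have h2 : iteratedDeriv k (subordinate G) t = (2 * Real.pi * Complex.I / k.factorial : ℂ)⁻¹ •
      ∮ z in C(t, R), (1 / (z - t) ^ (k + 1)) • subordinate G z := by
    rw [h1, inv_smul_smul₀ hne]
  have h3 : poissonDeriv M t k =
      ∫ φ in (0 : ℝ)..2 * Real.pi, cauchyCoeff k t R φ • subordinate G (circleMap t R φ) := by
    rw [(poissonDeriv_spec hG hM ht k).2, h2, circleIntegral, smul_smul,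
      ← intervalIntegral.integral_smul]
    refine intervalIntegral.integral_congr fun φ _ => ?_
    have hc : circleMap 0 R φ ≠ 0 := circleMap_ne_center hR0.ne'
    have hpi : (Real.pi : ℂ) ≠ 0 := by exact_mod_cast Real.pi_ne_zero
    simp only [smul_smul, deriv_circleMap, cauchyCoeff, circleMap_sub_center]
    congr 1
    rw [pow_succ]
    push_cast
    field_simp
  rw [h3]
  have hcont : Continuous fun φ => cauchyCoeff k t R φ • subordinate G (circleMap t R φ) :=
    (continuous_cauchyCoeff k t hR0).smul (continuous_subordinate_circleMap hG hR0.le hR)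
  exact ContinuousLinearMap.intervalIntegral_apply (hcont.intervalIntegrable _ _) f

end TimeDerivatives

/-! ### The contraction semigroup of a positive self-adjoint operator -/

section HeatSemigroup

/-- Applied with `R` the resolvent, so that convergence need be checked only after composition with
`R`, where the functional calculus gives norm rates. -/
theorem tendsto_zero_of_dense_range {E : Type*} [NormedAddCommGroup E] [NormedSpace ℂ E]
    {A : ℝ → E →L[ℂ] E} {R : E →L[ℂ] E} {l : Filter ℝ} {C : ℝ}
    (hR : DenseRange R) (hC : ∀ᶠ t in l, ‖A t‖ ≤ C)
    (hA : ∀ v, Tendsto (fun t => A t (R v)) l (𝓝 0)) (u : E) :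
    Tendsto (fun t => A t u) l (𝓝 0) := by
  rw [Metric.tendsto_nhds]
  intro ε hε
  obtain ⟨v, hv⟩ := hR.exists_dist_lt u (show 0 < ε / (2 * (|C| + 1)) by positivity)
  filter_upwards [hC, (Metric.tendsto_nhds.1 (hA v)) (ε / 2) (by positivity)] with t h1 h2
  rw [dist_zero_right] at h2 ⊢
  have h3 : ‖A t (u - R v)‖ ≤ ε / 2 := by
    refine ((A t).le_opNorm _).trans ?_
    rw [dist_eq_norm] at hv
    calc ‖A t‖ * ‖u - R v‖ ≤ (|C| + 1) * (ε / (2 * (|C| + 1))) := by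
          gcongr
          exact h1.trans ((le_abs_self C).trans (by linarith))
      _ = ε / 2 := by field_simp
  calc ‖A t u‖ = ‖A t (u - R v) + A t (R v)‖ := by rw [map_sub, sub_add_cancel]
    _ ≤ _ := norm_add_le _ _
    _ < ε := by linarith

variable {E : Type*} [NormedAddCommGroup E] [InnerProductSpace ℂ E] [CompleteSpace E]

theorem IsPositiveSelfAdjoint.inner_graph_nonneg {L : E →ₗ.[ℂ] E} (hL : IsPositiveSelfAdjoint L)
    {f g : E} (h : (f, g) ∈ L.graph) : 0 ≤ (inner ℂ f g).re := by
  obtain ⟨y, rfl, rfl⟩ := (LinearPMap.mem_graph_iff L).1 h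
  exact hL.2 y

theorem IsPositiveSelfAdjoint.inner_graph_symm {L : E →ₗ.[ℂ] E} (hL : IsPositiveSelfAdjoint L)
    {f g f' g' : E} (h : (f, g) ∈ L.graph) (h' : (f', g') ∈ L.graph) :
    inner ℂ g f' = inner ℂ f g' := by
  obtain ⟨y, rfl, rfl⟩ := (LinearPMap.mem_graph_iff L).1 h
  obtain ⟨y', rfl, rfl⟩ := (LinearPMap.mem_graph_iff L).1 h'
  have := LinearPMap.adjoint_isFormalAdjoint hL.1.dense_domain
  rw [LinearPMap.isSelfAdjoint_def.1 hL.1] at this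
  exact this y y'

theorem IsPositiveSelfAdjoint.norm_sq_le {L : E →ₗ.[ℂ] E} (hL : IsPositiveSelfAdjoint L)
    {f g : E} (h : (f, g) ∈ L.graph) : ‖f‖ ^ 2 + ‖g‖ ^ 2 ≤ ‖f + g‖ ^ 2 := by
  have h1 := norm_add_sq (𝕜 := ℂ) f g
  have h2 := hL.inner_graph_nonneg h
  have h3 : RCLike.re (inner ℂ f g) = (inner ℂ f g).re := rfl
  rw [h1, h3]
  linarith

/-- The resolvent of a positive self-adjoint operator at `-1`. -/
theorem IsPositiveSelfAdjoint.exists_resolvent {L : E →ₗ.[ℂ] E} (hL : IsPositiveSelfAdjoint L) :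
    ∃ R : E →L[ℂ] E, (∀ u, (R u, u - R u) ∈ L.graph) ∧ ∀ f g, (f, g) ∈ L.graph → R (f + g) = f := by
  have hclosed : IsClosed (L.graph : Set (E × E)) := hL.1.isClosed
  have : CompleteSpace L.graph := hclosed.completeSpace_coe
  -- This is `1 + L`, as a bounded operator on the graph. Positivity bounds it below, and the graph
  -- is complete, so its range is closed.
  set S : L.graph →L[ℂ] E :=
    (ContinuousLinearMap.fst ℂ E E + ContinuousLinearMap.snd ℂ E E).comp L.graph.subtypeL with hS
  have hSa : ∀ p : L.graph, S p = (p : E × E).1 + (p : E × E).2 := fun p => rfl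
  have hbound : ∀ p : L.graph, ‖p‖ ≤ ‖S p‖ := by
    intro p
    have h1 := hL.norm_sq_le (f := (p : E × E).1) (g := (p : E × E).2) p.2
    rw [hSa]
    change max ‖(p : E × E).1‖ ‖(p : E × E).2‖ ≤ _
    refine max_le ?_ ?_
    · exact le_of_sq_le_sq (by nlinarith [sq_nonneg ‖(p : E × E).2‖]) (norm_nonneg _)
    · exact le_of_sq_le_sq (by nlinarith [sq_nonneg ‖(p : E × E).1‖]) (norm_nonneg _)
  have hanti : AntilipschitzWith 1 S :=
    AddMonoidHomClass.antilipschitz_of_bound S fun p => by simpa using hbound p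
  have hrange : IsClosed (S.range : Set E) := by
    have h1 := hanti.isClosed_range S.uniformContinuous
    have h2 : (S.range : Set E) = Set.range S := LinearMap.coe_range _
    rw [h2]
    exact h1
  -- A vector `y` orthogonal to the range satisfies `L* y = -y`. As `L* = L`, positivity gives
  -- `-‖y‖² ≥ 0`.
  have hperp : S.rangeᗮ = ⊥ := by
    rw [Submodule.eq_bot_iff]
    intro y hy
    have h1 : ∀ f g, (f, g) ∈ L.graph → inner ℂ (-y) f = inner ℂ y g := by
      intro f g hfg
      have := Submodule.inner_left_of_mem_orthogonal (K := S.range) (u := f + g) (v := y)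
        ⟨⟨(f, g), hfg⟩, rfl⟩ hy
      rw [inner_add_right] at this
      rw [inner_neg_left]
      linear_combination -this
    have h2 : ∀ x : L.domain, inner ℂ (-y) (x : E) = inner ℂ y (L x) := fun x =>
      h1 _ _ (LinearPMap.mem_graph L x)
    have hy1 : y ∈ L.adjoint.domain := LinearPMap.mem_adjoint_domain_of_exists y ⟨-y, h2⟩
    have hy2 : (y, -y) ∈ L.adjoint.graph := by
      rw [LinearPMap.mem_graph_iff]
      exact ⟨⟨y, hy1⟩, rfl, LinearPMap.adjoint_apply_eq hL.1.dense_domain ⟨y, hy1⟩ h2⟩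
    rw [LinearPMap.isSelfAdjoint_def.1 hL.1] at hy2
    have h3 := hL.inner_graph_nonneg hy2
    rw [inner_neg_right, Complex.neg_re] at h3
    have h4 : (inner ℂ y y).re = ‖y‖ ^ 2 := by
      rw [← inner_self_eq_norm_sq (𝕜 := ℂ)]; rfl
    rw [h4] at h3
    have : ‖y‖ = 0 := by nlinarith [norm_nonneg y]
    exact norm_eq_zero.1 this
  have htop : S.range = ⊤ := by
    have : CompleteSpace S.range := hrange.completeSpace_coe
    exact (Submodule.orthogonal_eq_bot_iff).1 hperp
  have hker : S.ker = ⊥ := LinearMap.ker_eq_bot.2 hanti.injective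
  set Φ := ContinuousLinearEquiv.ofBijective S hker htop
  have hΦ : ∀ p, Φ p = S p := fun p => rfl
  refine ⟨(ContinuousLinearMap.fst ℂ E E).comp (L.graph.subtypeL.comp
    (Φ.symm : E →L[ℂ] L.graph)), fun u => ?_, fun f g hfg => ?_⟩
  · change ((Φ.symm u : E × E).1, u - (Φ.symm u : E × E).1) ∈ L.graph
    have h1 : (Φ.symm u : E × E).1 + (Φ.symm u : E × E).2 = u := by
      rw [← hSa, ← hΦ, Φ.apply_symm_apply]
    have h2 : u - (Φ.symm u : E × E).1 = (Φ.symm u : E × E).2 := by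
      rw [sub_eq_iff_eq_add, add_comm, h1]
    rw [h2]
    exact (Φ.symm u).2
  · change (Φ.symm (f + g) : E × E).1 = f
    have h1 : f + g = Φ ⟨(f, g), hfg⟩ := rfl
    rw [h1, Φ.symm_apply_apply]

/-- The function `exp (-t λ)` of `λ`, in the variable `x = (1 + λ)⁻¹`. -/
def heatFun (t x : ℝ) : ℝ := if 0 < x then Real.exp (-(t * (x⁻¹ - 1))) else 0

theorem heatFun_nonneg (t x : ℝ) : 0 ≤ heatFun t x := by
  unfold heatFun; split_ifs <;> positivity

theorem heatFun_le_one {t x : ℝ} (ht : 0 ≤ t) (hx : x ≤ 1) : heatFun t x ≤ 1 := by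
  unfold heatFun
  split_ifs with h
  · rw [Real.exp_le_one_iff]
    have : 1 ≤ x⁻¹ := (one_le_inv₀ h).2 hx
    have := mul_nonneg ht (sub_nonneg.2 this)
    linarith
  · exact zero_le_one

theorem heatFun_mul (s t x : ℝ) : heatFun s x * heatFun t x = heatFun (s + t) x := by
  unfold heatFun
  split_ifs with h
  · rw [← Real.exp_add]; congr 1; ring
  · simp

theorem continuous_heatFun {t : ℝ} (ht : 0 < t) : Continuous (heatFun t) := by
  rw [continuous_iff_continuousAt]
  intro x
  rcases lt_trichotomy x 0 with h | rfl | h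
  · refine (continuousAt_const (y := (0 : ℝ))).congr ?_
    filter_upwards [Iio_mem_nhds h] with y hy
    exact (if_neg (not_lt.2 (le_of_lt hy))).symm
  · have h0 : heatFun t 0 = 0 := if_neg (lt_irrefl _)
    rw [ContinuousAt, h0]
    have hlim : Tendsto (fun x : ℝ => Real.exp t / t * |x|) (𝓝 0) (𝓝 0) := by
      have : Continuous fun x : ℝ => Real.exp t / t * |x| := by fun_prop
      simpa using this.tendsto 0
    refine squeeze_zero (heatFun_nonneg t) (fun x => ?_) hlim
    unfold heatFun
    split_ifs with hx
    · rw [abs_of_pos hx]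
      have h1 : t / x ≤ Real.exp (t / x) := (le_add_of_nonneg_right zero_le_one).trans
        (Real.add_one_le_exp _)
      have h2 : -(t * (x⁻¹ - 1)) = t - t / x := by ring
      rw [h2, Real.exp_sub, div_mul_eq_mul_div, div_le_div_iff₀ (Real.exp_pos _) ht, mul_assoc]
      gcongr
      rwa [div_le_iff₀' hx] at h1
    · positivity
  · have : ContinuousAt (fun x : ℝ => Real.exp (-(t * (x⁻¹ - 1)))) x := by
      have := h.ne'
      fun_prop (disch := assumption)
    refine this.congr ?_
    filter_upwards [Ioi_mem_nhds h] with y hy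
    exact (if_pos hy).symm

/-- With `x = (1 + λ)⁻¹` and `y = tλ`, all three follow from `1 - y ≤ exp(-y) ≤ 1` and `exp(-y) ≤ 1
- y + y²`. The first is a uniform bound for the difference quotient; the other two are rates of
order `t`, gained from an extra factor `x`. -/
theorem abs_heat_quotient_le {t x : ℝ} (ht : 0 < t) (hx0 : 0 ≤ x) (hx1 : x ≤ 1) :
    |t⁻¹ * (x - heatFun t x * x) - (1 - x)| ≤ 1 ∧
    |(t⁻¹ * (x - heatFun t x * x) - (1 - x)) * x| ≤ t ∧ |heatFun t x * x - x| ≤ t := by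
  rcases hx0.eq_or_lt with rfl | hx
  · simp [ht.le]
  set y := t * (x⁻¹ - 1) with hy
  have hle : 1 ≤ x⁻¹ := (one_le_inv₀ hx).2 hx1
  have hy0 : 0 ≤ y := mul_nonneg ht.le (sub_nonneg.2 hle)
  have he : heatFun t x = Real.exp (-y) := if_pos hx
  have hyx : y * x = t * (1 - x) := by rw [hy]; field_simp
  rw [he]
  set e := Real.exp (-y)
  have h1 : 1 - y ≤ e := by linarith [Real.add_one_le_exp (-y)]
  have h2 : e ≤ 1 := by rw [Real.exp_le_one_iff]; linarith
  have h3 : e ≤ 1 - y + y ^ 2 := by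
    rcases le_total y 1 with hy1 | hy1
    · have := Real.abs_exp_sub_one_sub_id_le (x := -y) (by rw [abs_neg, abs_of_nonneg hy0]; exact hy1)
      have := (abs_le.1 this).2
      simp only [e]
      nlinarith
    · nlinarith
  have ha : t⁻¹ * (x - e * x) ≤ 1 - x := by
    rw [inv_mul_le_iff₀ ht, ← hyx]; nlinarith
  have hb : 0 ≤ t⁻¹ * (x - e * x) := by
    have : 0 ≤ x - e * x := by nlinarith
    positivity
  refine ⟨abs_le.2 ⟨by linarith, by linarith⟩, abs_le.2 ⟨?_, ?_⟩, abs_le.2 ⟨?_, ?_⟩⟩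
  · have h4 : (t⁻¹ * (x - e * x) - (1 - x)) * x = t⁻¹ * ((1 - e - y) * x ^ 2) := by
      have : 1 - x = t⁻¹ * (y * x) := by rw [hyx]; field_simp
      rw [this]; ring
    have h5 : -(t * (1 - x)) ^ 2 ≤ (1 - e - y) * x ^ 2 := by
      rw [← hyx]; nlinarith [sq_nonneg x]
    rw [h4]
    have h6 : -t ^ 2 ≤ (1 - e - y) * x ^ 2 := by
      refine le_trans ?_ h5
      rw [mul_pow]
      have : (1 - x) ^ 2 ≤ 1 := by nlinarith
      nlinarith [sq_nonneg t]
    calc -t = t⁻¹ * (-t ^ 2) := by field_simp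
      _ ≤ _ := by gcongr
  · have : (t⁻¹ * (x - e * x) - (1 - x)) * x ≤ 0 :=
      mul_nonpos_of_nonpos_of_nonneg (by linarith) hx.le
    linarith
  · nlinarith
  · have : e * x - x ≤ 0 := by nlinarith
    linarith

/-- A positive self-adjoint operator generates a contraction semigroup. -/
theorem IsPositiveSelfAdjoint.exists_semigroup {L : E →ₗ.[ℂ] E} (hL : IsPositiveSelfAdjoint L) :
    ∃ T : ℝ → E →L[ℂ] E, IsSemigroupOf T L ∧ IsC0SemigroupBddBy T 1 := by
  obtain ⟨R, hR1, hR2⟩ := hL.exists_resolvent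
  have hdense : DenseRange R := hL.1.dense_domain.mono fun f hf =>
    ⟨f + L ⟨f, hf⟩, hR2 _ _ (LinearPMap.mem_graph L ⟨f, hf⟩)⟩
  have hRpos : R.IsPositive := by
    rw [ContinuousLinearMap.isPositive_def']
    refine ⟨?_, fun u => ?_⟩
    · rw [ContinuousLinearMap.isSelfAdjoint_iff_isSymmetric]
      intro u v
      have := hL.inner_graph_symm (hR1 u) (hR1 v)
      rw [inner_sub_left, inner_sub_right] at this
      change inner ℂ (R u) v = inner ℂ u (R v)
      linear_combination -this
    · have h1 := hL.inner_graph_nonneg (hR1 u)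
      rw [ContinuousLinearMap.reApplyInnerSelf_apply]
      have h2 : inner ℂ (R u) u = inner ℂ (R u) (R u) + inner ℂ (R u) (u - R u) := by
        rw [← inner_add_right]; congr 1; abel
      rw [h2, map_add]
      exact add_nonneg inner_self_nonneg h1
  have hR0 : 0 ≤ R := (ContinuousLinearMap.nonneg_iff_isPositive R).2 hRpos
  have hsa : IsSelfAdjoint R := hRpos.isSelfAdjoint
  have hnorm : ‖R‖ ≤ 1 := ContinuousLinearMap.opNorm_le_bound _ zero_le_one fun u => by
    have := hL.norm_sq_le (hR1 u)
    rw [add_sub_cancel] at this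
    rw [one_mul]
    exact le_of_sq_le_sq (by nlinarith [sq_nonneg ‖u - R u‖]) (norm_nonneg _)
  have hspec : ∀ x ∈ spectrum ℝ R, 0 ≤ x ∧ x ≤ 1 := by
    intro x hx
    refine ⟨spectrum_nonneg_of_nonneg hR0 hx, ?_⟩
    rcases subsingleton_or_nontrivial E with h | h
    · have : Subsingleton (E →L[ℂ] E) := inferInstance
      simp [spectrum.of_subsingleton] at hx
    · exact (le_abs_self x).trans ((spectrum.norm_le_norm_of_mem hx).trans hnorm)
  have hcont := fun {t : ℝ} (ht : 0 < t) => (continuous_heatFun ht).continuousOn (s := spectrum ℝ R)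
  -- Time zero is treated apart: `heatFun 0` jumps at `0`, which may belong to the spectrum of `R`.
  set T : ℝ → E →L[ℂ] E := fun t => if 0 < t then cfc (heatFun t) R else 1 with hT
  have hTpos : ∀ {t : ℝ}, 0 < t → T t = cfc (heatFun t) R := fun ht => if_pos ht
  have hT0 : T 0 = 1 := if_neg (lt_irrefl _)
  have hTnorm : ∀ t, 0 ≤ t → ‖T t‖ ≤ 1 := by
    intro t ht
    rcases ht.eq_or_lt with rfl | ht
    · rw [hT0]; exact ContinuousLinearMap.norm_id_le
    · rw [hTpos ht]
      refine norm_cfc_le zero_le_one fun x hx => ?_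
      rw [Real.norm_of_nonneg (heatFun_nonneg t x)]
      exact heatFun_le_one ht.le (hspec x hx).2
  have hTR : ∀ {t : ℝ}, 0 < t → T t * R = cfc (fun x => heatFun t x * x) R := by
    intro t ht
    rw [hTpos ht]
    rw [cfc_mul (heatFun t) (fun x => x) R (hcont ht), cfc_id' ℝ R]
  have hcomm : ∀ {t : ℝ}, 0 < t → T t * R = R * T t := by
    intro t ht
    have := (cfc_commute_cfc (heatFun t) (fun x => x) R).eq
    rwa [cfc_id' ℝ R, ← hTpos ht] at this
  have hq : ∀ {t : ℝ}, 0 < t → t⁻¹ • (R - T t * R) - (1 - R) =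
      cfc (fun x => t⁻¹ * (x - heatFun t x * x) - (1 - x)) R := by
    intro t ht
    have hc := hcont ht
    have hc' : ContinuousOn (fun x => heatFun t x * x) (spectrum ℝ R) := hc.mul continuousOn_id
    rw [cfc_sub (fun x => t⁻¹ * (x - heatFun t x * x)) (fun x => 1 - x) R
        (continuousOn_const.mul (continuousOn_id.sub hc')) (by fun_prop),
      cfc_const_mul t⁻¹ (fun x => x - heatFun t x * x) R (continuousOn_id.sub hc'),
      cfc_sub (fun x => x) (fun x => heatFun t x * x) R continuousOn_id hc',
      cfc_sub (fun _ => (1 : ℝ)) (fun x => x) R (by fun_prop) (by fun_prop), cfc_id' ℝ R,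
      cfc_const_one ℝ R, ← hTR ht]
  have hsmall : ∀ v : E, Tendsto (fun t : ℝ => t * ‖v‖) (𝓝[>] 0) (𝓝 0) := by
    intro v
    have : Continuous fun t : ℝ => t * ‖v‖ := by fun_prop
    simpa using (this.tendsto 0).mono_left (nhdsWithin_le_nhds (s := Set.Ioi 0))
  have hlim : ∀ u, Tendsto (fun t : ℝ => T t u) (𝓝[>] 0) (𝓝 u) := by
    intro u
    rw [← tendsto_sub_nhds_zero_iff]
    refine tendsto_zero_of_dense_range (A := fun t => T t - 1) (C := 2) hdense ?_ ?_ u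
    · filter_upwards [self_mem_nhdsWithin] with t ht
      refine (norm_sub_le _ _).trans ?_
      have h1 : ‖(1 : E →L[ℂ] E)‖ ≤ 1 := ContinuousLinearMap.norm_id_le
      linarith [hTnorm t (le_of_lt ht)]
    · intro v
      refine squeeze_zero_norm' ?_ (hsmall v)
      filter_upwards [self_mem_nhdsWithin] with t ht
      have h1 : (T t - 1) (R v) = (T t * R - R) v := rfl
      rw [h1]
      refine ((T t * R - R).le_opNorm v).trans ?_
      gcongr
      have hc' : ContinuousOn (fun x => heatFun t x * x) (spectrum ℝ R) :=
        (hcont ht).mul continuousOn_id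
      have h2 : T t * R - R = cfc (fun x => heatFun t x * x - x) R := by
        rw [cfc_sub (fun x => heatFun t x * x) (fun x => x) R hc' continuousOn_id,
          cfc_id' ℝ R, ← hTR ht]
      rw [h2]
      exact norm_cfc_le (le_of_lt ht) fun x hx =>
        (abs_heat_quotient_le ht (hspec x hx).1 (hspec x hx).2).2.2
  have hgen : ∀ u, Gen T (R u) (u - R u) := by
    intro u
    have := tendsto_zero_of_dense_range (A := fun t => t⁻¹ • (R - T t * R) - (1 - R)) (C := 1)
      (l := 𝓝[>] 0) hdense ?_ ?_ u
    · rw [Gen, ← tendsto_sub_nhds_zero_iff]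
      refine this.congr fun t => ?_
      rw [Complex.coe_smul]
      rfl
    · filter_upwards [self_mem_nhdsWithin] with t ht
      rw [hq ht]
      exact norm_cfc_le zero_le_one fun x hx =>
        (abs_heat_quotient_le ht (hspec x hx).1 (hspec x hx).2).1
    · intro v
      refine squeeze_zero_norm' ?_ (hsmall v)
      filter_upwards [self_mem_nhdsWithin] with t ht
      have hc' : ContinuousOn (fun x => heatFun t x * x) (spectrum ℝ R) :=
        (hcont ht).mul continuousOn_id
      have hc'' : ContinuousOn (fun x => t⁻¹ * (x - heatFun t x * x) - (1 - x))
          (spectrum ℝ R) :=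
        (continuousOn_const.mul (continuousOn_id.sub hc')).sub (by fun_prop)
      have h2 : (t⁻¹ • (R - T t * R) - (1 - R)) * R =
          cfc (fun x => (t⁻¹ * (x - heatFun t x * x) - (1 - x)) * x) R := by
        rw [cfc_mul (fun x => t⁻¹ * (x - heatFun t x * x) - (1 - x)) (fun x => x) R hc''
          continuousOn_id, cfc_id' ℝ R, ← hq ht]
      rw [← mul_apply_eq_comp, h2]
      refine (ContinuousLinearMap.le_opNorm _ v).trans ?_
      gcongr
      exact norm_cfc_le (le_of_lt ht) fun x hx =>
        (abs_heat_quotient_le ht (hspec x hx).1 (hspec x hx).2).2.1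
  have hC0 : IsC0SemigroupBddBy T 1 :=
    { zero := hT0
      add := fun s t hs ht => by
        rcases hs.eq_or_lt with rfl | hs
        · rw [zero_add, hT0, one_mul]
        rcases ht.eq_or_lt with rfl | ht
        · rw [add_zero, hT0, mul_one]
        rw [hTpos hs, hTpos ht, hTpos (add_pos hs ht), ← cfc_mul _ _ R (hcont hs) (hcont ht)]
        simp only [heatFun_mul]
      tendsto := hlim
      norm_le := hTnorm }
  refine ⟨T, ⟨hC0.toIsC0Semigroup, fun f g => ⟨fun h => ?_, fun h => ?_⟩⟩, hC0⟩
  · have := hgen (f + g)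
    rwa [hR2 f g h, add_sub_cancel_left] at this
  -- The generator is no larger than `L`: two values for the image of `R f` give `R g = f - R f`, so
  -- `f = R (f + g)` lies in the domain of `L`.
  · have h1 : Gen T (R f) (R g) := by
      refine ((R.continuous.tendsto g).comp h).congr' ?_
      filter_upwards [self_mem_nhdsWithin] with t ht
      have := congrArg (fun S : E →L[ℂ] E => S f) (hcomm ht)
      simp only [mul_apply_eq_comp] at this
      simp only [Function.comp, map_smul, map_sub, this]
    have h2 := h1.unique (hgen f)
    have h3 : R (f + g) = f := by rw [map_add, h2]; abel
    have h4 := hR1 (f + g)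
    rwa [h3, add_sub_cancel_left] at h4

end HeatSemigroup

/-! ### Domination as membership in a closed convex cone -/

section Domination

variable {E : Type*} [NormedAddCommGroup E] [NormedSpace ℂ E]

/-- The abstract properties of the set of pairs `(u, v)` with `|u| ≤ v`. -/
structure IsDominationCone (K : Set (E × E)) : Prop where
  isClosed : IsClosed K
  zero_mem : (0 : E × E) ∈ K
  add_mem : ∀ {p q : E × E}, p ∈ K → q ∈ K → p + q ∈ K
  smul_mem : ∀ {c : ℂ} {r : ℝ} {p : E × E}, ‖c‖ ≤ r → p ∈ K → (c • p.1, (r : ℂ) • p.2) ∈ K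

namespace IsDominationCone

variable {K : Set (E × E)}

theorem real_smul_mem (hK : IsDominationCone K) {r : ℝ} (hr : 0 ≤ r) {p : E × E} (hp : p ∈ K) :
    r • p ∈ K := by
  have := hK.smul_mem (c := (r : ℂ)) (r := r) (by simp [abs_of_nonneg hr]) hp
  simpa [Complex.coe_smul, Prod.smul_def] using this

theorem convex (hK : IsDominationCone K) : Convex ℝ K :=
  fun _ hp _ hq _ _ ha hb _ => hK.add_mem (hK.real_smul_mem ha hp) (hK.real_smul_mem hb hq)

/-- Were the integral outside, Hahn-Banach would give a functional bounded above on the cone, hence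
nonpositive there by scaling, yet positive at the integral. -/
theorem integral_mem [CompleteSpace E] (hK : IsDominationCone K) {α : Type*} [MeasurableSpace α]
    {ν : Measure α} {u v : α → E} (hu : Integrable u ν) (hv : Integrable v ν)
    (h : ∀ᵐ s ∂ν, (u s, v s) ∈ K) : (∫ s, u s ∂ν, ∫ s, v s ∂ν) ∈ K := by
  by_contra hnot
  obtain ⟨ℓ, b, hℓ, hb⟩ := geometric_hahn_banach_closed_point hK.convex hK.isClosed hnot
  have hb0 : 0 < b := by simpa using hℓ 0 hK.zero_mem
  have hle : ∀ p ∈ K, ℓ p ≤ 0 := by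
    intro p hp
    by_contra! hpos
    have := hℓ _ (hK.real_smul_mem (r := b / ℓ p) (by positivity) hp)
    rw [map_smul, smul_eq_mul, div_mul_cancel₀ _ hpos.ne'] at this
    exact lt_irrefl _ this
  have hint : Integrable (fun s => (u s, v s)) ν := hu.prodMk hv
  have h1 : ℓ (∫ s, u s ∂ν, ∫ s, v s ∂ν) = ∫ s, ℓ (u s, v s) ∂ν := by
    rw [ℓ.integral_comp_comm hint, integral_pair hu hv]
  rw [h1] at hb
  have h2 : ∫ s, ℓ (u s, v s) ∂ν ≤ 0 := integral_nonpos_of_ae (h.mono fun s hs => hle _ hs)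
  linarith

variable [CompleteSpace E] {H G : ℝ → E →L[ℂ] E} {B B' : ℝ}

/-- The densities compare by `norm_subDensity_le_ofReal`, and the cone is stable under integration.
The second vector `f'` is left free so that it can carry the constant `C`. -/
theorem subordinate_mem (hK : IsDominationCone K) (hH : IsC0SemigroupBddBy H B)
    (hG : IsC0SemigroupBddBy G B') {z : ℂ} {τ c : ℝ} (hz : z ∈ diagSector) (hτ : 0 < τ)
    (h1 : ‖z‖ ≤ c * τ) (h2 : τ ^ 2 ≤ (z ^ 2).re) {f f' : E}
    (hf : ∀ s, 0 < s → (H s f, G s f') ∈ K) :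
    (subordinate H z f, (c : ℂ) • subordinate G τ f') ∈ K := by
  have hτ' := ofReal_mem_diagSector hτ
  rw [subordinate_of_mem hz, subordinate_of_mem hτ', hH.weightedAvg_apply (integrableOn_subDensity hz),
    hG.weightedAvg_apply (integrableOn_subDensity hτ'), ← integral_smul]
  refine hK.integral_mem (hH.integrableOn (integrableOn_subDensity hz) f)
    ((hG.integrableOn (integrableOn_subDensity hτ') f').smul (c : ℂ))
    ((ae_restrict_iff' measurableSet_Ioi).2 (Eventually.of_forall fun s hs => ?_))
  have := hK.smul_mem (norm_subDensity_le_ofReal h1 h2 hs) (hf s hs)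
  rwa [Complex.ofReal_mul, ← subDensity_ofReal, ← smul_smul] at this

end IsDominationCone

/-- The constants for the time derivatives. -/
def derivConst (k : ℕ) (θ : ℝ) : ℝ := k.factorial * (4 / (1 - θ ^ 2)) ^ k * (2 / θ)

variable [CompleteSpace E]

/-- The radius `R = (1-θ²)t/4` gives `Re z² ≥ (t-R)² - R² = t² (1+θ²)/2 ≥ (θt)²` on the circle, and
`|z| ≤ 2t = (2/θ)(θt)`. -/
theorem circleMap_bounds {θ t : ℝ} (hθ0 : 0 < θ) (hθ1 : θ < 1) (ht : 0 < t) (φ : ℝ) :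
    circleMap t ((1 - θ ^ 2) / 4 * t) φ ∈ diagSector ∧
    ‖circleMap t ((1 - θ ^ 2) / 4 * t) φ‖ ≤ 2 / θ * (θ * t) ∧
    (θ * t) ^ 2 ≤ ((circleMap t ((1 - θ ^ 2) / 4 * t) φ) ^ 2).re := by
  have hθ2 : θ ^ 2 < 1 := by nlinarith
  set R := (1 - θ ^ 2) / 4 * t with hR
  have hR0 : 0 ≤ R := mul_nonneg (by linarith) ht.le
  have hRt : R ≤ t / 4 := by rw [hR]; nlinarith [mul_pos (pow_pos hθ0 2) ht]
  have hmem := circleMap_mem_closedBall (t : ℂ) hR0 φ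
  refine ⟨closedBall_subset_diagSector (by linarith) hmem, ?_, ?_⟩
  all_goals
    set z := circleMap t R φ
    rw [Metric.mem_closedBall, dist_eq_norm] at hmem
  · have h1 : ‖z‖ ≤ ‖z - t‖ + ‖(t : ℂ)‖ := by simpa using norm_add_le (z - t) (t : ℂ)
    rw [Complex.norm_real, Real.norm_of_nonneg ht.le] at h1
    have h2 : 2 / θ * (θ * t) = 2 * t := by field_simp
    rw [h2]
    linarith
  · have h1 := (Complex.abs_re_le_norm _).trans hmem
    have h2 := (Complex.abs_im_le_norm _).trans hmem
    simp only [Complex.sub_re, Complex.sub_im, Complex.ofReal_re, Complex.ofReal_im,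
      sub_zero] at h1 h2
    have h3 := (abs_le.1 h1).1
    have h4 : z.im ^ 2 ≤ R ^ 2 := sq_le_sq' (abs_le.1 h2).1 (abs_le.1 h2).2
    have h5 : (t - R) ^ 2 ≤ z.re ^ 2 := pow_le_pow_left₀ (by linarith) (by linarith) 2
    rw [re_sq]
    have h6 : (t - R) ^ 2 - R ^ 2 = t ^ 2 * ((1 + θ ^ 2) / 2) := by rw [hR]; ring
    have h7 : (θ * t) ^ 2 ≤ t ^ 2 * ((1 + θ ^ 2) / 2) := by
      rw [mul_pow, mul_comm]; gcongr; linarith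
    linarith

theorem IsDominationCone.poissonDeriv_mem {K : Set (E × E)} {H G : ℝ → E →L[ℂ] E} {B B' : ℝ}
    {L : E →ₗ.[ℂ] E} (hK : IsDominationCone K) (hH : IsC0SemigroupBddBy H B)
    (hL : IsSemigroupOf H L) (hG : IsC0SemigroupBddBy G B') {θ t : ℝ} (hθ0 : 0 < θ) (hθ1 : θ < 1)
    (ht : 0 < t) (k : ℕ) {f f' : E} (hf : ∀ s, 0 < s → (H s f, G s f') ∈ K) :
    (poissonDeriv L t k f, (derivConst k θ : ℂ) • subordinate G (θ * t : ℝ) f') ∈ K := by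
  have hθ2 : 0 < 1 - θ ^ 2 := by nlinarith
  set R := (1 - θ ^ 2) / 4 * t with hR
  have hR0 : 0 < R := by positivity
  have hRt : 2 * R < t := by rw [hR]; nlinarith [mul_pos (pow_pos hθ0 2) ht]
  -- The norm of `cauchyCoeff`; its factor `(2π)⁻¹` cancels the length of the interval, and `t / R =
  -- 4/(1-θ²)`.
  set c := (2 * Real.pi)⁻¹ * (k.factorial * (t / R) ^ k) with hc
  have htR : t / R = 4 / (1 - θ ^ 2) := by rw [hR]; field_simp
  have hcont : Continuous fun φ => cauchyCoeff k t R φ • subordinate H (circleMap t R φ) f :=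
    (continuous_cauchyCoeff k t hR0).smul
      ((continuous_subordinate_circleMap hH hR0.le hRt).clm_apply continuous_const)
  have h2π : (0 : ℝ) ≤ 2 * Real.pi := by positivity
  set y := (c : ℂ) • ((2 / θ : ℝ) : ℂ) • subordinate G (θ * t : ℝ) f' with hy
  have h1 : (derivConst k θ : ℂ) • subordinate G (θ * t : ℝ) f' =
      ∫ _ in (0 : ℝ)..2 * Real.pi, y := by
    rw [intervalIntegral.integral_const, hy, sub_zero, ← Complex.coe_smul, smul_smul, smul_smul,
      ← Complex.ofReal_mul, ← Complex.ofReal_mul, derivConst, hc, htR]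
    congr 2
    have : Real.pi ≠ 0 := Real.pi_ne_zero
    field_simp
  rw [poissonDeriv_eq_integral hH hL hR0 hRt k f, h1, intervalIntegral.integral_of_le h2π,
    intervalIntegral.integral_of_le h2π]
  refine hK.integral_mem ((hcont.intervalIntegrable _ _).1) (intervalIntegrable_const.1) ?_
  refine Eventually.of_forall fun φ => ?_
  obtain ⟨b1, b2, b3⟩ := circleMap_bounds hθ0 hθ1 ht φ
  exact hK.smul_mem (norm_cauchyCoeff k ht.le hR0.le φ).le
    (hK.subordinate_mem hH hG b1 (mul_pos hθ0 ht) b2 b3 hf)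

end Domination

/-! ### The cone of pairs `|u| ≤ v` in `L²` -/

section LebesgueCone

variable {X : Type*} [MeasurableSpace X] {μ : Measure X}

/-- The pairs `(u, v)` in `L²` with `|u| ≤ v` almost everywhere. -/
def absLeSet (μ : Measure X) : Set (Lp ℂ 2 μ × Lp ℂ 2 μ) :=
  {p | ∀ᵐ x ∂μ, ((‖p.1 x‖ : ℝ) : ℂ) ≤ p.2 x}

theorem exists_subseq_ae {u : ℕ → Lp ℂ 2 μ} {f : Lp ℂ 2 μ} (h : Tendsto u atTop (𝓝 f)) :
    ∃ n : ℕ → ℕ, StrictMono n ∧ ∀ᵐ x ∂μ, Tendsto (fun i => u (n i) x) atTop (𝓝 (f x)) :=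
  (tendstoInMeasure_of_tendsto_Lp h).exists_seq_tendsto_ae

/-- An `L²`-convergent sequence has an almost everywhere convergent subsequence; two extractions
serve both components at once. -/
theorem isClosed_absLeSet : IsClosed (absLeSet μ) := by
  refine IsSeqClosed.isClosed fun p q hp hlim => ?_
  obtain ⟨n, hn, h1⟩ := exists_subseq_ae ((continuous_fst.tendsto q).comp hlim)
  obtain ⟨m, hm, h2⟩ := exists_subseq_ae
    (((continuous_snd.tendsto q).comp hlim).comp hn.tendsto_atTop)
  have h3 : ∀ᵐ x ∂μ, ∀ i, ((‖(p i).1 x‖ : ℝ) : ℂ) ≤ (p i).2 x := ae_all_iff.2 hp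
  filter_upwards [h1, h2, h3] with x hx1 hx2 hx3
  have h4 := ((Complex.continuous_ofReal.comp continuous_norm).tendsto _).comp
    (hx1.comp hm.tendsto_atTop)
  exact le_of_tendsto_of_tendsto' h4 hx2 fun i => hx3 _

theorem isDominationCone_absLeSet : IsDominationCone (absLeSet μ) where
  isClosed := isClosed_absLeSet
  zero_mem := by
    have h : ∀ᵐ x ∂μ, (0 : Lp ℂ 2 μ) x = 0 := Lp.coeFn_zero ℂ 2 μ
    change ∀ᵐ x ∂μ, ((‖(0 : Lp ℂ 2 μ) x‖ : ℝ) : ℂ) ≤ (0 : Lp ℂ 2 μ) x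
    filter_upwards [h] with x hx
    rw [hx, norm_zero, Complex.ofReal_zero]
  add_mem {p q} hp hq := by
    change ∀ᵐ x ∂μ, ((‖(p.1 + q.1) x‖ : ℝ) : ℂ) ≤ (p.2 + q.2) x
    filter_upwards [hp, hq, Lp.coeFn_add p.1 q.1, Lp.coeFn_add p.2 q.2] with x h1 h2 h3 h4
    rw [h3, h4]
    simp only [Pi.add_apply]
    refine le_trans ?_ (add_le_add h1 h2)
    rw [← Complex.ofReal_add]
    exact Complex.real_le_real.2 (norm_add_le _ _)
  smul_mem {c r p} hc hp := by
    change ∀ᵐ x ∂μ, ((‖(c • p.1) x‖ : ℝ) : ℂ) ≤ ((r : ℂ) • p.2) x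
    filter_upwards [hp, Lp.coeFn_smul c p.1, Lp.coeFn_smul (r : ℂ) p.2] with x h1 h3 h4
    rw [h3, h4]
    simp only [Pi.smul_apply, smul_eq_mul, norm_mul, Complex.ofReal_mul]
    have h0 : (0 : ℂ) ≤ ((‖p.1 x‖ : ℝ) : ℂ) := Complex.zero_le_real.2 (norm_nonneg _)
    exact mul_le_mul (Complex.real_le_real.2 hc) h1 h0
      (Complex.zero_le_real.2 ((norm_nonneg c).trans hc))

theorem dominated_iff {T S : Lp ℂ 2 μ →L[ℂ] Lp ℂ 2 μ} {c : ℝ} :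
    Dominated T S c ↔ ∀ f, (T f, (c : ℂ) • S (absL2 f)) ∈ absLeSet μ := by
  refine forall_congr' fun f => ?_
  change _ ↔ ∀ᵐ x ∂μ, ((‖T f x‖ : ℝ) : ℂ) ≤ ((c : ℂ) • S (absL2 f)) x
  refine ⟨fun h => ?_, fun h => ?_⟩
  · filter_upwards [h, Lp.coeFn_smul (c : ℂ) (S (absL2 f))] with x h1 h2
    rwa [h2]
  · filter_upwards [h, Lp.coeFn_smul (c : ℂ) (S (absL2 f))] with x h1 h2
    rwa [h2] at h1

variable {H G : ℝ → Lp ℂ 2 μ →L[ℂ] Lp ℂ 2 μ} {B B' C : ℝ}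

theorem dominated_subordinate (hH : IsC0SemigroupBddBy H B) (hG : IsC0SemigroupBddBy G B')
    (hd : ∀ t, 0 < t → Dominated (H t) (G t) C) {z : ℂ} {τ c : ℝ} (hz : z ∈ diagSector)
    (hτ : 0 < τ) (h1 : ‖z‖ ≤ c * τ) (h2 : τ ^ 2 ≤ (z ^ 2).re) :
    Dominated (subordinate H z) (subordinate G τ) (c * C) := by
  rw [dominated_iff]
  intro f
  have := isDominationCone_absLeSet.subordinate_mem hH hG hz hτ h1 h2 (f := f)
    (f' := (C : ℂ) • absL2 f) fun s hs => by
      rw [map_smul]; exact dominated_iff.1 (hd s hs) f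
  rwa [map_smul, smul_smul, ← Complex.ofReal_mul] at this

theorem dominated_poissonDeriv {L : Lp ℂ 2 μ →ₗ.[ℂ] Lp ℂ 2 μ} (hH : IsC0SemigroupBddBy H B)
    (hL : IsSemigroupOf H L) (hG : IsC0SemigroupBddBy G B')
    (hd : ∀ t, 0 < t → Dominated (H t) (G t) C) {θ t : ℝ} (hθ0 : 0 < θ) (hθ1 : θ < 1)
    (ht : 0 < t) (k : ℕ) :
    Dominated (poissonDeriv L t k) (subordinate G (θ * t : ℝ)) (derivConst k θ * C) := by
  rw [dominated_iff]
  intro f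
  have := isDominationCone_absLeSet.poissonDeriv_mem hH hL hG hθ0 hθ1 ht k (f := f)
    (f' := (C : ℂ) • absL2 f) fun s hs => by
      rw [map_smul]; exact dominated_iff.1 (hd s hs) f
  rwa [map_smul, smul_smul, ← Complex.ofReal_mul] at this

/-- The domination passes to time `0`. -/
theorem dominated_one (hH : IsC0SemigroupBddBy H B) (hG : IsC0SemigroupBddBy G B')
    (hd : ∀ t, 0 < t → Dominated (H t) (G t) C) : Dominated (μ := μ) 1 1 C := by
  rw [dominated_iff]
  intro f
  refine isClosed_absLeSet.mem_of_tendsto (b := 𝓝[>] (0 : ℝ))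
    ((hH.tendsto f).prodMk_nhds ((hG.tendsto (absL2 f)).const_smul (C : ℂ))) ?_
  filter_upwards [self_mem_nhdsWithin] with t ht using dominated_iff.1 (hd t ht) f

theorem absL2_coe (f : Lp ℂ 2 μ) : ∀ᵐ x ∂μ, absL2 f x = ((‖f x‖ : ℝ) : ℂ) :=
  MemLp.coeFn_toLp _

theorem Dominated.one_mono {c : ℝ} (h : Dominated (μ := μ) 1 1 C) (hc : C ≤ c) :
    Dominated (μ := μ) 1 1 c := by
  intro f
  filter_upwards [h f, absL2_coe f] with x h1 h2
  simp only [one_apply_eq_self] at h1 ⊢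
  rw [h2] at h1 ⊢
  exact h1.trans (mul_le_mul_of_nonneg_right (Complex.real_le_real.2 hc)
    (Complex.zero_le_real.2 (norm_nonneg _)))

end LebesgueCone

/-! ### Comparing kernels through their integrals over rectangles -/

section SetSemiring

variable {α β : Type*}

/-- Finite intersections and differences of measurable rectangles are finite disjoint unions of
measurable rectangles. -/
theorem isSetSemiring_measurable_prod [MeasurableSpace α] [MeasurableSpace β] :
    IsSetSemiring (Set.image2 (· ×ˢ ·) {s : Set α | MeasurableSet s}
      {t : Set β | MeasurableSet t}) where
  empty_mem := ⟨∅, .empty, ∅, .empty, by simp⟩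
  inter_mem := by
    rintro _ ⟨s, hs, t, ht, rfl⟩ _ ⟨s', hs', t', ht', rfl⟩
    exact ⟨s ∩ s', hs.inter hs', t ∩ t', ht.inter ht', Set.prod_inter_prod.symm⟩
  sdiff_eq_sUnion' := by
    classical
    rintro _ ⟨s, hs, t, ht, rfl⟩ _ ⟨s', hs', t', ht', rfl⟩
    refine ⟨{(s \ s') ×ˢ t, (s ∩ s') ×ˢ (t \ t')}, ?_, ?_, ?_⟩
    · intro u hu
      simp only [Finset.coe_insert, Finset.coe_singleton, Set.mem_insert_iff,
        Set.mem_singleton_iff] at hu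
      rcases hu with rfl | rfl
      · exact ⟨_, hs.diff hs', _, ht, rfl⟩
      · exact ⟨_, hs.inter hs', _, ht.diff ht', rfl⟩
    · rw [Finset.coe_insert, Finset.coe_singleton]
      refine Set.PairwiseDisjoint.insert (Set.pairwiseDisjoint_singleton _ _) ?_
      rintro _ rfl -
      refine Set.disjoint_left.2 ?_
      rintro ⟨x, y⟩ ⟨h1, -⟩ ⟨h2, -⟩
      exact h1.2 h2.2
    · ext ⟨x, y⟩
      simp only [Set.mem_sdiff, Set.mem_prod, Finset.coe_insert, Finset.coe_singleton,
        Set.sUnion_insert, Set.sUnion_singleton, Set.mem_union, Set.mem_inter_iff]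
      tauto

variable {E : Type*} [NormedAddCommGroup E] [NormedSpace ℝ E] [MeasurableSpace α]

/-- If the integrals of `f` over the members of a generating semiring lie in a closed additive
submonoid, then so do the integrals of `f` over all measurable sets. -/
theorem setIntegral_mem_of_isSetSemiring {ν : Measure α} [IsFiniteMeasure ν] {𝒞 : Set (Set α)}
    (h𝒞 : IsSetSemiring 𝒞) (huniv : Set.univ ∈ 𝒞)
    (hgen : ‹MeasurableSpace α› = MeasurableSpace.generateFrom 𝒞) {f : α → E}
    (hf : Integrable f ν) (K : AddSubmonoid E) (hK : IsClosed (K : Set E))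
    (h : ∀ s ∈ 𝒞, ∫ x in s, f x ∂ν ∈ K) {s : Set α} (hs : MeasurableSet s) :
    ∫ x in s, f x ∂ν ∈ K := by
  classical
  have hmeas : ∀ t ∈ 𝒞, MeasurableSet t := fun t ht => by
    rw [hgen]; exact MeasurableSpace.measurableSet_generateFrom ht
  have hsup : ∀ t ∈ supClosure 𝒞, MeasurableSet t ∧ ∫ x in t, f x ∂ν ∈ K := by
    intro t ht
    obtain ⟨P, hP⟩ := h𝒞.mem_supClosure_iff.1 ht
    obtain ⟨S, hS, hd, rfl⟩ : ∃ S : Finset (Set α), (S : Set (Set α)) ⊆ 𝒞 ∧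
        (S : Set (Set α)).PairwiseDisjoint id ∧ t = ⋃ i ∈ S, i := by
      refine ⟨P.parts, hP, P.disjoint, ?_⟩
      have h1 := P.sup_parts
      rw [Finset.sup_id_eq_sSup, Set.sSup_eq_sUnion, Set.sUnion_eq_biUnion] at h1
      exact h1.symm
    have hm : ∀ i ∈ S, MeasurableSet i := fun i hi => hmeas i (hS hi)
    refine ⟨Finset.measurableSet_biUnion _ hm, ?_⟩
    rw [integral_biUnion_finset S hm hd fun i _ => hf.integrableOn]
    exact K.sum_mem fun i hi => h i (hS hi)
  -- Finite disjoint unions of members approximate `s` in measure, and the integrals over the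
  -- difference sets tend to zero by absolute continuity.
  have happ : ∀ n : ℕ, ∃ t ∈ supClosure 𝒞, ν (symmDiff t s) < ((n : ℝ≥0∞) + 1)⁻¹ := fun n =>
    exists_measure_symmDiff_lt_of_generateFrom_isSetSemiring h𝒞
      ⟨{Set.univ}, Set.countable_singleton _, by simpa using huniv, by simp⟩ hgen hs
      (ENNReal.inv_pos.2 (by finiteness))
  choose t ht htlt using happ
  have hlim : Tendsto (fun n => ν (symmDiff (t n) s)) atTop (𝓝 0) := by
    refine tendsto_of_tendsto_of_tendsto_of_le_of_le tendsto_const_nhds ?_ (fun _ => zero_le)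
      fun n => (htlt n).le
    have h1 := ENNReal.tendsto_inv_nat_nhds_zero.comp (tendsto_add_atTop_nat 1)
    refine h1.congr fun n => ?_
    simp
  have h1 : Tendsto (fun n => ∫ x in t n \ s, f x ∂ν) atTop (𝓝 0) :=
    hf.tendsto_setIntegral_nhds_zero (tendsto_of_tendsto_of_tendsto_of_le_of_le
      tendsto_const_nhds hlim (fun _ => zero_le) fun n => measure_mono fun x hx => Or.inl hx)
  have h2 : Tendsto (fun n => ∫ x in s \ t n, f x ∂ν) atTop (𝓝 0) :=
    hf.tendsto_setIntegral_nhds_zero (tendsto_of_tendsto_of_tendsto_of_le_of_le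
      tendsto_const_nhds hlim (fun _ => zero_le) fun n => measure_mono fun x hx => Or.inr hx)
  have h3 : Tendsto (fun n => ∫ x in t n, f x ∂ν) atTop (𝓝 (∫ x in s, f x ∂ν)) := by
    have h4 := (h1.sub h2).add_const (∫ x in s, f x ∂ν)
    rw [sub_zero, zero_add] at h4
    refine h4.congr fun n => ?_
    rw [← integral_inter_add_sdiff (s := t n) hs hf.integrableOn,
      ← integral_inter_add_sdiff (s := s) (hsup _ (ht n)).1 hf.integrableOn, Set.inter_comm s]
    abel
  exact hK.mem_of_tendsto h3 (Eventually.of_forall fun n => (hsup _ (ht n)).2)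

end SetSemiring

section Cone

variable {α : Type*} [MeasurableSpace α]

/-- The closed convex cone of all pairs `(a, b)` with `|a| ≤ b`. -/
def normLeCone : AddSubmonoid (ℂ × ℂ) where
  carrier := {p | ((‖p.1‖ : ℝ) : ℂ) ≤ p.2}
  zero_mem' := by simp
  add_mem' {p q} hp hq := by
    change ((‖p.1 + q.1‖ : ℝ) : ℂ) ≤ p.2 + q.2
    refine le_trans ?_ (add_le_add hp hq)
    rw [← Complex.ofReal_add]
    exact Complex.real_le_real.2 (norm_add_le _ _)

theorem mem_normLeCone {p : ℂ × ℂ} : p ∈ normLeCone ↔ ((‖p.1‖ : ℝ) : ℂ) ≤ p.2 := Iff.rfl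

theorem isClosed_normLeCone : IsClosed (normLeCone : Set (ℂ × ℂ)) :=
  isClosed_le (Complex.continuous_ofReal.comp (continuous_norm.comp continuous_fst))
    continuous_snd

/-- A characterization of `|a| ≤ b` by countably many real linear inequalities. -/
theorem norm_le_iff_forall_dense {a b : ℂ} :
    ((‖a‖ : ℝ) : ℂ) ≤ b ↔ b.im = 0 ∧
      ∀ n : ℕ, 0 ≤ (b * ((‖TopologicalSpace.denseSeq ℂ n‖ : ℝ) : ℂ)
        - TopologicalSpace.denseSeq ℂ n * a).re := by
  have key : (∀ n : ℕ, 0 ≤ (b * ((‖TopologicalSpace.denseSeq ℂ n‖ : ℝ) : ℂ)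
        - TopologicalSpace.denseSeq ℂ n * a).re) ↔
      ∀ u : ℂ, 0 ≤ (b * ((‖u‖ : ℝ) : ℂ) - u * a).re := by
    refine ⟨fun h u => ?_, fun h n => h _⟩
    have hc : IsClosed {u : ℂ | 0 ≤ (b * ((‖u‖ : ℝ) : ℂ) - u * a).re} :=
      isClosed_le continuous_const (by fun_prop)
    have := (TopologicalSpace.denseRange_denseSeq ℂ).closure_range
    have h1 : closure (Set.range (TopologicalSpace.denseSeq ℂ)) ⊆
        {u : ℂ | 0 ≤ (b * ((‖u‖ : ℝ) : ℂ) - u * a).re} := by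
      refine hc.closure_subset_iff.2 ?_
      rintro _ ⟨n, rfl⟩
      exact h n
    rw [this] at h1
    exact h1 (Set.mem_univ u)
  rw [key, Complex.le_def, Complex.ofReal_re, Complex.ofReal_im]
  constructor
  · rintro ⟨h1, h2⟩
    refine ⟨h2.symm, fun u => ?_⟩
    have h3 : (u * a).re ≤ ‖u‖ * ‖a‖ := by
      rw [← norm_mul]; exact Complex.re_le_norm _
    rw [Complex.sub_re, Complex.re_mul_ofReal]
    nlinarith [norm_nonneg u]
  · rintro ⟨h1, h2⟩
    refine ⟨?_, h1.symm⟩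
    rcases eq_or_ne a 0 with rfl | ha
    · have := h2 1
      simp at this
      simpa using this
    -- The test vector `conj a` gives `|a|² ≤ |a| Re b`.
    · have := h2 ((starRingEnd ℂ) a)
      rw [Complex.sub_re, Complex.re_mul_ofReal, RCLike.norm_conj, ← Complex.normSq_eq_conj_mul_self,
        Complex.ofReal_re, Complex.normSq_eq_norm_sq] at this
      have hpos := norm_pos_iff.2 ha
      nlinarith

/-- The cone is cut out by countably many real linear conditions. Each passes from set integrals to
almost every point, and countably many null sets are harmless. -/
theorem ae_mem_normLeCone_of_setIntegral {ν : Measure α} {f : α → ℂ × ℂ} (hf : Integrable f ν)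
    (h : ∀ s, MeasurableSet s → ∫ x in s, f x ∂ν ∈ normLeCone) : ∀ᵐ x ∂ν, f x ∈ normLeCone := by
  have hf1 := hf.fst
  have hf2 := hf.snd
  have h' : ∀ s, MeasurableSet s →
      ((‖∫ x in s, (f x).1 ∂ν‖ : ℝ) : ℂ) ≤ ∫ x in s, (f x).2 ∂ν := fun s hs => by
    have := mem_normLeCone.1 (h s hs)
    rwa [fst_integral hf.integrableOn, snd_integral hf.integrableOn] at this
  have him : ∀ᵐ x ∂ν, (f x).2.im = 0 := by
    have h1 : Integrable (fun x => (f x).2.im) ν := hf2.im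
    have h2 : (fun x => (f x).2.im) =ᵐ[ν] 0 := by
      refine h1.ae_eq_zero_of_forall_setIntegral_eq_zero fun s hs _ => ?_
      have := (norm_le_iff_forall_dense.1 (h' s hs)).1
      rwa [← RCLike.im_eq_complex_im, ← integral_im hf2.integrableOn] at this
    exact h2
  have hre : ∀ n : ℕ, ∀ᵐ x ∂ν, 0 ≤ ((f x).2 * ((‖TopologicalSpace.denseSeq ℂ n‖ : ℝ) : ℂ)
        - TopologicalSpace.denseSeq ℂ n * (f x).1).re := by
    intro n
    have h1 : Integrable (fun x => (f x).2 * ((‖TopologicalSpace.denseSeq ℂ n‖ : ℝ) : ℂ)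
        - TopologicalSpace.denseSeq ℂ n * (f x).1) ν :=
      (hf2.mul_const _).sub (hf1.const_mul _)
    refine ae_nonneg_of_forall_setIntegral_nonneg h1.re fun s hs _ => ?_
    have h2 := (norm_le_iff_forall_dense.1 (h' s hs)).2 n
    rw [← integral_mul_const, ← integral_const_mul, ← integral_sub
      (hf2.integrableOn.mul_const _) (hf1.integrableOn.const_mul _), ← RCLike.re_eq_complex_re,
      ← integral_re h1.integrableOn] at h2
    exact h2
  filter_upwards [him, ae_all_iff.2 hre] with x hx1 hx2
  exact mem_normLeCone.2 (norm_le_iff_forall_dense.2 ⟨hx1, hx2⟩)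

end Cone

section RectangleTest

variable {X : Type*} [MeasurableSpace X] {μ : Measure X} [SigmaFinite μ]

/-- An estimate between locally integrable functions on a product follows from the corresponding
estimates for the integrals over measurable rectangles. -/
theorem ae_norm_le_of_setIntegral_prod {p q : X × X → ℂ}
    (hp : ∀ n, IntegrableOn p (spanningSets μ n ×ˢ spanningSets μ n) (μ.prod μ))
    (hq : ∀ n, IntegrableOn q (spanningSets μ n ×ˢ spanningSets μ n) (μ.prod μ))
    (h : ∀ A B : Set X, MeasurableSet A → MeasurableSet B → μ A < ∞ → μ B < ∞ →
      ((‖∫ x in A ×ˢ B, p x ∂(μ.prod μ)‖ : ℝ) : ℂ) ≤ ∫ x in A ×ˢ B, q x ∂(μ.prod μ)) :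
    ∀ᵐ x ∂(μ.prod μ), ((‖p x‖ : ℝ) : ℂ) ≤ q x := by
  have hn : ∀ n, ∀ᵐ x ∂((μ.prod μ).restrict (spanningSets μ n ×ˢ spanningSets μ n)),
      ((‖p x‖ : ℝ) : ℂ) ≤ q x := by
    intro n
    set D := spanningSets μ n with hD
    have hDm : MeasurableSet D := measurableSet_spanningSets μ n
    have hDf : μ D < ∞ := measure_spanningSets_lt_top μ n
    have : IsFiniteMeasure ((μ.prod μ).restrict (D ×ˢ D)) :=
      ⟨by rw [Measure.restrict_apply_univ, Measure.prod_prod]; exact ENNReal.mul_lt_top hDf hDf⟩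
    have hf : Integrable (fun x => (p x, q x)) ((μ.prod μ).restrict (D ×ˢ D)) :=
      (hp n).prodMk (hq n)
    refine ae_mem_normLeCone_of_setIntegral hf fun s hs =>
      setIntegral_mem_of_isSetSemiring isSetSemiring_measurable_prod
        ⟨Set.univ, .univ, Set.univ, .univ, Set.univ_prod_univ⟩ generateFrom_prod.symm hf _
        isClosed_normLeCone ?_ hs
    rintro _ ⟨A, hA, B, hB, rfl⟩
    rw [mem_normLeCone, fst_integral hf.integrableOn, snd_integral hf.integrableOn,
      Measure.restrict_restrict (hA.prod hB), Set.prod_inter_prod]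
    exact h _ _ (hA.inter hDm) (hB.inter hDm) ((measure_mono Set.inter_subset_right).trans_lt hDf)
      ((measure_mono Set.inter_subset_right).trans_lt hDf)
  have hU : (⋃ n, spanningSets μ n ×ˢ spanningSets μ n) = Set.univ := by
    rw [Set.iUnion_prod_of_monotone (monotone_spanningSets μ) (monotone_spanningSets μ),
      iUnion_spanningSets, Set.univ_prod_univ]
  have := ae_restrict_iUnion_iff (μ := μ.prod μ)
    (fun n => spanningSets μ n ×ˢ spanningSets μ n) (fun x => ((‖p x‖ : ℝ) : ℂ) ≤ q x)
  rw [hU, Measure.restrict_univ] at this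
  exact this.2 hn

end RectangleTest

section KernelTest

variable {X : Type*} [MeasurableSpace X] {μ : Measure X}

/-- Testing against indicators turns the form of an operator into the integral of its kernel over a
rectangle. -/
theorem indicator_prod_ae_eq {A B : Set X} (hA : MeasurableSet A) (hB : MeasurableSet B)
    (hμA : μ A ≠ ∞) (hμB : μ B ≠ ∞) (p : X × X → ℂ) :
    (fun x : X × X => p x * indicatorConstLp 2 hB hμB (1 : ℂ) x.2 *
      (starRingEnd ℂ) (indicatorConstLp 2 hA hμA (1 : ℂ) x.1)) =ᵐ[μ.prod μ]
      (A ×ˢ B).indicator p := by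
  have h1 : ∀ᵐ x ∂(μ.prod μ), indicatorConstLp 2 hA hμA (1 : ℂ) x.1 = A.indicator 1 x.1 :=
    Measure.quasiMeasurePreserving_fst.ae indicatorConstLp_coeFn
  have h2 : ∀ᵐ x ∂(μ.prod μ), indicatorConstLp 2 hB hμB (1 : ℂ) x.2 = B.indicator 1 x.2 :=
    Measure.quasiMeasurePreserving_snd.ae indicatorConstLp_coeFn
  filter_upwards [h1, h2] with x hx1 hx2
  rw [hx1, hx2]
  by_cases ha : x.1 ∈ A <;> by_cases hb : x.2 ∈ B <;>
    simp [ha, hb, Set.indicator, Set.mem_prod]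

variable [MetricSpace X]

namespace HasKernel

variable {T S : Lp ℂ 2 μ →L[ℂ] Lp ℂ 2 μ} {p q : X × X → ℂ}

theorem integrableOn_prod (hT : HasKernel T p) {A B : Set X} (hA : MeasurableSet A)
    (hB : MeasurableSet B) (hμA : μ A ≠ ∞) (hμB : μ B ≠ ∞) :
    IntegrableOn p (A ×ˢ B) (μ.prod μ) := by
  rw [← integrable_indicator_iff (hA.prod hB)]
  exact (hT.integrable _ _).congr (indicator_prod_ae_eq hA hB hμA hμB p)

theorem setIntegral_prod (hT : HasKernel T p) {A B : Set X} (hA : MeasurableSet A)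
    (hB : MeasurableSet B) (hμA : μ A ≠ ∞) (hμB : μ B ≠ ∞) :
    ∫ x in A ×ˢ B, p x ∂(μ.prod μ) =
      inner ℂ (indicatorConstLp 2 hA hμA (1 : ℂ)) (T (indicatorConstLp 2 hB hμB (1 : ℂ))) := by
  rw [hT.inner_eq, integral_congr_ae (indicator_prod_ae_eq hA hB hμA hμB p),
    integral_indicator (hA.prod hB)]

/-- Domination of operators on nonnegative functions implies domination of their kernels. -/
theorem kernelDominated [SigmaFinite μ] (hT : HasKernel T p) (hS : HasKernel S q) {c : ℝ}
    (h : ∀ f : Lp ℂ 2 μ, (∀ᵐ x ∂μ, 0 ≤ f x) →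
      ∀ᵐ x ∂μ, ((‖T f x‖ : ℝ) : ℂ) ≤ (c : ℂ) * S f x) : KernelDominated μ p q c := by
  have hfin : ∀ n, μ (spanningSets μ n) ≠ ∞ := fun n => (measure_spanningSets_lt_top μ n).ne
  have hm : ∀ n, MeasurableSet (spanningSets μ n) := measurableSet_spanningSets μ
  refine ae_norm_le_of_setIntegral_prod
    (fun n => hT.integrableOn_prod (hm n) (hm n) (hfin n) (hfin n))
    (fun n => (hS.integrableOn_prod (hm n) (hm n) (hfin n) (hfin n)).const_mul _) ?_
  intro A B hA hB hμA hμB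
  rw [integral_const_mul, hT.setIntegral_prod hA hB hμA.ne hμB.ne,
    hS.setIntegral_prod hA hB hμA.ne hμB.ne, L2.inner_indicatorConstLp_one,
    L2.inner_indicatorConstLp_one, ← integral_const_mul]
  set f := indicatorConstLp 2 hB hμB.ne (1 : ℂ)
  have hf : ∀ᵐ x ∂μ, 0 ≤ f x := by
    filter_upwards [indicatorConstLp_coeFn (p := 2) (hs := hB) (hμs := hμB.ne) (c := (1 : ℂ))]
      with x hx
    rw [hx]
    exact Set.indicator_nonneg (fun _ _ => zero_le_one) x
  have hint : ∀ g : Lp ℂ 2 μ, IntegrableOn g A μ := fun g =>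
    integrableOn_Lp_of_measure_ne_top g (by norm_num) hμA.ne
  calc ((‖∫ x in A, T f x ∂μ‖ : ℝ) : ℂ) ≤ ((∫ x in A, ‖T f x‖ ∂μ : ℝ) : ℂ) :=
        Complex.real_le_real.2 (norm_integral_le_integral_norm _)
    _ = ∫ x in A, ((‖T f x‖ : ℝ) : ℂ) ∂μ := integral_ofReal.symm
    _ ≤ ∫ x in A, (c : ℂ) * S f x ∂μ :=
        setIntegral_mono_ae (hint _).norm.ofReal ((hint _).const_mul _) (h f hf)

end HasKernel

end KernelTest

/-! ### Mixtures of measures and of nonnegative kernels -/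

section Mixture

open ProbabilityTheory

variable {Ω Y : Type*} [MeasurableSpace Ω] [MeasurableSpace Y]

/-- A mixture of measures which are absolutely continuous with respect to `ν` has a density. -/
theorem exists_density_mixture {ρ : Measure Ω} {ν : Measure Y} [SigmaFinite ν] (κ : Kernel Ω Y)
    (hκ : ∀ ω, κ ω ≪ ν) [SigmaFinite (κ ∘ₘ ρ)] :
    ∃ a : Y → ℝ, ∀ ψ : Y → ℂ, AEStronglyMeasurable ψ ν → (∀ ω, Integrable ψ (κ ω)) →
      Integrable (fun ω => ∫ y, ‖ψ y‖ ∂(κ ω)) ρ →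
      Integrable (fun y => (a y : ℂ) * ψ y) ν ∧ Integrable (fun ω => ∫ y, ψ y ∂(κ ω)) ρ ∧
        ∫ y, (a y : ℂ) * ψ y ∂ν = ∫ ω, ∫ y, ψ y ∂(κ ω) ∂ρ := by
  have hac : κ ∘ₘ ρ ≪ ν := by
    refine Measure.AbsolutelyContinuous.mk fun s hs h0 => ?_
    rw [Measure.bind_apply hs κ.aemeasurable]
    simp [fun ω => hκ ω h0]
  refine ⟨fun y => ((κ ∘ₘ ρ).rnDeriv ν y).toReal, fun ψ hψ h1 h2 => ?_⟩
  have hint : Integrable ψ (κ ∘ₘ ρ) :=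
    (Measure.integrable_comp_iff (hψ.mono_ac hac)).2 ⟨Eventually.of_forall h1, h2⟩
  have hint' := hint
  rw [Measure.comp_eq_comp_const_apply] at hint'
  have h3 := Kernel.integral_comp hint'
  have h4 := hint'.integral_comp
  rw [Kernel.const_apply] at h3 h4
  rw [← Measure.comp_eq_comp_const_apply] at h3
  have h5 := (integrable_rnDeriv_smul_iff hac).2 hint
  have h6 := integral_rnDeriv_smul hac (f := ψ)
  simp only [Complex.real_smul] at h5 h6
  exact ⟨h5, h4, h6.trans h3⟩

end Mixture

section KernelMixture

open ProbabilityTheory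

variable {Ω X : Type*} [MeasurableSpace Ω] [MeasurableSpace X] {μ : Measure X}

theorem aestronglyMeasurable_test [SFinite μ] (f g : Lp ℂ 2 μ) :
    AEStronglyMeasurable (fun p : X × X => f p.2 * (starRingEnd ℂ) (g p.1)) (μ.prod μ) := by
  have h1 : AEStronglyMeasurable (fun p : X × X => f p.2) (μ.prod μ) :=
    (Lp.aestronglyMeasurable f).comp_snd
  have h2 : AEStronglyMeasurable (fun p : X × X => g p.1) (μ.prod μ) :=
    (Lp.aestronglyMeasurable g).comp_fst
  exact h1.mul (Complex.continuous_conj.comp_aestronglyMeasurable h2)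

theorem integral_test_indicator {A B : Set X} (hA : MeasurableSet A) (hB : MeasurableSet B)
    (hμA : μ A ≠ ∞) (hμB : μ B ≠ ∞) (F : X × X → ℂ) :
    ∫ p, F p * indicatorConstLp 2 hB hμB (1 : ℂ) p.2 *
      (starRingEnd ℂ) (indicatorConstLp 2 hA hμA (1 : ℂ) p.1) ∂(μ.prod μ) =
      ∫ p in A ×ˢ B, F p ∂(μ.prod μ) := by
  rw [integral_congr_ae (indicator_prod_ae_eq hA hB hμA hμB F), integral_indicator (hA.prod hB)]

variable [SigmaFinite μ]

theorem aestronglyMeasurable_of_integrableOn_spanningSets {F : X × X → ℂ}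
    (h : ∀ n, IntegrableOn F (spanningSets μ n ×ˢ spanningSets μ n) (μ.prod μ)) :
    AEStronglyMeasurable F (μ.prod μ) := by
  have hU : (⋃ n, spanningSets μ n ×ˢ spanningSets μ n) = Set.univ := by
    rw [Set.iUnion_prod_of_monotone (monotone_spanningSets μ) (monotone_spanningSets μ),
      iUnion_spanningSets, Set.univ_prod_univ]
  have := AEStronglyMeasurable.iUnion fun n => (h n).aestronglyMeasurable
  rwa [hU, Measure.restrict_univ] at this

/-- Rectangles form a generating π-system, which suffices for finite measures. The general case
follows by restricting to the squares of the spanning sets and taking suprema. -/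
theorem measurable_measure_of_prod {κ : Ω → Measure (X × X)}
    (hm : ∀ A B, MeasurableSet A → MeasurableSet B → μ A < ∞ → μ B < ∞ →
      Measurable fun ω => κ ω (A ×ˢ B))
    (hf : ∀ A B, MeasurableSet A → MeasurableSet B → μ A < ∞ → μ B < ∞ →
      ∀ ω, κ ω (A ×ˢ B) < ∞) : Measurable κ := by
  set D := spanningSets μ
  have hDm : ∀ n, MeasurableSet (D n) := measurableSet_spanningSets μ
  have hDf : ∀ n (A : Set X), μ (A ∩ D n) < ∞ := fun n A =>
    (measure_mono Set.inter_subset_right).trans_lt (measure_spanningSets_lt_top μ n)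
  have hD : Monotone fun n => D n ×ˢ D n := fun m n hmn =>
    Set.prod_mono (monotone_spanningSets μ hmn) (monotone_spanningSets μ hmn)
  have hU : (⋃ n, D n ×ˢ D n) = Set.univ := by
    rw [Set.iUnion_prod_of_monotone (monotone_spanningSets μ) (monotone_spanningSets μ),
      iUnion_spanningSets, Set.univ_prod_univ]
  have hn : ∀ n, Measurable fun ω => (κ ω).restrict (D n ×ˢ D n) := by
    intro n
    have hfin : ∀ ω, IsFiniteMeasure ((κ ω).restrict (D n ×ˢ D n)) := fun ω =>
      ⟨by rw [Measure.restrict_apply_univ]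
          exact hf _ _ (hDm n) (hDm n) (measure_spanningSets_lt_top μ n)
            (measure_spanningSets_lt_top μ n) ω⟩
    have hrect : ∀ A B, MeasurableSet A → MeasurableSet B →
        Measurable fun ω => (κ ω).restrict (D n ×ˢ D n) (A ×ˢ B) := fun A B hA hB => by
      simp only [Measure.restrict_apply (hA.prod hB), Set.prod_inter_prod]
      exact hm _ _ (hA.inter (hDm n)) (hB.inter (hDm n)) (hDf n A) (hDf n B)
    refine Measurable.measure_of_isPiSystem generateFrom_prod.symm isPiSystem_prod ?_ ?_
    · rintro _ ⟨A, hA, B, hB, rfl⟩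
      exact hrect A B hA hB
    · rw [← Set.univ_prod_univ]
      exact hrect _ _ .univ .univ
  refine Measure.measurable_of_measurable_coe _ fun E hE => ?_
  have h1 : ∀ ω, κ ω E = ⨆ n, (κ ω).restrict (D n ×ˢ D n) E := fun ω => by
    simp only [Measure.restrict_apply hE]
    rw [← Monotone.measure_iUnion fun m n hmn => Set.inter_subset_inter_right E (hD hmn),
      ← Set.inter_iUnion, hU, Set.inter_univ]
  simp only [h1]
  exact Measurable.iSup fun n => (Measure.measurable_coe hE).comp (hn n)

/-- A mixture of nonnegative kernels is a kernel. -/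
theorem exists_kernel_mixture {ρ : Measure Ω} {F : Ω → X × X → ℝ}
    (hF : ∀ ω, ∀ᵐ p ∂(μ.prod μ), 0 ≤ F ω p)
    (hint : ∀ ω, ∀ f g : Lp ℂ 2 μ, Integrable
      (fun p : X × X => (F ω p : ℂ) * f p.2 * (starRingEnd ℂ) (g p.1)) (μ.prod μ))
    (hmeas : ∀ f g : Lp ℂ 2 μ, Measurable
      fun ω => ∫ p, (F ω p : ℂ) * f p.2 * (starRingEnd ℂ) (g p.1) ∂(μ.prod μ))
    (hρ : ∀ f g : Lp ℂ 2 μ, Integrable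
      (fun ω => ∫ p, (F ω p : ℂ) * f p.2 * (starRingEnd ℂ) (g p.1) ∂(μ.prod μ)) ρ) :
    ∃ a : X × X → ℝ, ∀ f g : Lp ℂ 2 μ,
      Integrable (fun p : X × X => (a p : ℂ) * f p.2 * (starRingEnd ℂ) (g p.1)) (μ.prod μ) ∧
      ∫ p, (a p : ℂ) * f p.2 * (starRingEnd ℂ) (g p.1) ∂(μ.prod μ) =
        ∫ ω, ∫ p, (F ω p : ℂ) * f p.2 * (starRingEnd ℂ) (g p.1) ∂(μ.prod μ) ∂ρ := by
  have hon : ∀ ω A B (hA : MeasurableSet A) (hB : MeasurableSet B) (hμA : μ A ≠ ∞)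
      (hμB : μ B ≠ ∞), IntegrableOn (fun p => (F ω p : ℂ)) (A ×ˢ B) (μ.prod μ) := by
    intro ω A B hA hB hμA hμB
    rw [← integrable_indicator_iff (hA.prod hB)]
    exact (hint ω _ _).congr (indicator_prod_ae_eq hA hB hμA hμB _)
  have hDm := measurableSet_spanningSets μ
  have hDf := measure_spanningSets_lt_top μ
  have hFm : ∀ ω, AEMeasurable (F ω) (μ.prod μ) := fun ω => by
    have := (aestronglyMeasurable_of_integrableOn_spanningSets fun n =>
      hon ω _ _ (hDm n) (hDm n) (hDf n).ne (hDf n).ne).re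
    simpa using this.aemeasurable
  -- Nothing is known about `F` as a function of `(ω, p)` jointly. As measures, however, the kernels
  -- depend measurably on `ω`, because their values on rectangles are test integrals; this is enough
  -- to mix them.
  set κ : Ω → Measure (X × X) := fun ω =>
    (μ.prod μ).withDensity fun p => ENNReal.ofReal (F ω p) with hκ
  have hrect : ∀ A B (hA : MeasurableSet A) (hB : MeasurableSet B) (hμA : μ A ≠ ∞)
      (hμB : μ B ≠ ∞) ω, κ ω (A ×ˢ B) = ENNReal.ofReal (∫ p, (F ω p : ℂ) *
        indicatorConstLp 2 hB hμB (1 : ℂ) p.2 *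
        (starRingEnd ℂ) (indicatorConstLp 2 hA hμA (1 : ℂ) p.1) ∂(μ.prod μ)).re := by
    intro A B hA hB hμA hμB ω
    rw [integral_test_indicator hA hB hμA hμB, integral_complex_ofReal, Complex.ofReal_re, hκ]
    simp only
    rw [withDensity_apply _ (hA.prod hB), ofReal_integral_eq_lintegral_ofReal _
      (ae_restrict_of_ae (hF ω))]
    simpa using (hon ω A B hA hB hμA hμB).re
  have hκm : Measurable κ := by
    refine measurable_measure_of_prod (μ := μ) (fun A B hA hB hμA hμB => ?_)
      fun A B hA hB hμA hμB ω => ?_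
    · simp only [hrect A B hA hB hμA.ne hμB.ne]
      exact (Complex.measurable_re.comp (hmeas _ _)).ennreal_ofReal
    · rw [hrect A B hA hB hμA.ne hμB.ne]
      exact ENNReal.ofReal_lt_top
  have hσ : SigmaFinite ((⟨κ, hκm⟩ : Kernel Ω (X × X)) ∘ₘ ρ) := by
    refine ⟨⟨⟨fun n => spanningSets μ n ×ˢ spanningSets μ n, fun _ => trivial, fun n => ?_, ?_⟩⟩⟩
    · rw [Measure.bind_apply ((hDm n).prod (hDm n)) (Kernel.aemeasurable _)]
      simp only [Kernel.coe_mk, hrect _ _ (hDm n) (hDm n) (hDf n).ne (hDf n).ne]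
      exact (hρ _ _).re.lintegral_lt_top
    · rw [Set.iUnion_prod_of_monotone (monotone_spanningSets μ) (monotone_spanningSets μ),
        iUnion_spanningSets, Set.univ_prod_univ]
  obtain ⟨a, ha⟩ := exists_density_mixture (ρ := ρ) (ν := μ.prod μ)
    (⟨κ, hκm⟩ : Kernel Ω (X × X)) fun ω => withDensity_absolutelyContinuous _ _
  have hsmul : ∀ ω (ψ : X × X → ℂ), ∫ p, ψ p ∂(κ ω) = ∫ p, (F ω p : ℂ) * ψ p ∂(μ.prod μ) := by
    intro ω ψ
    rw [hκ, integral_withDensity_eq_integral_toReal_smul₀ (hFm ω).ennreal_ofReal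
      (Eventually.of_forall fun _ => ENNReal.ofReal_lt_top)]
    refine integral_congr_ae ?_
    filter_upwards [hF ω] with p hp
    rw [ENNReal.toReal_ofReal hp, Complex.real_smul]
  refine ⟨a, fun f g => ?_⟩
  have h1 : ∀ ω, Integrable (fun p : X × X => f p.2 * (starRingEnd ℂ) (g p.1)) (κ ω) := by
    intro ω
    rw [hκ, integrable_withDensity_iff_integrable_smul₀' (hFm ω).ennreal_ofReal
      (Eventually.of_forall fun _ => ENNReal.ofReal_lt_top)]
    refine (hint ω f g).congr ?_
    filter_upwards [hF ω] with p hp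
    rw [ENNReal.toReal_ofReal hp, Complex.real_smul, mul_assoc]
  have h2 : Integrable (fun ω => ∫ p, ‖f p.2 * (starRingEnd ℂ) (g p.1)‖ ∂(κ ω)) ρ := by
    refine (hρ (absL2 f) (absL2 g)).re.congr (Eventually.of_forall fun ω => ?_)
    have h3 : ((∫ p, ‖f p.2 * (starRingEnd ℂ) (g p.1)‖ ∂(κ ω) : ℝ) : ℂ) =
        ∫ p, (F ω p : ℂ) * absL2 f p.2 * (starRingEnd ℂ) (absL2 g p.1) ∂(μ.prod μ) := by
      rw [← integral_complex_ofReal, hsmul]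
      refine integral_congr_ae ?_
      have h4 : ∀ᵐ p ∂(μ.prod μ), absL2 f p.2 = ((‖f p.2‖ : ℝ) : ℂ) :=
        Measure.quasiMeasurePreserving_snd.ae (absL2_coe f)
      have h5 : ∀ᵐ p ∂(μ.prod μ), absL2 g p.1 = ((‖g p.1‖ : ℝ) : ℂ) :=
        Measure.quasiMeasurePreserving_fst.ae (absL2_coe g)
      filter_upwards [h4, h5] with p hp1 hp2
      rw [hp1, hp2, norm_mul, RCLike.norm_conj, Complex.conj_ofReal]
      push_cast
      ring
    simp only [← h3]
    simp
  obtain ⟨h6, -, h7⟩ := ha _ (aestronglyMeasurable_test f g) h1 h2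
  simp only [← mul_assoc] at h6 h7
  refine ⟨h6, h7.trans (integral_congr_ae (Eventually.of_forall fun ω => ?_))⟩
  simp only [Kernel.coe_mk, hsmul, mul_assoc]

end KernelMixture

theorem integral_sub_add_I_mul_sub {α : Type*} [MeasurableSpace α] {ν : Measure α}
    {u v w : α → ℂ} (hu : Integrable u ν) (hv : Integrable v ν) (hw : Integrable w ν) :
    ∫ x, ((v x - u x) + Complex.I * (w x - u x)) ∂ν =
      (∫ x, v x ∂ν - ∫ x, u x ∂ν) + Complex.I * (∫ x, w x ∂ν - ∫ x, u x ∂ν) := by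
  have h1 : Integrable (fun x => v x - u x) ν := hv.sub hu
  have h2 : Integrable (fun x => w x - u x) ν := hw.sub hu
  rw [integral_add h1 (h2.const_mul _), integral_const_mul, integral_sub hv hu,
    integral_sub hw hu]

/-! ### Kernels of integrals of operators -/

section KernelIntegral

variable {Ω X : Type*} [MeasurableSpace Ω] [MeasurableSpace X] {μ : Measure X}

/-- Testing `conj k` on `f, g` amounts to testing `k` on `conj f, conj g`. Thus test integrals of
`Re k` and `Im k` are expressed through the operator, and so are measurable in a parameter. -/
theorem integrable_conj_kernel {k : X × X → ℂ} {f g : Lp ℂ 2 μ}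
    (h : Integrable (fun p : X × X => k p * (star f : Lp ℂ 2 μ) p.2 *
      (starRingEnd ℂ) ((star g : Lp ℂ 2 μ) p.1)) (μ.prod μ)) :
    Integrable (fun p : X × X => (starRingEnd ℂ) (k p) * f p.2 * (starRingEnd ℂ) (g p.1))
      (μ.prod μ) ∧
    ∫ p, (starRingEnd ℂ) (k p) * f p.2 * (starRingEnd ℂ) (g p.1) ∂(μ.prod μ) =
      (starRingEnd ℂ) (∫ p, k p * (star f : Lp ℂ 2 μ) p.2 *
        (starRingEnd ℂ) ((star g : Lp ℂ 2 μ) p.1) ∂(μ.prod μ)) := by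
  have h1 : ∀ᵐ p ∂(μ.prod μ), (star f : Lp ℂ 2 μ) p.2 = (starRingEnd ℂ) (f p.2) :=
    Measure.quasiMeasurePreserving_snd.ae (Lp.coeFn_star f)
  have h2 : ∀ᵐ p ∂(μ.prod μ), (star g : Lp ℂ 2 μ) p.1 = (starRingEnd ℂ) (g p.1) :=
    Measure.quasiMeasurePreserving_fst.ae (Lp.coeFn_star g)
  have h3 : (fun p : X × X => (starRingEnd ℂ) (k p * (star f : Lp ℂ 2 μ) p.2 *
      (starRingEnd ℂ) ((star g : Lp ℂ 2 μ) p.1))) =ᵐ[μ.prod μ]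
      fun p => (starRingEnd ℂ) (k p) * f p.2 * (starRingEnd ℂ) (g p.1) := by
    filter_upwards [h1, h2] with p hp1 hp2
    rw [hp1, hp2]
    simp
  refine ⟨((LinearIsometryEquiv.integrable_comp_iff RCLike.conjLIE).2 h).congr h3, ?_⟩
  rw [← integral_congr_ae h3, integral_conj]

variable [MetricSpace X]

/-- Test integrals of the real part of a kernel. -/
theorem HasKernel.re_test {T : Lp ℂ 2 μ →L[ℂ] Lp ℂ 2 μ} {k : X × X → ℂ} (hT : HasKernel T k)
    (f g : Lp ℂ 2 μ) :
    Integrable (fun p : X × X => ((k p).re : ℂ) * f p.2 * (starRingEnd ℂ) (g p.1)) (μ.prod μ) ∧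
    ∫ p, ((k p).re : ℂ) * f p.2 * (starRingEnd ℂ) (g p.1) ∂(μ.prod μ) =
      (inner ℂ g (T f) + (starRingEnd ℂ) (inner ℂ (star g) (T (star f)))) / 2 := by
  obtain ⟨h1, h2⟩ := integrable_conj_kernel (hT.integrable (star f) (star g))
  have h0 := hT.integrable f g
  have h3 : (fun p : X × X => ((k p).re : ℂ) * f p.2 * (starRingEnd ℂ) (g p.1)) = fun p =>
      (k p * f p.2 * (starRingEnd ℂ) (g p.1) +
        (starRingEnd ℂ) (k p) * f p.2 * (starRingEnd ℂ) (g p.1)) / 2 := by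
    ext p
    rw [Complex.re_eq_add_conj]
    ring
  rw [h3]
  refine ⟨(h0.add h1).div_const 2, ?_⟩
  rw [integral_div, integral_add h0 h1, h2, hT.inner_eq f g, hT.inner_eq (star f) (star g)]

/-- Test integrals of the imaginary part of a kernel. -/
theorem HasKernel.im_test {T : Lp ℂ 2 μ →L[ℂ] Lp ℂ 2 μ} {k : X × X → ℂ} (hT : HasKernel T k)
    (f g : Lp ℂ 2 μ) :
    Integrable (fun p : X × X => ((k p).im : ℂ) * f p.2 * (starRingEnd ℂ) (g p.1)) (μ.prod μ) ∧
    ∫ p, ((k p).im : ℂ) * f p.2 * (starRingEnd ℂ) (g p.1) ∂(μ.prod μ) =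
      (inner ℂ g (T f) - (starRingEnd ℂ) (inner ℂ (star g) (T (star f)))) / (2 * Complex.I) := by
  obtain ⟨h1, h2⟩ := integrable_conj_kernel (hT.integrable (star f) (star g))
  have h0 := hT.integrable f g
  have h3 : (fun p : X × X => ((k p).im : ℂ) * f p.2 * (starRingEnd ℂ) (g p.1)) = fun p =>
      (k p * f p.2 * (starRingEnd ℂ) (g p.1) -
        (starRingEnd ℂ) (k p) * f p.2 * (starRingEnd ℂ) (g p.1)) / (2 * Complex.I) := by
    ext p
    rw [Complex.im_eq_sub_conj]
    ring
  rw [h3]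
  refine ⟨(h0.sub h1).div_const _, ?_⟩
  rw [integral_div, integral_sub h0 h1, h2, hT.inner_eq f g, hT.inner_eq (star f) (star g)]

theorem HasKernel.norm_inner_le {T S : Lp ℂ 2 μ →L[ℂ] Lp ℂ 2 μ} {k l : X × X → ℂ}
    (hT : HasKernel T k) (hS : HasKernel S l) (hd : KernelDominated μ k l 1) (f g : Lp ℂ 2 μ) :
    ‖inner ℂ g (T f)‖ ≤ (inner ℂ (absL2 g) (S (absL2 f))).re := by
  have h4 : ∀ᵐ p ∂(μ.prod μ), absL2 f p.2 = ((‖f p.2‖ : ℝ) : ℂ) :=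
    Measure.quasiMeasurePreserving_snd.ae (absL2_coe f)
  have h5 : ∀ᵐ p ∂(μ.prod μ), absL2 g p.1 = ((‖g p.1‖ : ℝ) : ℂ) :=
    Measure.quasiMeasurePreserving_fst.ae (absL2_coe g)
  have hi := hS.integrable (absL2 f) (absL2 g)
  rw [hT.inner_eq, hS.inner_eq, ← RCLike.re_eq_complex_re, ← integral_re hi]
  refine (norm_integral_le_integral_norm _).trans
    (integral_mono_ae (hT.integrable f g).norm hi.re ?_)
  filter_upwards [h4, h5, hd] with p hp1 hp2 hp3
  rw [hp1, hp2, norm_mul, norm_mul, RCLike.norm_conj, Complex.conj_ofReal,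
    RCLike.re_eq_complex_re, Complex.re_mul_ofReal, Complex.re_mul_ofReal]
  rw [Complex.ofReal_one, one_mul] at hp3
  have := (Complex.le_def.1 hp3).1
  rw [Complex.ofReal_re] at this
  gcongr

/-- An integral of operators with kernels has a kernel, if it is dominated by an integral of
operators with nonnegative kernels. -/
theorem exists_hasKernel_of_integral {ρ : Measure Ω} {T S : Ω → Lp ℂ 2 μ →L[ℂ] Lp ℂ 2 μ}
    {T₀ : Lp ℂ 2 μ →L[ℂ] Lp ℂ 2 μ} {k l : Ω → X × X → ℂ} [SigmaFinite μ] [OpensMeasurableSpace X]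
    (hball : ∀ (a : X) (r : ℝ), μ (Metric.ball a r) < ∞)
    (hT : ∀ ω, HasKernel (T ω) (k ω)) (hS : ∀ ω, HasKernel (S ω) (l ω))
    (hd : ∀ ω, KernelDominated μ (k ω) (l ω) 1)
    (mT : ∀ f g, Measurable fun ω => inner ℂ g (T ω f))
    (mS : ∀ f g, Measurable fun ω => inner ℂ g (S ω f))
    (iS : ∀ f g, Integrable (fun ω => inner ℂ g (S ω f)) ρ)
    (hT₀ : ∀ f g, inner ℂ g (T₀ f) = ∫ ω, inner ℂ g (T ω f) ∂ρ) :
    ∃ k₀ : X × X → ℂ, HasKernel T₀ k₀ := by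
  have iT : ∀ f g, Integrable (fun ω => inner ℂ g (T ω f)) ρ := fun f g =>
    (iS (absL2 f) (absL2 g)).re.mono' (mT f g).aestronglyMeasurable
      (Eventually.of_forall fun ω => (hT ω).norm_inner_le (hS ω) (hd ω) f g)
  have hd' : ∀ ω, ∀ᵐ p ∂(μ.prod μ), ‖k ω p‖ ≤ (l ω p).re ∧ ((l ω p).re : ℂ) = l ω p := by
    intro ω
    filter_upwards [hd ω] with p hp
    rw [Complex.ofReal_one, one_mul] at hp
    have h1 := Complex.le_def.1 hp
    exact ⟨h1.1, Complex.ext rfl h1.2⟩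
  have e0 : ∀ ω (f g : Lp ℂ 2 μ),
      (fun p : X × X => l ω p * f p.2 * (starRingEnd ℂ) (g p.1)) =ᵐ[μ.prod μ]
      fun p => ((l ω p).re : ℂ) * f p.2 * (starRingEnd ℂ) (g p.1) := by
    intro ω f g
    filter_upwards [hd' ω] with p hp
    rw [hp.2]
  have i0 : ∀ ω (f g : Lp ℂ 2 μ), Integrable (fun p : X × X =>
      ((l ω p).re : ℂ) * f p.2 * (starRingEnd ℂ) (g p.1)) (μ.prod μ) := fun ω f g =>
    ((hS ω).integrable f g).congr (e0 ω f g)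
  have v0 : ∀ ω (f g : Lp ℂ 2 μ), ∫ p : X × X,
      ((l ω p).re : ℂ) * f p.2 * (starRingEnd ℂ) (g p.1) ∂(μ.prod μ) = inner ℂ g (S ω f) :=
    fun ω f g => by rw [(hS ω).inner_eq, integral_congr_ae (e0 ω f g)]
  have i1 : ∀ ω (f g : Lp ℂ 2 μ), Integrable (fun p : X × X =>
      (((l ω p).re + (k ω p).re : ℝ) : ℂ) * f p.2 * (starRingEnd ℂ) (g p.1)) (μ.prod μ) :=
    fun ω f g => by
      refine ((i0 ω f g).add ((hT ω).re_test f g).1).congr (Eventually.of_forall fun p => ?_)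
      simp only [Pi.add_apply]
      push_cast
      ring
  have v1 : ∀ ω (f g : Lp ℂ 2 μ), ∫ p : X × X,
      (((l ω p).re + (k ω p).re : ℝ) : ℂ) * f p.2 * (starRingEnd ℂ) (g p.1) ∂(μ.prod μ) =
      inner ℂ g (S ω f) +
        (inner ℂ g (T ω f) + (starRingEnd ℂ) (inner ℂ (star g) (T ω (star f)))) / 2 :=
    fun ω f g => by
      rw [← v0, ← ((hT ω).re_test f g).2, ← integral_add (i0 ω f g) ((hT ω).re_test f g).1]
      refine integral_congr_ae (Eventually.of_forall fun p => ?_)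
      simp only
      push_cast
      ring
  have i2 : ∀ ω (f g : Lp ℂ 2 μ), Integrable (fun p : X × X =>
      (((l ω p).re + (k ω p).im : ℝ) : ℂ) * f p.2 * (starRingEnd ℂ) (g p.1)) (μ.prod μ) :=
    fun ω f g => by
      refine ((i0 ω f g).add ((hT ω).im_test f g).1).congr (Eventually.of_forall fun p => ?_)
      simp only [Pi.add_apply]
      push_cast
      ring
  have v2 : ∀ ω (f g : Lp ℂ 2 μ), ∫ p : X × X,
      (((l ω p).re + (k ω p).im : ℝ) : ℂ) * f p.2 * (starRingEnd ℂ) (g p.1) ∂(μ.prod μ) =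
      inner ℂ g (S ω f) +
        (inner ℂ g (T ω f) - (starRingEnd ℂ) (inner ℂ (star g) (T ω (star f))))
          / (2 * Complex.I) :=
    fun ω f g => by
      rw [← v0, ← ((hT ω).im_test f g).2, ← integral_add (i0 ω f g) ((hT ω).im_test f g).1]
      refine integral_congr_ae (Eventually.of_forall fun p => ?_)
      simp only
      push_cast
      ring
  have mc : ∀ f g : Lp ℂ 2 μ,
      Measurable fun ω => (starRingEnd ℂ) (inner ℂ (star g) (T ω (star f))) := fun f g =>
    Complex.continuous_conj.measurable.comp (mT _ _)
  have ic : ∀ f g : Lp ℂ 2 μ,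
      Integrable (fun ω => (starRingEnd ℂ) (inner ℂ (star g) (T ω (star f)))) ρ := fun f g =>
    (LinearIsometryEquiv.integrable_comp_iff RCLike.conjLIE).2 (iT _ _)
  -- As `|k| ≤ l`, the kernels `l`, `l + Re k` and `l + Im k` are nonnegative and can be mixed. The
  -- identity `k = ((l + Re k) - l) + i ((l + Im k) - l)` then recombines the three densities.
  obtain ⟨a0, h0⟩ := exists_kernel_mixture (ρ := ρ) (F := fun ω p => (l ω p).re)
    (fun ω => by
      filter_upwards [hd' ω] with p hp
      exact (norm_nonneg _).trans hp.1) i0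
    (fun f g => by simp only [v0]; exact mS f g) (fun f g => by simp only [v0]; exact iS f g)
  obtain ⟨a1, h1⟩ := exists_kernel_mixture (ρ := ρ) (F := fun ω p => (l ω p).re + (k ω p).re)
    (fun ω => by
      filter_upwards [hd' ω] with p hp
      linarith [(abs_le.1 (Complex.abs_re_le_norm (k ω p))).1]) i1
    (fun f g => by
      simp only [v1]; exact (mS f g).add (((mT f g).add (mc f g)).div_const _))
    (fun f g => by
      simp only [v1]; exact (iS f g).add (((iT f g).add (ic f g)).div_const _))
  obtain ⟨a2, h2⟩ := exists_kernel_mixture (ρ := ρ) (F := fun ω p => (l ω p).re + (k ω p).im)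
    (fun ω => by
      filter_upwards [hd' ω] with p hp
      linarith [(abs_le.1 (Complex.abs_im_le_norm (k ω p))).1]) i2
    (fun f g => by
      simp only [v2]; exact (mS f g).add (((mT f g).sub (mc f g)).div_const _))
    (fun f g => by
      simp only [v2]; exact (iS f g).add (((iT f g).sub (ic f g)).div_const _))
  have e3 : ∀ f g : Lp ℂ 2 μ, (fun p : X × X =>
      (((a1 p : ℂ) - a0 p) + Complex.I * ((a2 p : ℂ) - a0 p)) * f p.2 *
        (starRingEnd ℂ) (g p.1)) = fun p =>
      ((a1 p : ℂ) * f p.2 * (starRingEnd ℂ) (g p.1) - a0 p * f p.2 * (starRingEnd ℂ) (g p.1)) +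
      Complex.I * ((a2 p : ℂ) * f p.2 * (starRingEnd ℂ) (g p.1) -
        a0 p * f p.2 * (starRingEnd ℂ) (g p.1)) := fun f g => by
    ext p
    ring
  have i3 : ∀ f g : Lp ℂ 2 μ, Integrable (fun p : X × X =>
      (((a1 p : ℂ) - a0 p) + Complex.I * ((a2 p : ℂ) - a0 p)) * f p.2 *
        (starRingEnd ℂ) (g p.1)) (μ.prod μ) := fun f g => by
    rw [e3]
    exact ((h1 f g).1.sub (h0 f g).1).add (((h2 f g).1.sub (h0 f g).1).const_mul _)
  refine ⟨fun p => ((a1 p : ℂ) - a0 p) + Complex.I * ((a2 p : ℂ) - a0 p), ?_, i3, ?_⟩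
  · intro a r
    -- Balls have finite measure, so their indicators are admissible test functions in `L²`.
    rw [← integrable_indicator_iff (measurableSet_ball.prod measurableSet_ball)]
    exact (i3 _ _).congr (indicator_prod_ae_eq measurableSet_ball measurableSet_ball
      (hball a r).ne (hball a r).ne _)
  · intro f g
    have w0 := (iS f g)
    have w1 : Integrable (fun ω => inner ℂ g (S ω f) +
        (inner ℂ g (T ω f) + (starRingEnd ℂ) (inner ℂ (star g) (T ω (star f)))) / 2) ρ :=
      (iS f g).add (((iT f g).add (ic f g)).div_const _)
    have w2 : Integrable (fun ω => inner ℂ g (S ω f) +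
        (inner ℂ g (T ω f) - (starRingEnd ℂ) (inner ℂ (star g) (T ω (star f))))
          / (2 * Complex.I)) ρ :=
      (iS f g).add (((iT f g).sub (ic f g)).div_const _)
    rw [e3, integral_sub_add_I_mul_sub (h0 f g).1 (h1 f g).1 (h2 f g).1,
      (h0 f g).2, (h1 f g).2, (h2 f g).2]
    simp only [v0, v1, v2]
    rw [← integral_sub_add_I_mul_sub w0 w1 w2, hT₀]
    refine integral_congr_ae (Eventually.of_forall fun ω => ?_)
    simp only
    field_simp
    ring

end KernelIntegral

/-! ### Domination on nonnegative functions -/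

section NonnegDomination

variable {X : Type*} [MeasurableSpace X] {μ : Measure X} {T S : Lp ℂ 2 μ →L[ℂ] Lp ℂ 2 μ} {c : ℝ}

/-- `|T f| ≤ c S f` almost everywhere, for all nonnegative `f ∈ L²(X)`. -/
def DominatedOnNonneg (T S : Lp ℂ 2 μ →L[ℂ] Lp ℂ 2 μ) (c : ℝ) : Prop :=
  ∀ f : Lp ℂ 2 μ, (∀ᵐ x ∂μ, 0 ≤ f x) → ∀ᵐ x ∂μ, ((‖T f x‖ : ℝ) : ℂ) ≤ (c : ℂ) * S f x

theorem ofReal_norm_of_nonneg {w : ℂ} (hw : 0 ≤ w) : ((‖w‖ : ℝ) : ℂ) = w := by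
  exact RCLike.norm_of_nonneg' hw

theorem Dominated.onNonneg (h : Dominated T S c) : DominatedOnNonneg T S c := by
  intro f hf
  have hf' : absL2 f = f := by
    refine Lp.ext ?_
    filter_upwards [absL2_coe f, hf] with x hx h0
    rw [hx, ofReal_norm_of_nonneg h0]
  have := h f
  rwa [hf'] at this

/-- Lets `G` dominate itself, so that the kernels of its Poisson semigroup come from the same
existence result. The rectangle test involves nonnegative functions only. -/
theorem IsPositivityPreserving.dominatedOnNonneg (h : IsPositivityPreserving T) :
    DominatedOnNonneg T T 1 := by
  intro f hf
  filter_upwards [h f hf] with x hx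
  rw [ofReal_norm_of_nonneg hx, Complex.ofReal_one, one_mul]

theorem DominatedOnNonneg.smul (h : DominatedOnNonneg T S c) (a : ℂ) :
    DominatedOnNonneg (a • T) (((‖a‖ * c : ℝ) : ℂ) • S) 1 := by
  intro f hf
  filter_upwards [h f hf, Lp.coeFn_smul a (T f), Lp.coeFn_smul ((‖a‖ * c : ℝ) : ℂ) (S f)]
    with x h1 h2 h3
  rw [smul_apply, smul_apply, h2, h3, Complex.ofReal_one, one_mul]
  simp only [Pi.smul_apply, smul_eq_mul, norm_mul, Complex.ofReal_mul]
  rw [mul_assoc]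
  exact mul_le_mul_of_nonneg_left h1 (Complex.zero_le_real.2 (norm_nonneg a))

end NonnegDomination

/-! ### Kernels of the Poisson operators and their derivatives -/

section SubordinateKernels

variable {X : Type*} [MetricSpace X] [MeasurableSpace X] {μ : Measure X}

theorem HasKernel.smul {T : Lp ℂ 2 μ →L[ℂ] Lp ℂ 2 μ} {k : X × X → ℂ} (hT : HasKernel T k)
    (c : ℂ) : HasKernel (c • T) (fun p => c * k p) where
  integrableOn a r := (hT.integrableOn a r).const_mul c
  integrable f g := by
    simpa only [mul_assoc] using (hT.integrable f g).const_mul c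
  inner_eq f g := by
    rw [smul_apply, inner_smul_right, hT.inner_eq, ← integral_const_mul]
    simp only [mul_assoc]

variable [BorelSpace X] [SigmaFinite μ] {H G : ℝ → Lp ℂ 2 μ →L[ℂ] Lp ℂ 2 μ} {B B' C : ℝ}

/-- The subordinated semigroup of a dominated semigroup has kernels. -/
theorem exists_hasKernel_subordinate (hH : IsC0SemigroupBddBy H B)
    (hG : IsC0SemigroupBddBy G B') (hd : ∀ t, 0 < t → DominatedOnNonneg (H t) (G t) C)
    (hball : ∀ (a : X) (r : ℝ), μ (Metric.ball a r) < ∞)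
    (kH : ∀ t, 0 < t → ∃ h : X × X → ℂ, HasKernel (H t) h)
    (kG : ∀ t, 0 < t → ∃ g : X × X → ℂ, HasKernel (G t) g) {z : ℂ} (hz : z ∈ diagSector) :
    ∃ k : X × X → ℂ, HasKernel (subordinate H z) k := by
  choose h hh using fun s : Set.Ioi (0 : ℝ) => kH s s.2
  choose g hg using fun s : Set.Ioi (0 : ℝ) => kG s s.2
  have hη := integrableOn_subDensity hz
  have cη : Continuous fun s : Set.Ioi (0 : ℝ) => subDensity z s :=
    (continuousOn_subDensity z).domRestrict
  have cH : ∀ {F : ℝ → Lp ℂ 2 μ →L[ℂ] Lp ℂ 2 μ}, IsC0Semigroup F → ∀ f : Lp ℂ 2 μ,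
      Continuous fun s : Set.Ioi (0 : ℝ) => F s f := fun hF f =>
    ((hF.continuousOn f).mono Set.Ioi_subset_Ici_self).domRestrict
  have hη' : IntegrableOn (fun s => ((‖subDensity z s‖ * C : ℝ) : ℂ)) (Set.Ioi 0) :=
    (hη.norm.mul_const C).ofReal
  -- The parameter space is the type of positive times, because kernels are required for every
  -- parameter and are given for `s > 0` only.
  refine exists_hasKernel_of_integral (ρ := Measure.comap Subtype.val (volume : Measure ℝ))
    (T := fun s : Set.Ioi (0 : ℝ) => subDensity z s • H s)
    (S := fun s : Set.Ioi (0 : ℝ) => ((‖subDensity z s‖ * C : ℝ) : ℂ) • G s)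
    hball (fun s => (hh s).smul _) (fun s => (hg s).smul _)
    (fun s => ((hh s).smul _).kernelDominated ((hg s).smul _) ((hd s s.2).smul _))
    ?_ ?_ ?_ ?_
  · intro f g
    exact (continuous_const.inner (cη.smul (cH hH.toIsC0Semigroup f))).measurable
  · intro f g
    exact (continuous_const.inner ((Complex.continuous_ofReal.comp
      (cη.norm.mul continuous_const)).smul (cH hG.toIsC0Semigroup f))).measurable
  · intro f g
    have h1 : IntegrableOn (fun s => inner ℂ g (((‖subDensity z s‖ * C : ℝ) : ℂ) • G s f))
        (Set.Ioi 0) := (hG.integrableOn hη' f).const_inner g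
    exact (integrableOn_iff_comap_subtypeVal measurableSet_Ioi).1 h1
  · intro f g
    rw [subordinate_of_mem hz, hH.weightedAvg_apply hη, ← integral_inner]
    · exact (integral_subtype_comap measurableSet_Ioi
        fun s => inner ℂ g (subDensity z s • H s f)).symm
    · exact hH.integrableOn hη f

/-- The time derivatives of the Poisson semigroup of a dominated semigroup have kernels. -/
theorem exists_hasKernel_poissonDeriv {L : Lp ℂ 2 μ →ₗ.[ℂ] Lp ℂ 2 μ}
    (hH : IsC0SemigroupBddBy H B) (hL : IsSemigroupOf H L)
    (hG : IsC0SemigroupBddBy G B') (hd : ∀ t, 0 < t → Dominated (H t) (G t) C)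
    (hball : ∀ (a : X) (r : ℝ), μ (Metric.ball a r) < ∞)
    (kP : ∀ z ∈ diagSector, ∃ p : X × X → ℂ, HasKernel (subordinate H z) p)
    (kQ : ∀ t : ℝ, 0 < t → ∃ q : X × X → ℂ, HasKernel (subordinate G t) q)
    {t : ℝ} (ht : 0 < t) (k : ℕ) :
    ∃ p : X × X → ℂ, HasKernel (poissonDeriv L t k) p := by
  -- Only existence is at stake, so any fixed `θ` in `(0, 1)` would do.
  have hθ0 : (0 : ℝ) < 1 / 2 := by norm_num
  have hθ1 : (1 / 2 : ℝ) < 1 := by norm_num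
  set θ : ℝ := 1 / 2
  have hb := circleMap_bounds hθ0 hθ1 ht
  have hR0 : 0 < (1 - θ ^ 2) / 4 * t := mul_pos (by norm_num [θ]) ht
  have hRt : 2 * ((1 - θ ^ 2) / 4 * t) < t := by norm_num [θ]; linarith
  set R := (1 - θ ^ 2) / 4 * t
  choose p hp using fun φ => kP _ (hb φ).1
  obtain ⟨q, hq⟩ := kQ _ (mul_pos hθ0 ht)
  have cT : Continuous fun φ => cauchyCoeff k t R φ • subordinate H (circleMap t R φ) :=
    (continuous_cauchyCoeff k t hR0).smul (continuous_subordinate_circleMap hH hR0.le hRt)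
  have h2π : (0 : ℝ) ≤ 2 * Real.pi := by positivity
  refine exists_hasKernel_of_integral (ρ := volume.restrict (Set.Ioc 0 (2 * Real.pi)))
    (T := fun φ => cauchyCoeff k t R φ • subordinate H (circleMap t R φ))
    (S := fun φ => ((‖cauchyCoeff k t R φ‖ * (2 / θ * C) : ℝ) : ℂ) •
      subordinate G ((θ * t : ℝ) : ℂ))
    hball (fun φ => (hp φ).smul _) (fun φ => hq.smul _)
    (fun φ => ((hp φ).smul _).kernelDominated (hq.smul _)
      ((dominated_subordinate hH hG hd (hb φ).1 (mul_pos hθ0 ht) (hb φ).2.1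
        (hb φ).2.2).onNonneg.smul _)) ?_ ?_ ?_ ?_
  · intro f g
    exact (continuous_const.inner (cT.clm_apply continuous_const)).measurable
  · intro f g
    simp only [norm_cauchyCoeff k ht.le hR0.le]
    exact measurable_const
  · intro f g
    simp only [norm_cauchyCoeff k ht.le hR0.le]
    exact integrable_const _
  · intro f g
    rw [poissonDeriv_eq_integral hH hL hR0 hRt k f, intervalIntegral.integral_of_le h2π,
      ← integral_inner]
    · rfl
    · exact ((cT.clm_apply continuous_const).intervalIntegrable _ _).1

end SubordinateKernels

/-! ### The constant on the closed sector -/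

section ClosedSector

variable {X : Type*} [MeasurableSpace X] {μ : Measure X} {H G : ℝ → Lp ℂ 2 μ →L[ℂ] Lp ℂ 2 μ}
  {B B' C β : ℝ}

/-- The constant for the bounds on the sector of half-angle `β`. -/
def sectorConst (β : ℝ) : ℝ := √(Real.cos (2 * β))

theorem sectorConst_pos (h0 : 0 < β) (hβ : β < Real.pi / 4) : 0 < sectorConst β :=
  Real.sqrt_pos.2 (cos_two_mul_pos h0 hβ)

theorem sectorConst_lt_one (h0 : 0 < β) (hβ : β < Real.pi / 4) : sectorConst β < 1 := by
  rw [sectorConst, Real.sqrt_lt' one_pos, one_pow, ← Real.cos_zero]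
  exact Real.cos_lt_cos_of_nonneg_of_le_pi le_rfl (by linarith [Real.pi_pos]) (by linarith)

theorem closedSector_re_pos (h0 : 0 < β) (hβ : β < Real.pi / 4) {z : ℂ}
    (hz : z ∈ closedSector β) (hz0 : z ≠ 0) : 0 < z.re :=
  diagSector_re_pos (mem_subSector_of_closedSector h0 hβ hz hz0).1

/-- With `τ = √(cos 2β) Re z` one has `τ² ≤ |z|² cos 2β ≤ Re z²`. Moreover `Re z² > 0` means `|Im z|
< Re z`, so `|z| ≤ √2 Re z`. -/
theorem dominated_closedSector (hH : IsC0SemigroupBddBy H B) (hG : IsC0SemigroupBddBy G B')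
    (hd : ∀ t, 0 < t → Dominated (H t) (G t) C) (hC : 0 < C) (h0 : 0 < β)
    (hβ : β < Real.pi / 4) {z : ℂ} (hz : z ∈ closedSector β) :
    Dominated (subordinate H z) (subordinate G (sectorConst β * z.re : ℝ))
      (√2 * (sectorConst β)⁻¹ * C) := by
  have hγ := sectorConst_pos h0 hβ
  have hγ1 := sectorConst_lt_one h0 hβ
  have h2 : (1 : ℝ) ≤ √2 := Real.one_le_sqrt.2 one_le_two
  rcases eq_or_ne z 0 with rfl | hz0
  -- At `z = 0` both operators are the identity. The domination there is the limit `t → 0` of the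
  -- hypothesis, with `C`, which is below the stated constant.
  · rw [Complex.zero_re, mul_zero, Complex.ofReal_zero, subordinate_zero, subordinate_zero]
    refine (dominated_one hH hG hd).one_mono (le_mul_of_one_le_left hC.le ?_)
    exact one_le_mul_of_one_le_of_one_le h2 ((one_le_inv₀ hγ).2 hγ1.le)
  · have hdiag := (mem_subSector_of_closedSector h0 hβ hz hz0).1
    have hre := closedSector_re_pos h0 hβ hz hz0
    have hsq := diagSector_re_sq_pos hdiag
    have hn : ‖z‖ ^ 2 = z.re ^ 2 + z.im ^ 2 := by
      rw [← Complex.normSq_eq_norm_sq, Complex.normSq_apply]; ring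
    refine dominated_subordinate hH hG hd hdiag (mul_pos hγ hre) ?_ ?_
    · have h1 : √2 * (sectorConst β)⁻¹ * (sectorConst β * z.re) = √2 * z.re := by
        field_simp
      rw [h1]
      refine abs_le_of_sq_le_sq' ?_ (by positivity) |>.2
      rw [mul_pow, Real.sq_sqrt zero_le_two, hn]
      rw [re_sq] at hsq
      linarith
    · refine le_trans ?_ (cos_sq_sub_sin_sq_ge hβ hz)
      rw [mul_pow, sectorConst, Real.sq_sqrt (cos_two_mul_pos h0 hβ).le, mul_comm]
      refine mul_le_mul_of_nonneg_right ?_ (cos_two_mul_pos h0 hβ).le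
      rw [hn]
      nlinarith [sq_nonneg z.im]

end ClosedSector

end PoissonDomination

end

/-! ### The main theorem -/

open PoissonDomination in
theorem mainTheorem8 :
    ∃ (K : ℕ → ℝ → ℝ) (γ : ℝ → ℝ),
      (∀ β : ℝ, 0 < β → β < Real.pi / 4 → 0 < γ β ∧ γ β < 1) ∧
      ∀ (X : Type*) [MetricSpace X] [MeasurableSpace X] [BorelSpace X]
        (μ : Measure X) [SigmaFinite μ]
        (L M : Lp ℂ 2 μ →ₗ.[ℂ] Lp ℂ 2 μ) (G : ℝ → Lp ℂ 2 μ →L[ℂ] Lp ℂ 2 μ) (C : ℝ),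
        0 < C →
        IsPositiveSelfAdjoint L →
        IsSemigroupOf G M → IsBoundedSemigroup G →
        (∀ t : ℝ, 0 < t → IsPositivityPreserving (G t)) →
        (∀ t : ℝ, 0 < t → Dominated (opExp L t) (G t) C) →
        -- bounds for the time derivatives
        (∀ (k : ℕ) (θ t : ℝ), 1 ≤ k → 0 < θ → θ < 1 → 0 < t →
          IsPoissonDeriv L t k (poissonDeriv L t k) ∧
          Dominated (poissonDeriv L t k) (poisson M (θ * t)) (K k θ * C)) ∧
        -- the extension to complex times and its bound
        (∀ β : ℝ, 0 < β → β < Real.pi / 4 →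
          ∃ P : ℂ → Lp ℂ 2 μ →L[ℂ] Lp ℂ 2 μ, IsPoissonExtension L β P ∧
            (∀ z ∈ closedSector β,
              Dominated (P z) (poisson M (γ β * z.re)) (√2 * (γ β)⁻¹ * C)) ∧
            -- the kernels of the extension
            ((∀ (a : X) (r : ℝ), μ (Metric.ball a r) < ∞) →
              (∀ t : ℝ, 0 < t → ∃ h : X × X → ℂ, HasKernel (opExp L t) h) →
              (∀ t : ℝ, 0 < t → ∃ g : X × X → ℂ, HasKernel (G t) g) →
              ∀ z ∈ closedSector β, z ≠ 0 →
                (∃ p : X × X → ℂ, HasKernel (P z) p) ∧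
                ∀ p q : X × X → ℂ, HasKernel (P z) p → HasKernel (poisson M (γ β * z.re)) q →
                  KernelDominated μ p q (√2 * (γ β)⁻¹ * C))) ∧
        -- the kernels of the Poisson operators and of the time derivatives
        ((∀ (a : X) (r : ℝ), μ (Metric.ball a r) < ∞) →
          (∀ t : ℝ, 0 < t → ∃ h : X × X → ℂ, HasKernel (opExp L t) h) →
          (∀ t : ℝ, 0 < t → ∃ g : X × X → ℂ, HasKernel (G t) g) →
          (∀ t : ℝ, 0 < t →
            (∃ q : X × X → ℂ, HasKernel (poisson M t) q) ∧
            (∃ p : X × X → ℂ, HasKernel (poisson L t) p) ∧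
            ∀ k : ℕ, 1 ≤ k → ∃ p : X × X → ℂ, HasKernel (poissonDeriv L t k) p) ∧
          ∀ (k : ℕ) (θ t : ℝ), 1 ≤ k → 0 < θ → θ < 1 → 0 < t →
            ∀ p q : X × X → ℂ, HasKernel (poissonDeriv L t k) p →
              HasKernel (poisson M (θ * t)) q → KernelDominated μ p q (K k θ * C)) := by

  refine ⟨derivConst, sectorConst, fun β h0 hβ => ⟨sectorConst_pos h0 hβ, sectorConst_lt_one h0 hβ⟩,
    fun X _ _ _ μ _ L M G C hC hL hGM hGb hGp hdom => ?_⟩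
  -- Existence of one semigroup generated by `-L` gives meaning to `opExp L`, and uniqueness
  -- transfers the contraction bound to it.
  obtain ⟨T, hT, hT1⟩ := hL.exists_semigroup
  obtain ⟨B, hB⟩ := hGb
  have hG : IsC0SemigroupBddBy G B := ⟨hGM.toIsC0Semigroup, hB⟩
  have hHL : IsSemigroupOf (opExp L) L := isSemigroupOf_opExp hT
  have hH : IsC0SemigroupBddBy (opExp L) 1 :=
    ⟨hHL.toIsC0Semigroup, fun t ht => by rw [opExp_eq hT ht]; exact hT1.norm_le t ht⟩
  have hposG : ∀ t, 0 < t → DominatedOnNonneg (G t) (G t) 1 := fun t ht =>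
    (hGp t ht).dominatedOnNonneg
  have hQ : ∀ t : ℝ, 0 ≤ t → poisson M t = subordinate G t := fun t ht =>
    poisson_eq_subordinate hG hGM ht
  have hderiv : ∀ (k : ℕ) (θ t : ℝ), 0 < θ → θ < 1 → 0 < t →
      Dominated (poissonDeriv L t k) (poisson M (θ * t)) (derivConst k θ * C) :=
    fun k θ t h0 h1 ht => by
      rw [hQ _ (mul_pos h0 ht).le]
      exact dominated_poissonDeriv hH hHL hG hdom h0 h1 ht k
  have hsector : ∀ β : ℝ, 0 < β → β < Real.pi / 4 → ∀ z ∈ closedSector β,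
      Dominated (subordinate (opExp L) z) (poisson M (sectorConst β * z.re))
        (√2 * (sectorConst β)⁻¹ * C) := fun β h0 hβ z hz => by
    rw [hQ _ (mul_nonneg (sectorConst_pos h0 hβ).le (closedSector_re_nonneg hβ hz))]
    exact dominated_closedSector hH hG hdom hC h0 hβ hz
  refine ⟨fun k θ t _ h0 h1 ht => ⟨(poissonDeriv_spec hH hHL ht k).1, hderiv k θ t h0 h1 ht⟩,
    fun β h0 hβ => ⟨subordinate (opExp L), isPoissonExtension_subordinate hH hHL h0 hβ,
      hsector β h0 hβ, fun hball kH kG z hz hz0 => ⟨?_, fun p q hp hq =>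
        hp.kernelDominated hq (hsector β h0 hβ z hz).onNonneg⟩⟩,
    fun hball kH kG => ?_⟩
  · exact exists_hasKernel_subordinate hH hG (fun t ht => (hdom t ht).onNonneg) hball kH kG
      (mem_subSector_of_closedSector h0 hβ hz hz0).1
  · have kP : ∀ z ∈ diagSector, ∃ p : X × X → ℂ, HasKernel (subordinate (opExp L) z) p :=
      fun z hz => exists_hasKernel_subordinate hH hG (fun t ht => (hdom t ht).onNonneg)
        hball kH kG hz
    have kQ : ∀ t : ℝ, 0 < t → ∃ q : X × X → ℂ, HasKernel (subordinate G t) q :=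
      fun t ht => exists_hasKernel_subordinate hG hG hposG hball kG kG (ofReal_mem_diagSector ht)
    refine ⟨fun t ht => ⟨?_, ?_, fun k _ => exists_hasKernel_poissonDeriv hH hHL hG hdom hball
      kP kQ ht k⟩, fun k θ t _ h0 h1 ht p q hp hq =>
        hp.kernelDominated hq (hderiv k θ t h0 h1 ht).onNonneg⟩
    · rw [hQ t ht.le]
      exact kQ t ht
    · rw [poisson_eq_subordinate hH hHL ht.le]
      exact kP _ (ofReal_mem_diagSector ht)
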